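/- Let $b>a>0$. Let $X_1,X_2,\dots$ and $Y_1,Y_2,\dots$ be two independent sequences of i.i.d. non-negative random variables, with moments $a_k=\mathbf{E}X_1^k$ and $b_k=\mathbf{E}Y_1^k$, such that $\mathbf{E}X_1^4<\infty$, $\mathbf{E}Y_1^3<\infty$, $\mathbf{P}(X_1>0)>0$ and $\mathbf{P}(Y_1>0)>0$. Given these weights, let $H_{X,Y}$ be the random bipartite graph with parts $\{w_1,w_2,\dots\}$ and $\{v_1,v_2,\dots\}$ in which the edges $\{w_i,v_j\}$ are inserted independently with probabilities $$p_{ij}=\min\Bigl\{1,\frac{X_iY_j}{\sqrt{ij}}\Bigr\}\,\mathbb{I}_{\{aj\le i\le bj\}}$$ (that is, $\tau(t)=t$). Let $G_{X,Y}$ be the random intersection graph on $\{v_1,v_2,\dots\}$ in which two distinct vertices $u,v$ are adjacent ($u\sim v$) whenever they have a common neighbour in $H_{X,Y}$, and let $d(v_t)$ be the degree of $v_t$ in $G_{X,Y}$. Let $\mathbf{E}_{st}$ denote the conditional expectation given the event $v_s\sim v_t$, let $\mathbf{Var}_{st}Z=\mathbf{E}_{st}Z^2-(\mathbf{E}_{st}Z)^2$,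 and let $$r_{st}=\frac{\mathbf{E}_{st}d(v_s)d(v_t)-\mathbf{E}_{st}d(v_s)\,\mathbf{E}_{st}d(v_t)}{\sqrt{\mathbf{Var}_{st}d(v_s)\,\mathbf{Var}_{st}d(v_t)}}$$ be the assortativity coefficient. Put $\tilde\gamma=2(a^{-1/2}-b^{-1/2})$ and $$h_1=a_2b_1^2,\quad h_2=a_3b_1^3\tilde\gamma,\quad h_3=a_2^2b_1^2b_2\tilde\gamma(\sqrt b-\sqrt a),\quad h_4=a_4b_1^4\tilde\gamma^2,$$ $$h_5=a_2a_3b_1^3b_2\tilde\gamma^2(\sqrt b-\sqrt a),\quad h_6=a_2^3b_1^3b_3\tilde\gamma^2(\sqrt b-\sqrt a)^2,\quad h_7=a_2^3b_1^2b_2^2\tilde\gamma^2(\sqrt b-\sqrt a)^2,$$ $$\delta_1=1+h_1^{-1}(h_2+2h_3),\quad \delta_2=1+h_1^{-1}(3h_2+6h_3+h_4+6h_5+4h_6),\quad \Delta=h_1^{-1}\bigl(2h_3+2h_5+4(h_6-h_7)\bigr).$$ Let $s,t\to\infty$ with $s<t$ and $bs-at\to+\infty$. Then, eventually, $\mathbf{P}(v_s\sim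 v_t)>0$ and $d(v_s),d(v_t)$ have finite second moments conditionally on $v_s\sim v_t$, and $$\mathbf{E}_{st}d(v_s)=\mathbf{E}_{st}d(v_t)+o(1)=\delta_1+o(1),\qquad \mathbf{E}_{st}d^2(v_s)=\mathbf{E}_{st}d^2(v_t)+o(1)=\delta_2+o(1),$$ $$\mathbf{E}_{st}d(v_s)d(v_t)=\delta_2-\Delta+o(1).$$ Moreover $\delta_2-\delta_1^2>0$, and $$r_{st}=1-\frac{\Delta}{\delta_2-\delta_1^2}+o(1).$$ -/

import Mathlib

open MeasureTheory ProbabilityTheory Filter Topology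
open scoped NNReal

noncomputable section

namespace RandomIntersection

/-- The weights: `w.1 i` is the weight `x_i` of the item `w_i`, `w.2 j` is the weight `y_j` of the
actor `v_j`. Items and actors of the model are numbered `1, 2, …`; the additional index `0` plays
no role, because `edgeProb` vanishes as soon as one of the two indices is `0`. -/
abbrev Weights : Type := (ℕ → ℝ≥0) × (ℕ → ℝ≥0)

/-- A bipartite graph with parts `W = {w_i}` and `V = {v_j}`: `H (i, j) = true` means that
`{w_i, v_j}` is an edge. -/
abbrev BipartiteGraph : Type := ℕ × ℕ → Bool

/-- The probability `p_{ij} = min {1, x_i y_j / √(i j)} 𝟙{a τ(j) ≤ i ≤ b τ(j)}` of the edge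
`{w_i, v_j}`. -/
def edgeProb (a b : ℝ) (τ : ℕ → ℝ) (w : Weights) (i j : ℕ) : ℝ :=
  if a * τ j ≤ i ∧ (i : ℝ) ≤ b * τ j then
    min 1 ((w.1 i : ℝ) * (w.2 j : ℝ) / √((i : ℝ) * (j : ℝ)))
  else 0

lemma edgeProb_mem_unitInterval (a b : ℝ) (τ : ℕ → ℝ) (w : Weights) (i j : ℕ) :
    edgeProb a b τ w i j ∈ unitInterval := by
  unfold edgeProb
  split_ifs
  · exact ⟨le_min zero_le_one (by positivity), min_le_left _ _⟩
  · exact ⟨le_rfl, zero_le_one⟩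

lemma edgeProb_zero_left (a b : ℝ) (τ : ℕ → ℝ) (w : Weights) (j : ℕ) :
    edgeProb a b τ w 0 j = 0 := by
  simp [edgeProb]

lemma edgeProb_zero_right (a b : ℝ) (τ : ℕ → ℝ) (w : Weights) (i : ℕ) :
    edgeProb a b τ w i 0 = 0 := by
  simp [edgeProb]

lemma measurable_edgeProb (a b : ℝ) (τ : ℕ → ℝ) (i j : ℕ) :
    Measurable fun w : Weights => edgeProb a b τ w i j := by
  unfold edgeProb
  split_ifs
  · fun_prop
  · exact measurable_const

/-- The law of the random bipartite graph `H_{x,y}` with given weights: the edges `{w_i, v_j}` are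
inserted independently, with probabilities `p_{ij}`. -/
def bipartiteLaw (a b : ℝ) (τ : ℕ → ℝ) (w : Weights) : Measure BipartiteGraph :=
  Measure.infinitePi fun e : ℕ × ℕ =>
    bernoulliMeasure true false ⟨edgeProb a b τ w e.1 e.2, edgeProb_mem_unitInterval a b τ w e.1 e.2⟩

instance (a b : ℝ) (τ : ℕ → ℝ) (w : Weights) : IsProbabilityMeasure (bipartiteLaw a b τ w) := by
  unfold bipartiteLaw
  infer_instance

lemma measurable_bipartiteLaw (a b : ℝ) (τ : ℕ → ℝ) : Measurable (bipartiteLaw a b τ) := by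
  refine Measurable.measure_of_isPiSystem_of_isProbabilityMeasure
    (generateFrom_squareCylinders (α := fun _ : ℕ × ℕ => Bool)).symm
    (isPiSystem_squareCylinders (fun _ => MeasurableSpace.isPiSystem_measurableSet)
      (fun _ => (MeasurableSet.univ : MeasurableSet (Set.univ : Set Bool)))) ?_
  rintro _ ⟨s, t, ht, rfl⟩
  have h : ∀ w, bipartiteLaw a b τ w ((s : Set (ℕ × ℕ)).pi t) = ∏ e ∈ s,
      bernoulliMeasure true false
        ⟨edgeProb a b τ w e.1 e.2, edgeProb_mem_unitInterval a b τ w e.1 e.2⟩ (t e) := by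
    intro w
    exact Measure.infinitePi_pi _ fun i _ => ht i (Set.mem_univ i)
  simp_rw [h]
  refine Finset.measurable_prod _ fun e _ => ?_
  have hm := measurable_edgeProb a b τ e.1 e.2
  have hp : Measurable fun w : Weights => (⟨edgeProb a b τ w e.1 e.2,
      edgeProb_mem_unitInterval a b τ w e.1 e.2⟩ : unitInterval) := hm.subtype_mk
  have hq : Measurable fun w : Weights => unitInterval.symm (⟨edgeProb a b τ w e.1 e.2,
      edgeProb_mem_unitInterval a b τ w e.1 e.2⟩ : unitInterval) :=
    unitInterval.continuous_symm.measurable.comp hp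
  have hn : Measurable unitInterval.toNNReal := unitInterval.toNNReal_continuous.measurable
  have hte : MeasurableSet (t e) := ht e (Set.mem_univ e)
  classical
  simp_rw [bernoulliMeasure_apply _ hte]
  split_ifs
  · exact measurable_const
  · exact (hn.comp hp).coe_nnreal_ennreal
  · exact (hn.comp hq).coe_nnreal_ennreal
  · exact measurable_const

/-- The weights `X_i` and `Y_j` being random, `bipartiteKernel` is the conditional law of the
bipartite graph `H_{X,Y}` given the weights. -/
def bipartiteKernel (a b : ℝ) (τ : ℕ → ℝ) : Kernel Weights BipartiteGraph where
  toFun := bipartiteLaw a b τ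
  measurable' := measurable_bipartiteLaw a b τ

instance (a b : ℝ) (τ : ℕ → ℝ) : IsMarkovKernel (bipartiteKernel a b τ) :=
  ⟨fun w => inferInstanceAs (IsProbabilityMeasure (bipartiteLaw a b τ w))⟩

/-- The sample space: the weights together with the bipartite graph. -/
abbrev Sample : Type := Weights × BipartiteGraph

/-- The joint law of the weights and of the bipartite graph `H_{X,Y}`: the `X_i` are i.i.d. with law
`μX`, the `Y_j` are i.i.d. with law `μY`, both sequences are independent, and given the weights
the bipartite graph has the law `bipartiteLaw`. -/
def law (a b : ℝ) (τ : ℕ → ℝ) (μX μY : Measure ℝ≥0) [IsProbabilityMeasure μX]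
    [IsProbabilityMeasure μY] : Measure Sample :=
  ((Measure.infinitePi fun _ : ℕ => μX).prod (Measure.infinitePi fun _ : ℕ => μY)) ⊗ₘ
    bipartiteKernel a b τ

/-- The random intersection graph `G_{X,Y}`: two distinct vertices `v_s`, `v_t` are adjacent when
they have a common neighbour in the bipartite graph. -/
def graph (ω : Sample) : SimpleGraph ℕ where
  Adj s t := s ≠ t ∧ ∃ i, ω.2 (i, s) = true ∧ ω.2 (i, t) = true
  symm := ⟨fun _ _ h => ⟨h.1.symm, h.2.imp fun _ hi => hi.symm⟩⟩
  loopless := ⟨fun _ h => h.1 rfl⟩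

/-- The degree `d(v_t)` of `v_t` in `G_{X,Y}`. -/
def deg (t : ℕ) (ω : Sample) : ℝ := ((graph ω).neighborSet t).ncard

/-- The event `v_s ∼ v_t`. -/
def adjEvent (s t : ℕ) : Set Sample := {ω | (graph ω).Adj s t}

/-- The conditional probability given the event `v_s ∼ v_t`. -/
def condLaw (P : Measure Sample) (s t : ℕ) : Measure Sample := P[|adjEvent s t]

/-- The conditional expectation `E_{st}` given the event `v_s ∼ v_t`. -/
def condE (P : Measure Sample) (s t : ℕ) (Z : Sample → ℝ) : ℝ := ∫ ω, Z ω ∂(condLaw P s t)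

/-- The conditional variance `Var_{st} Z = E_{st} Z² - (E_{st} Z)²`. -/
def condVariance (P : Measure Sample) (s t : ℕ) (Z : Sample → ℝ) : ℝ :=
  condE P s t (fun ω => Z ω ^ 2) - condE P s t Z ^ 2

/-- The assortativity coefficient `r_{st}`. -/
def assortativity (P : Measure Sample) (s t : ℕ) : ℝ :=
  (condE P s t (fun ω => deg s ω * deg t ω) - condE P s t (deg s) * condE P s t (deg t)) /
    √(condVariance P s t (deg s) * condVariance P s t (deg t))

/-- The filter on pairs `(s, t)` expressing: `s < t`, `s, t → ∞` and `b s - a t → ∞`. -/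
def pairLimit (a b : ℝ) : Filter (ℕ × ℕ) :=
  comap Prod.fst atTop ⊓ comap Prod.snd atTop ⊓
    comap (fun p : ℕ × ℕ => b * (p.1 : ℝ) - a * (p.2 : ℝ)) atTop ⊓ 𝓟 {p | p.1 < p.2}

/-- The `k`-th moment of a law on `[0, ∞)`. -/
def wmoment (μ : Measure ℝ≥0) (k : ℕ) : ℝ := ∫ x, (x : ℝ) ^ k ∂μ

/-- `γ̃ = 2 (a^{-1/2} - b^{-1/2})`. -/
def gam (a b : ℝ) : ℝ := 2 * ((√a)⁻¹ - (√b)⁻¹)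

section Constants

variable (a b : ℝ) (μX μY : Measure ℝ≥0)

/-- `h₁ = a₂ b₁²`, where `a_k` and `b_k` are the moments of `X_1` and of `Y_1`. -/
def h₁ : ℝ := wmoment μX 2 * wmoment μY 1 ^ 2

/-- `h₂ = a₃ b₁³ γ̃`. -/
def h₂ : ℝ := wmoment μX 3 * wmoment μY 1 ^ 3 * gam a b

/-- `h₃ = a₂² b₁² b₂ γ̃ (√b - √a)`. -/
def h₃ : ℝ := wmoment μX 2 ^ 2 * wmoment μY 1 ^ 2 * wmoment μY 2 * gam a b * (√b - √a)

/-- `h₄ = a₄ b₁⁴ γ̃²`. -/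
def h₄ : ℝ := wmoment μX 4 * wmoment μY 1 ^ 4 * gam a b ^ 2

/-- `h₅ = a₂ a₃ b₁³ b₂ γ̃² (√b - √a)`. -/
def h₅ : ℝ :=
  wmoment μX 2 * wmoment μX 3 * wmoment μY 1 ^ 3 * wmoment μY 2 * gam a b ^ 2 * (√b - √a)

/-- `h₆ = a₂³ b₁³ b₃ γ̃² (√b - √a)²`. -/
def h₆ : ℝ :=
  wmoment μX 2 ^ 3 * wmoment μY 1 ^ 3 * wmoment μY 3 * gam a b ^ 2 * (√b - √a) ^ 2

/-- `h₇ = a₂³ b₁² b₂² γ̃² (√b - √a)²`. -/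
def h₇ : ℝ :=
  wmoment μX 2 ^ 3 * wmoment μY 1 ^ 2 * wmoment μY 2 ^ 2 * gam a b ^ 2 * (√b - √a) ^ 2

/-- `δ₁ = 1 + h₁⁻¹ (h₂ + 2 h₃)`. -/
def δ₁ : ℝ := 1 + (h₁ μX μY)⁻¹ * (h₂ a b μX μY + 2 * h₃ a b μX μY)

/-- `δ₂ = 1 + h₁⁻¹ (3 h₂ + 6 h₃ + h₄ + 6 h₅ + 4 h₆)`. -/
def δ₂ : ℝ :=
  1 + (h₁ μX μY)⁻¹ * (3 * h₂ a b μX μY + 6 * h₃ a b μX μY + h₄ a b μX μY + 6 * h₅ a b μX μY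
    + 4 * h₆ a b μX μY)

/-- `Δ = h₁⁻¹ (2 h₃ + 2 h₅ + 4 (h₆ - h₇))`. -/
def bigDelta : ℝ :=
  (h₁ μX μY)⁻¹ * (2 * h₃ a b μX μY + 2 * h₅ a b μX μY + 4 * (h₆ a b μX μY - h₇ a b μX μY))

end Constants

end RandomIntersection

end

open RandomIntersection

/-! Given `v_s ∼ v_t`, the degree `d(v_s)` is one plus the number of further neighbours of `v_s`.
Expanding products of such sums, every conditional moment becomes a ratio with denominator `P(v_s ∼
v_t)` whose numerator is built from this probability and expected counts: of one further neighbour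
(`expTwo`), of two distinct further neighbours, attached to the same end or to different ends
(`expThree`), and of a further common neighbour (`expCommon`). See `condE_deg`, `condE_deg_sq` and
`condE_deg_mul`.

Each count is asymptotic to the total weight of configurations in which every adjacency is realised
by a path through one item. The upper bound is the union bound together with `p_ij ≤ X_i Y_j /
√(ij)`. For the lower bound the weights are truncated at `M`, so that the minimum in `p_ij` is
inactive for large indices, and Bonferroni's inequality is used. Its error terms contain two paths
between the same two actors, which costs a factor of order `1/s + 1/t` for fixed `M`. Letting `s, t
→ ∞` and then `M → ∞` closes the gap (`tendsto_expectation`).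

The weight of a configuration is a product of kernels `1 / √(ij)` times moments whose orders are the
vertex degrees. All sums are compared with `pairNorm`, the kernel sum over common items of `s` and
`t`; its size depends on how fast `bs - at` grows, but it cancels in the ratios. Summing the kernel
over the items of an actor gives `2(√b - √a)`, and over the actors of an item gives `γ̃`. The
constants then record which items of the paths coincide. One extra path gives `h₂` (same item) or
`2h₃` (another item). Two extra paths from `s` give `h₄`, three patterns of weight `2h₅`, and `4h₆`.
With one path from each end, the pattern in which both share a second item common to `s` and `t` is
negligible, leaving `h₄ + 4h₅ + 4h₇`. Common neighbours contribute only through the item already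
joining `s` and `t`, which gives `h₂`.

Finally, `δ₂ - δ₁²` is a sum of positive terms and two Cauchy–Schwarz deficits of moments
(`variance_limit_pos`), so the quotient defining the assortativity converges. -/

noncomputable section

namespace RandomIntersection

/-! ### Probabilities of finite edge sets: bounds by kernels and moments. -/

section EdgeProbabilities

open scoped ENNReal

/-- The event that all edges of `F` are present and that the weights of their ends lie in `T`. -/
def cyl (T : Set ℝ≥0) (F : Finset (ℕ × ℕ)) : Set Sample :=
  {ω | ∀ e ∈ F, ω.2 e = true ∧ ω.1.1 e.1 ∈ T ∧ ω.1.2 e.2 ∈ T}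

/-- The moments of a law restricted to the set `T`, with the convention that the moment of order
`0` is the total mass. -/
def tmoment (T : Set ℝ≥0) (μ : Measure ℝ≥0) (k : ℕ) : ℝ :=
  ∫ x, ((T.indicator id x : ℝ≥0) : ℝ) ^ k ∂μ

/-- The kernel `𝟙{a j ≤ i ≤ b j} / √(i j)`. -/
def kern (a b : ℝ) (i j : ℕ) : ℝ :=
  if a * j ≤ i ∧ (i : ℝ) ≤ b * j then 1 / √((i : ℝ) * j) else 0

/-- The number of edges of `F` at the item `i`. -/
def itemDeg (F : Finset (ℕ × ℕ)) (i : ℕ) : ℕ := (F.filter fun e => e.1 = i).card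

/-- The number of edges of `F` at the actor `j`. -/
def actorDeg (F : Finset (ℕ × ℕ)) (j : ℕ) : ℕ := (F.filter fun e => e.2 = j).card

/-- The weight of a finite set of edges: the product of the kernel over the edges, times the moments
of the item weights and of the actor weights of the orders given by the degrees. -/
def edgeWeight (a b : ℝ) (mX mY : ℕ → ℝ) (F : Finset (ℕ × ℕ)) : ℝ :=
  (∏ e ∈ F, kern a b e.1 e.2) * (∏ i ∈ F.image Prod.fst, mX (itemDeg F i)) *
    ∏ j ∈ F.image Prod.snd, mY (actorDeg F j)

lemma kern_nonneg (a b : ℝ) (i j : ℕ) : 0 ≤ kern a b i j := by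
  unfold kern; split_ifs <;> positivity

lemma measurableSet_cyl {T : Set ℝ≥0} (hT : MeasurableSet T) (F : Finset (ℕ × ℕ)) :
    MeasurableSet (cyl T F) := by
  have : cyl T F = ⋂ e ∈ F, ({ω : Sample | ω.2 e = true} ∩
      ((fun ω : Sample => ω.1.1 e.1) ⁻¹' T ∩ (fun ω : Sample => ω.1.2 e.2) ⁻¹' T)) := by
    ext ω; simp [cyl]
  rw [this]
  refine Finset.measurableSet_biInter _ fun e _ => ?_
  refine MeasurableSet.inter ?_ (MeasurableSet.inter (hT.preimage (by fun_prop))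
    (hT.preimage (by fun_prop)))
  exact (measurableSet_singleton true).preimage
    (show Measurable fun ω : Sample => ω.2 e by fun_prop)

lemma cyl_union (T : Set ℝ≥0) (F F' : Finset (ℕ × ℕ)) : cyl T (F ∪ F') = cyl T F ∩ cyl T F' := by
  ext ω
  simp only [cyl, Finset.mem_union, Set.mem_ofPred_eq, Set.mem_inter_iff]
  constructor
  · exact fun h => ⟨fun e he => h e (Or.inl he), fun e he => h e (Or.inr he)⟩
  · rintro ⟨h, h'⟩ e (he | he)
    exacts [h e he, h' e he]

variable {a b : ℝ} {τ : ℕ → ℝ} {μX μY : Measure ℝ≥0} [IsProbabilityMeasure μX]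
  [IsProbabilityMeasure μY]

instance : IsProbabilityMeasure (law a b τ μX μY) := by unfold law; infer_instance

/-- Given the weights, the edges are independent, so the conditional probability is a product; if
the weight of some end leaves `T`, both sides of the integrand identity vanish. -/
lemma law_cyl {T : Set ℝ≥0} (hT : MeasurableSet T) (F : Finset (ℕ × ℕ)) :
    law a b τ μX μY (cyl T F) =
      ∫⁻ w, ∏ e ∈ F, (ENNReal.ofReal (edgeProb a b τ w e.1 e.2) *
        (T.indicator 1 (w.1 e.1) * T.indicator 1 (w.2 e.2)))
        ∂((Measure.infinitePi fun _ : ℕ => μX).prod (Measure.infinitePi fun _ : ℕ => μY)) := by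
  classical
  unfold law
  rw [Measure.compProd_apply (measurableSet_cyl hT F)]
  refine lintegral_congr fun w => ?_
  change bipartiteLaw a b τ w _ = _
  by_cases h : ∀ e ∈ F, w.1 e.1 ∈ T ∧ w.2 e.2 ∈ T
  · have h1 : Prod.mk w ⁻¹' cyl T F = (F : Set (ℕ × ℕ)).pi fun _ => {true} := by
      ext H
      simp only [cyl, Set.mem_preimage, Set.mem_ofPred_eq, Set.mem_pi, Set.mem_singleton_iff,
        Finset.mem_coe]
      exact ⟨fun hH e he => (hH e he).1, fun hH e he => ⟨hH e he, h e he⟩⟩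
    rw [h1, bipartiteLaw, Measure.infinitePi_pi _ fun _ _ => measurableSet_singleton _]
    refine Finset.prod_congr rfl fun e he => ?_
    rw [bernoulliMeasure_apply_of_mem_of_notMem _ (measurableSet_singleton _) (by simp) (by simp)]
    simp only [Set.indicator_of_mem (h e he).1, Set.indicator_of_mem (h e he).2, Pi.one_apply,
      mul_one]
    rw [ENNReal.ofReal, Real.toNNReal_of_nonneg (edgeProb_mem_unitInterval a b τ w e.1 e.2).1]
    rfl
  · push Not at h
    obtain ⟨e, he, h⟩ := h
    have h1 : Prod.mk w ⁻¹' cyl T F = ∅ := by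
      ext H
      simp only [cyl, Set.mem_preimage, Set.mem_ofPred_eq, Set.mem_empty_iff_false, iff_false]
      exact fun hH => h (hH e he).2.1 (hH e he).2.2
    rw [h1, measure_empty, eq_comm]
    refine Finset.prod_eq_zero he ?_
    by_cases h2 : w.1 e.1 ∈ T
    · simp [h h2]
    · simp [h2]

/-- Grouping the edges by their end turns the product into powers of independent coordinates, the
exponent being the degree. With `g` either projection it serves items and actors alike. -/
lemma lintegral_prod_items (μ : Measure ℝ≥0) [IsProbabilityMeasure μ] {T : Set ℝ≥0}
    (hT : MeasurableSet T) (F : Finset (ℕ × ℕ)) (g : ℕ × ℕ → ℕ) :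
    ∫⁻ x, ∏ e ∈ F, ((T.indicator id (x (g e)) : ℝ≥0) : ℝ≥0∞)
      ∂(Measure.infinitePi fun _ : ℕ => μ) =
    ∏ i ∈ F.image g, ∫⁻ x, ((T.indicator id x : ℝ≥0) : ℝ≥0∞) ^ (F.filter fun e => g e = i).card
      ∂μ := by
  have hm : ∀ k : ℕ, Measurable fun y : ℝ≥0 => ((T.indicator id y : ℝ≥0) : ℝ≥0∞) ^ k := fun k =>
    ((measurable_id.indicator hT).coe_nnreal_ennreal).pow_const k
  have h1 : ∀ x : ℕ → ℝ≥0, ∏ e ∈ F, ((T.indicator id (x (g e)) : ℝ≥0) : ℝ≥0∞) =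
      ∏ i ∈ F.image g, ((T.indicator id (x i) : ℝ≥0) : ℝ≥0∞) ^
        (F.filter fun e => g e = i).card := fun x =>
    Finset.prod_comp (fun i => ((T.indicator id (x i) : ℝ≥0) : ℝ≥0∞)) g
  simp_rw [h1]
  rw [lintegral_prod_eq_prod_lintegral_of_indepFun (F.image g)
    (fun i (x : ℕ → ℝ≥0) => ((T.indicator id (x i) : ℝ≥0) : ℝ≥0∞) ^
        (F.filter fun e => g e = i).card)
    (iIndepFun_infinitePi (P := fun _ : ℕ => μ)
      (X := fun i y => ((T.indicator id y : ℝ≥0) : ℝ≥0∞) ^ (F.filter fun e => g e = i).card)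
      fun i => hm _) fun i => (hm _).comp (measurable_pi_apply i)]
  refine Finset.prod_congr rfl fun i _ => ?_
  rw [← (measurePreserving_eval_infinitePi (fun _ : ℕ => μ) i).lintegral_comp (hm _)]

lemma ofReal_tmoment {μ : Measure ℝ≥0} {T : Set ℝ≥0} {k : ℕ}
    (h : Integrable (fun x : ℝ≥0 => ((T.indicator id x : ℝ≥0) : ℝ) ^ k) μ) :
    ∫⁻ x, ((T.indicator id x : ℝ≥0) : ℝ≥0∞) ^ k ∂μ = ENNReal.ofReal (tmoment T μ k) := by
  rw [tmoment, ofReal_integral_eq_lintegral_ofReal h (ae_of_all _ fun x => by positivity)]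
  refine lintegral_congr fun x => ?_
  rw [ENNReal.ofReal_pow (by positivity), ENNReal.ofReal_coe_nnreal]

lemma tmoment_nonneg (T : Set ℝ≥0) (μ : Measure ℝ≥0) (k : ℕ) : 0 ≤ tmoment T μ k :=
  integral_nonneg fun x => by positivity

/-- This is `law_cyl` with the edge probability replaced by its version without the minimum;
comparing the two integrands yields both the upper and the lower bound for probabilities. -/
lemma ofReal_edgeWeight {T : Set ℝ≥0} (hT : MeasurableSet T) (F : Finset (ℕ × ℕ))
    (hX : ∀ i, Integrable (fun x : ℝ≥0 => ((T.indicator id x : ℝ≥0) : ℝ) ^ itemDeg F i) μX)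
    (hY : ∀ j, Integrable (fun x : ℝ≥0 => ((T.indicator id x : ℝ≥0) : ℝ) ^ actorDeg F j) μY) :
    ENNReal.ofReal (edgeWeight a b (tmoment T μX) (tmoment T μY) F) =
      ∫⁻ w, ∏ e ∈ F, (ENNReal.ofReal (kern a b e.1 e.2) *
        (((T.indicator id (w.1 e.1) : ℝ≥0) : ℝ≥0∞) * ((T.indicator id (w.2 e.2) : ℝ≥0) : ℝ≥0∞)))
        ∂((Measure.infinitePi fun _ : ℕ => μX).prod (Measure.infinitePi fun _ : ℕ => μY)) := by
  have hm : ∀ g : ℕ × ℕ → ℕ, Measurable fun x : ℕ → ℝ≥0 =>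
      ∏ e ∈ F, ((T.indicator id (x (g e)) : ℝ≥0) : ℝ≥0∞) := fun g =>
    Finset.measurable_prod _ fun e _ =>
      ((measurable_id.indicator hT).coe_nnreal_ennreal).comp (measurable_pi_apply (g e))
  simp_rw [Finset.prod_mul_distrib]
  have hm2 : Measurable fun w : (ℕ → ℝ≥0) × (ℕ → ℝ≥0) =>
      (∏ e ∈ F, ((T.indicator id (w.1 e.1) : ℝ≥0) : ℝ≥0∞)) *
        ∏ e ∈ F, ((T.indicator id (w.2 e.2) : ℝ≥0) : ℝ≥0∞) :=
    ((hm Prod.fst).comp measurable_fst).mul ((hm Prod.snd).comp measurable_snd)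
  rw [lintegral_const_mul _ hm2,
    lintegral_prod_mul (f := fun x : ℕ → ℝ≥0 => ∏ e ∈ F, ((T.indicator id (x e.1) : ℝ≥0) : ℝ≥0∞))
      (g := fun x : ℕ → ℝ≥0 => ∏ e ∈ F, ((T.indicator id (x e.2) : ℝ≥0) : ℝ≥0∞))
      (hm _).aemeasurable (hm _).aemeasurable,
    lintegral_prod_items μX hT F Prod.fst, lintegral_prod_items μY hT F Prod.snd]
  have h1 : 0 ≤ ∏ e ∈ F, kern a b e.1 e.2 := Finset.prod_nonneg fun e _ => kern_nonneg _ _ _ _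
  have h2 : 0 ≤ ∏ i ∈ F.image Prod.fst, tmoment T μX (itemDeg F i) :=
    Finset.prod_nonneg fun e _ => tmoment_nonneg _ _ _
  rw [edgeWeight, ENNReal.ofReal_mul (mul_nonneg h1 h2), ENNReal.ofReal_mul h1,
    ENNReal.ofReal_prod_of_nonneg fun e _ => kern_nonneg _ _ _ _,
    ENNReal.ofReal_prod_of_nonneg fun e _ => tmoment_nonneg _ _ _,
    ENNReal.ofReal_prod_of_nonneg fun e _ => tmoment_nonneg _ _ _, mul_assoc]
  congr 2
  · exact Finset.prod_congr rfl fun i _ => (ofReal_tmoment (hX i)).symm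
  · exact Finset.prod_congr rfl fun i _ => (ofReal_tmoment (hY i)).symm

lemma edgeProb_le_kern (w : Weights) (i j : ℕ) :
    edgeProb a b (fun t : ℕ => (t : ℝ)) w i j ≤ kern a b i j * (w.1 i * w.2 j) := by
  unfold edgeProb kern
  split_ifs
  · refine (min_le_right _ _).trans (le_of_eq ?_)
    ring
  · simp

/-- The minimum is inactive because `x_i y_j ≤ M² ≤ √(ij)`. -/
lemma edgeProb_eq_kern {M : ℝ≥0} {w : Weights} {i j : ℕ} (hi : w.1 i ≤ M) (hj : w.2 j ≤ M)
    (hM : (M : ℝ) ^ 4 ≤ (i : ℝ) * j) :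
    edgeProb a b (fun t : ℕ => (t : ℝ)) w i j = kern a b i j * (w.1 i * w.2 j) := by
  unfold edgeProb kern
  split_ifs
  · rw [min_eq_right]
    · ring
    · refine div_le_one_of_le₀ (Real.le_sqrt_of_sq_le ?_) (Real.sqrt_nonneg _)
      refine le_trans ?_ hM
      have : ((w.1 i : ℝ) * w.2 j) ≤ M * M := by gcongr
      calc ((w.1 i : ℝ) * w.2 j) ^ 2 ≤ ((M : ℝ) * M) ^ 2 := by gcongr
        _ = _ := by ring
  · simp

lemma indicator_mul_le {T : Set ℝ≥0} (w : Weights) (e : ℕ × ℕ) :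
    ENNReal.ofReal (edgeProb a b (fun t : ℕ => (t : ℝ)) w e.1 e.2) *
        (T.indicator 1 (w.1 e.1) * T.indicator 1 (w.2 e.2)) ≤
      ENNReal.ofReal (kern a b e.1 e.2) *
        (((T.indicator id (w.1 e.1) : ℝ≥0) : ℝ≥0∞) *
          ((T.indicator id (w.2 e.2) : ℝ≥0) : ℝ≥0∞)) := by
  by_cases h1 : w.1 e.1 ∈ T <;> by_cases h2 : w.2 e.2 ∈ T <;> simp [h1, h2]
  rw [← ENNReal.ofReal_coe_nnreal, ← ENNReal.ofReal_coe_nnreal,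
    ← ENNReal.ofReal_mul (by positivity), ← ENNReal.ofReal_mul (kern_nonneg _ _ _ _)]
  exact ENNReal.ofReal_le_ofReal (edgeProb_le_kern _ _ _)

/-- An upper bound for the probability of a finite set of edges. -/
lemma law_real_cyl_le {T : Set ℝ≥0} (hT : MeasurableSet T) (F : Finset (ℕ × ℕ))
    (hX : ∀ i, Integrable (fun x : ℝ≥0 => ((T.indicator id x : ℝ≥0) : ℝ) ^ itemDeg F i) μX)
    (hY : ∀ j, Integrable (fun x : ℝ≥0 => ((T.indicator id x : ℝ≥0) : ℝ) ^ actorDeg F j) μY) :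
    (law a b (fun t : ℕ => (t : ℝ)) μX μY).real (cyl T F) ≤
      edgeWeight a b (tmoment T μX) (tmoment T μY) F := by
  refine ENNReal.toReal_le_of_le_ofReal ?_ ?_
  · exact mul_nonneg (mul_nonneg (Finset.prod_nonneg fun e _ => kern_nonneg _ _ _ _)
      (Finset.prod_nonneg fun e _ => tmoment_nonneg _ _ _))
      (Finset.prod_nonneg fun e _ => tmoment_nonneg _ _ _)
  · rw [ofReal_edgeWeight hT F hX hY, law_cyl hT]
    exact lintegral_mono fun w => Finset.prod_le_prod' fun e _ => indicator_mul_le w e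

lemma integrable_indicator_Iic_pow (μ : Measure ℝ≥0) [IsProbabilityMeasure μ] (M : ℝ≥0) (k : ℕ) :
    Integrable (fun x : ℝ≥0 => (((Set.Iic M).indicator id x : ℝ≥0) : ℝ) ^ k) μ := by
  refine Integrable.of_bound (C := (M : ℝ) ^ k) ?_ (ae_of_all _ fun x => ?_)
  · exact (((measurable_id.indicator measurableSet_Iic).coe_nnreal_real).pow_const
      k).aestronglyMeasurable
  · rw [Real.norm_of_nonneg (by positivity)]
    refine pow_le_pow_left₀ (by positivity) ?_ _
    by_cases h : x ∈ Set.Iic M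
    · rw [Set.indicator_of_mem h]
      exact_mod_cast h
    · simp [h]

/-- A lower bound for the probability of a finite set of edges whose ends have weights at most
`M`. -/
lemma le_law_real_cyl {M : ℝ≥0} (F : Finset (ℕ × ℕ))
    (hM : ∀ e ∈ F, (M : ℝ) ^ 4 ≤ (e.1 : ℝ) * e.2) :
    edgeWeight a b (tmoment (Set.Iic M) μX) (tmoment (Set.Iic M) μY) F ≤
      (law a b (fun t : ℕ => (t : ℝ)) μX μY).real (cyl (Set.Iic M) F) := by
  refine (ENNReal.ofReal_le_iff_le_toReal (measure_ne_top _ _)).1 ?_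
  rw [ofReal_edgeWeight measurableSet_Iic F (fun i => integrable_indicator_Iic_pow _ _ _)
    (fun i => integrable_indicator_Iic_pow _ _ _), law_cyl measurableSet_Iic]
  refine lintegral_mono fun w => Finset.prod_le_prod' fun e he => ?_
  by_cases h1 : w.1 e.1 ∈ Set.Iic M
  · by_cases h2 : w.2 e.2 ∈ Set.Iic M
    · simp only [h1, h2, Set.indicator_of_mem, Pi.one_apply, mul_one, id]
      rw [← ENNReal.ofReal_coe_nnreal, ← ENNReal.ofReal_coe_nnreal,
        ← ENNReal.ofReal_mul (by positivity), ← ENNReal.ofReal_mul (kern_nonneg _ _ _ _),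
        edgeProb_eq_kern h1 h2 (hM e he)]
    · simp [h2]
  · simp [h1]

/-- A crude upper bound for the probability of a finite set of edges whose ends have weights at
most `M`. -/
lemma law_real_cyl_Iic_le (M : ℝ≥0) (F : Finset (ℕ × ℕ)) :
    (law a b (fun t : ℕ => (t : ℝ)) μX μY).real (cyl (Set.Iic M) F) ≤
      ∏ e ∈ F, ((M : ℝ) ^ 2 * kern a b e.1 e.2) := by
  have h0 : ∀ e : ℕ × ℕ, 0 ≤ (M : ℝ) ^ 2 * kern a b e.1 e.2 := fun e =>
    mul_nonneg (by positivity) (kern_nonneg _ _ _ _)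
  refine ENNReal.toReal_le_of_le_ofReal (Finset.prod_nonneg fun e _ => h0 e) ?_
  rw [law_cyl measurableSet_Iic, ENNReal.ofReal_prod_of_nonneg fun e _ => h0 e]
  calc _ ≤ ∫⁻ w, ∏ e ∈ F, ENNReal.ofReal ((M : ℝ) ^ 2 * kern a b e.1 e.2)
        ∂((Measure.infinitePi fun _ : ℕ => μX).prod (Measure.infinitePi fun _ : ℕ => μY)) := by
        refine lintegral_mono fun w => Finset.prod_le_prod' fun e _ => ?_
        by_cases h1 : w.1 e.1 ∈ Set.Iic M
        swap
        · simp [h1]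
        by_cases h2 : w.2 e.2 ∈ Set.Iic M
        swap
        · simp [h2]
        simp only [h1, h2, Set.indicator_of_mem, Pi.one_apply, mul_one]
        refine ENNReal.ofReal_le_ofReal ((edgeProb_le_kern _ _ _).trans ?_)
        rw [mul_comm]
        refine mul_le_mul_of_nonneg_right ?_ (kern_nonneg _ _ _ _)
        rw [sq]
        exact mul_le_mul (by exact_mod_cast h1) (by exact_mod_cast h2) (by positivity)
          (by positivity)
    _ = _ := by simp

/-- Almost surely all edges lie in the range `a j ≤ i ≤ b j`. -/
lemma ae_kern_ne_zero :
    ∀ᵐ ω ∂(law a b (fun t : ℕ => (t : ℝ)) μX μY), ∀ e : ℕ × ℕ, ω.2 e = true →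
      kern a b e.1 e.2 ≠ 0 := by
  rw [ae_all_iff]
  intro e
  by_cases h : kern a b e.1 e.2 = 0
  · have h1 : law a b (fun t : ℕ => (t : ℝ)) μX μY (cyl Set.univ {e}) = 0 := by
      rw [law_cyl MeasurableSet.univ]
      refine le_antisymm ?_ bot_le
      refine (lintegral_mono fun w => Finset.prod_le_prod' fun e _ =>
        indicator_mul_le w e).trans ?_
      simp [h]
    filter_upwards [measure_eq_zero_iff_ae_notMem.1 h1] with ω hω h2
    exact (hω (by simpa [cyl] using h2)).elim
  · exact ae_of_all _ fun _ _ => h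

end EdgeProbabilities

/-! ### Pointwise and summed bounds for the kernel. -/

section Kernel

variable {a b : ℝ}

lemma kern_ne_zero {i j : ℕ} (h : kern a b i j ≠ 0) :
    a * j ≤ i ∧ (i : ℝ) ≤ b * j ∧ 0 < i ∧ 0 < j := by
  unfold kern at h
  split_ifs at h with h1
  · refine ⟨h1.1, h1.2, Nat.pos_of_ne_zero ?_, Nat.pos_of_ne_zero ?_⟩ <;> rintro rfl <;> simp at h
  · exact absurd rfl h

/-- On the support `i ≥ a j`, hence `√(ij) ≥ √a j`. The companion bound uses `j ≥ i / b`. -/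
lemma kern_le_div_actor (ha : 0 < a) (i j : ℕ) : kern a b i j ≤ (√a)⁻¹ / j := by
  by_cases h : kern a b i j = 0
  · rw [h]; positivity
  obtain ⟨h1, h2, h3, h4⟩ := kern_ne_zero h
  rw [kern, if_pos ⟨h1, h2⟩]
  have hj : (0 : ℝ) < j := by exact_mod_cast h4
  rw [inv_eq_one_div, div_div]
  refine one_div_le_one_div_of_le (by positivity) (Real.le_sqrt_of_sq_le ?_)
  rw [mul_pow, Real.sq_sqrt ha.le, sq, ← mul_assoc]
  gcongr

lemma kern_le_div_item (ha : 0 < a) (hab : a < b) (i j : ℕ) : kern a b i j ≤ √b / i := by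
  by_cases h : kern a b i j = 0
  · rw [h]; positivity
  obtain ⟨h1, h2, h3, h4⟩ := kern_ne_zero h
  rw [kern, if_pos ⟨h1, h2⟩]
  have hj : (0 : ℝ) < j := by exact_mod_cast h4
  have hi : (0 : ℝ) < i := by exact_mod_cast h3
  have hb : 0 < b := ha.trans hab
  rw [div_le_div_iff₀ (by positivity) hi, one_mul, ← Real.sqrt_mul hb.le]
  refine Real.le_sqrt_of_sq_le ?_
  nlinarith

/-- A bound for the sum of the kernel over the actors. -/
def actorBound (a b : ℝ) : ℝ := √b * (a⁻¹ + 1)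

/-- A bound for the sum of the kernel over the items. -/
def itemBound (a b : ℝ) : ℝ := (√a)⁻¹ * (b + 1)

/-- At most `⌊i/a⌋ + 1` actors have nonzero kernel with `i`, each contributing at most `√b / i`. The
bound is uniform in `i` and in the range of summation. -/
lemma sum_kern_actor_le (ha : 0 < a) (hab : a < b) (i : ℕ) (R : Finset ℕ) :
    ∑ u ∈ R, kern a b i u ≤ actorBound a b := by
  rcases Nat.eq_zero_or_pos i with rfl | hi
  · have : ∀ u, kern a b 0 u = 0 := fun u => by simp [kern]
    simp only [this, Finset.sum_const_zero, actorBound]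
    positivity
  have hi' : (1 : ℝ) ≤ i := by exact_mod_cast hi
  calc ∑ u ∈ R, kern a b i u ≤ ∑ u ∈ R ∪ Finset.range (⌊(i : ℝ) / a⌋₊ + 1), kern a b i u :=
        Finset.sum_le_sum_of_subset_of_nonneg Finset.subset_union_left
          fun _ _ _ => kern_nonneg _ _ _ _
    _ = ∑ u ∈ Finset.range (⌊(i : ℝ) / a⌋₊ + 1), kern a b i u := by
        refine (Finset.sum_subset Finset.subset_union_right fun u _ hu => ?_).symm
        by_contra h
        refine hu (Finset.mem_range.2 (Nat.lt_succ_of_le (Nat.le_floor ?_)))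
        rw [le_div_iff₀ ha, mul_comm]
        exact (kern_ne_zero h).1
    _ ≤ ∑ u ∈ Finset.range (⌊(i : ℝ) / a⌋₊ + 1), √b / i :=
        Finset.sum_le_sum fun u _ => kern_le_div_item ha hab i u
    _ = (⌊(i : ℝ) / a⌋₊ + 1) * (√b / i) := by simp
    _ ≤ (i / a + i) * (√b / i) := by
        gcongr
        exact Nat.floor_le (by positivity)
    _ = actorBound a b := by rw [actorBound]; field_simp

lemma sum_kern_item_le (ha : 0 < a) (hab : a < b) (j : ℕ) (R : Finset ℕ) :
    ∑ i ∈ R, kern a b i j ≤ itemBound a b := by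
  have hb : 0 < b := ha.trans hab
  rcases Nat.eq_zero_or_pos j with rfl | hj
  · have : ∀ u, kern a b u 0 = 0 := fun u => by simp [kern]
    simp only [this, Finset.sum_const_zero, itemBound]
    positivity
  have hj' : (1 : ℝ) ≤ j := by exact_mod_cast hj
  calc ∑ i ∈ R, kern a b i j ≤ ∑ i ∈ R ∪ Finset.range (⌊b * j⌋₊ + 1), kern a b i j :=
        Finset.sum_le_sum_of_subset_of_nonneg Finset.subset_union_left
          fun _ _ _ => kern_nonneg _ _ _ _
    _ = ∑ i ∈ Finset.range (⌊b * j⌋₊ + 1), kern a b i j := by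
        refine (Finset.sum_subset Finset.subset_union_right fun u _ hu => ?_).symm
        by_contra h
        exact hu (Finset.mem_range.2 (Nat.lt_succ_of_le (Nat.le_floor (kern_ne_zero h).2.1)))
    _ ≤ ∑ i ∈ Finset.range (⌊b * j⌋₊ + 1), (√a)⁻¹ / j :=
        Finset.sum_le_sum fun u _ => kern_le_div_actor ha u j
    _ = (⌊b * j⌋₊ + 1) * ((√a)⁻¹ / j) := by simp
    _ ≤ (b * j + j) * ((√a)⁻¹ / j) := by
        gcongr
        exact Nat.floor_le (by positivity)
    _ = itemBound a b := by rw [itemBound]; field_simp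

end Kernel

/-! ### Riemann sums: limits of kernel sums over items or actors. -/

section Riemann

/-- Telescoping: `√(q+1) - √q = 1 / (√(q+1) + √q) ≤ 1 / (2√q)`. The reverse bound below uses `√q -
√(q-1) ≥ 1 / (2√q)`. -/
lemma le_sum_inv_sqrt {p q : ℕ} (hp : 0 < p) (hpq : p ≤ q) :
    2 * (√(q : ℝ) - √(p : ℝ)) ≤ ∑ u ∈ Finset.Ico p q, 1 / √(u : ℝ) := by
  induction q, hpq using Nat.le_induction with
  | base => simp
  | succ q hq ih =>
    rw [Finset.sum_Ico_succ_top hq]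
    have h1 : (0 : ℝ) < √(q : ℝ) := Real.sqrt_pos.2 (by exact_mod_cast hp.trans_le hq)
    have h2 : √(q : ℝ) ≤ √((q + 1 : ℕ) : ℝ) := Real.sqrt_le_sqrt (by simp)
    have h3 : √((q + 1 : ℕ) : ℝ) ^ 2 = √(q : ℝ) ^ 2 + 1 := by
      rw [Real.sq_sqrt (by positivity), Real.sq_sqrt (by positivity)]; simp
    have : 2 * (√((q + 1 : ℕ) : ℝ) - √(q : ℝ)) ≤ 1 / √(q : ℝ) := by
      rw [le_div_iff₀ h1]
      nlinarith
    linarith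

lemma sum_inv_sqrt_le {p q : ℕ} (hp : 0 < p) (hpq : p ≤ q) :
    ∑ u ∈ Finset.Ico p q, 1 / √(u : ℝ) ≤ 2 * (√((q : ℝ) - 1) - √((p : ℝ) - 1)) := by
  induction q, hpq using Nat.le_induction with
  | base => simp
  | succ q hq ih =>
    rw [Finset.sum_Ico_succ_top hq]
    have hq1 : (1 : ℝ) ≤ q := by exact_mod_cast hp.trans_le hq
    have h1 : (0 : ℝ) < √(q : ℝ) := Real.sqrt_pos.2 (by linarith)
    have h2 : √((q : ℝ) - 1) ≤ √(q : ℝ) := Real.sqrt_le_sqrt (by linarith)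
    have h3 : √(q : ℝ) ^ 2 = √((q : ℝ) - 1) ^ 2 + 1 := by
      rw [Real.sq_sqrt (by linarith), Real.sq_sqrt (by linarith)]; ring
    have : 1 / √(q : ℝ) ≤ 2 * (√(q : ℝ) - √((q : ℝ) - 1)) := by
      rw [div_le_iff₀ h1]
      nlinarith
    have h4 : ((q + 1 : ℕ) : ℝ) - 1 = q := by push_cast; ring
    rw [h4]
    linarith

lemma tendsto_sum_inv_sqrt {c d : ℝ} (hc : 0 < c) (hcd : c < d) :
    Tendsto (fun n : ℕ => ∑ u ∈ Finset.Icc ⌈c * n⌉₊ ⌊d * n⌋₊, 1 / √((u : ℝ) * n)) atTop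
      (𝓝 (2 * (√d - √c))) := by
  have hd : 0 < d := hc.trans hcd
  -- The shifts by `1/n` absorb the rounding of the lower end `c n`; at the upper end `⌊d n⌋ ≤ d n <
  -- ⌊d n⌋ + 1` already suffices.
  have hlo : Tendsto (fun n : ℕ => 2 * (√d - √(c + 1 / (n : ℝ)))) atTop (𝓝 (2 * (√d - √c))) := by
    have h := tendsto_one_div_atTop_nhds_zero_nat (𝕜 := ℝ)
    simpa using ((((h.const_add c).sqrt).const_sub (√d)).const_mul 2)
  have hhi : Tendsto (fun n : ℕ => 2 * (√d - √(c - 1 / (n : ℝ)))) atTop (𝓝 (2 * (√d - √c))) := by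
    have h := tendsto_one_div_atTop_nhds_zero_nat (𝕜 := ℝ)
    simpa using ((((h.const_sub c).sqrt).const_sub (√d)).const_mul 2)
  have hkey : ∀ n : ℕ, 0 < n →
      2 * (√d - √(c + 1 / (n : ℝ))) ≤
          ∑ u ∈ Finset.Icc ⌈c * n⌉₊ ⌊d * n⌋₊, 1 / √((u : ℝ) * n) ∧
        ∑ u ∈ Finset.Icc ⌈c * n⌉₊ ⌊d * n⌋₊, 1 / √((u : ℝ) * n) ≤
          2 * (√d - √(c - 1 / (n : ℝ))) := by
    intro n hn
    have hn' : (0 : ℝ) < n := by exact_mod_cast hn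
    have hs : (0 : ℝ) < √(n : ℝ) := Real.sqrt_pos.2 hn'
    have hp : 0 < ⌈c * n⌉₊ := Nat.ceil_pos.2 (by positivity)
    have hpq : ⌈c * n⌉₊ ≤ ⌊d * n⌋₊ + 1 := by
      refine Nat.ceil_le.2 ?_
      push_cast
      exact (by gcongr : c * n ≤ d * n).trans (Nat.lt_floor_add_one _).le
    have heq : ∑ u ∈ Finset.Icc ⌈c * n⌉₊ ⌊d * n⌋₊, 1 / √((u : ℝ) * n) =
        (∑ u ∈ Finset.Ico ⌈c * n⌉₊ (⌊d * n⌋₊ + 1), 1 / √(u : ℝ)) / √(n : ℝ) := by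
      rw [Finset.sum_div]
      refine Finset.sum_congr (by ext; simp) fun u _ => ?_
      rw [Real.sqrt_mul (by positivity), div_div]
    rw [heq]
    have hmul : ∀ x : ℝ, 0 ≤ x → √x * √(n : ℝ) = √(x * n) := fun x hx =>
      (Real.sqrt_mul hx _).symm
    constructor
    · rw [le_div_iff₀ hs]
      refine le_trans ?_ (le_sum_inv_sqrt hp hpq)
      rw [mul_assoc, sub_mul, hmul _ hd.le, hmul _ (by positivity)]
      have h1 : √(d * n) ≤ √((⌊d * n⌋₊ + 1 : ℕ) : ℝ) := by
        refine Real.sqrt_le_sqrt ?_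
        push_cast
        exact (Nat.lt_floor_add_one _).le
      have h2 : √(⌈c * n⌉₊ : ℝ) ≤ √((c + 1 / n) * n) := by
        refine Real.sqrt_le_sqrt ((Nat.ceil_lt_add_one (by positivity)).le.trans (le_of_eq ?_))
        field_simp
      linarith
    · rw [div_le_iff₀ hs]
      refine (sum_inv_sqrt_le hp hpq).trans ?_
      rw [mul_assoc, sub_mul, hmul _ hd.le]
      have h1 : √(((⌊d * n⌋₊ + 1 : ℕ) : ℝ) - 1) ≤ √(d * n) := by
        refine Real.sqrt_le_sqrt ?_
        push_cast
        rw [add_sub_cancel_right]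
        exact Nat.floor_le (by positivity)
      have h2 : √(c - 1 / n) * √(n : ℝ) ≤ √((⌈c * n⌉₊ : ℝ) - 1) := by
        rw [← Real.sqrt_mul' _ hn'.le]
        refine Real.sqrt_le_sqrt ?_
        have := Nat.le_ceil (c * n)
        rw [sub_mul, one_div, inv_mul_cancel₀ hn'.ne']
        linarith
      linarith
  refine tendsto_of_tendsto_of_tendsto_of_le_of_le' hlo hhi ?_ ?_
  · filter_upwards [eventually_gt_atTop 0] with n hn using (hkey n hn).1
  · filter_upwards [eventually_gt_atTop 0] with n hn using (hkey n hn).2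

/-- Deleting at most `m` indices is harmless, as each term is at most `(√c)⁻¹ / n`. An arbitrary
filter and deleted sets depending on the parameter are needed for iterated sums over distinct
indices. -/
lemma tendsto_sum_sdiff {Y : Type*} {l : Filter Y} {c d : ℝ} (hc : 0 < c) (hcd : c < d)
    {n : Y → ℕ} (hn : Tendsto n l atTop) {K : Y → ℕ} {A : Y → Finset ℕ} (m : ℕ)
    (hA : ∀ y, (A y).card ≤ m) (hK : ∀ᶠ y in l, ∀ u : ℕ, (u : ℝ) ≤ d * n y → u < K y) :
    Tendsto (fun y => ∑ u ∈ Finset.range (K y) \ A y,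
      if c * n y ≤ u ∧ (u : ℝ) ≤ d * n y then 1 / √((u : ℝ) * n y) else 0) l
      (𝓝 (2 * (√d - √c))) := by
  have hd : 0 < d := hc.trans hcd
  have h1 := (tendsto_sum_inv_sqrt hc hcd).comp hn
  have hn' : Tendsto (fun y => (n y : ℝ)) l atTop := tendsto_natCast_atTop_atTop.comp hn
  have h2 : Tendsto (fun y => (m : ℝ) * ((√c)⁻¹ / n y)) l (𝓝 0) := by
    simpa using (hn'.const_div_atTop (√c)⁻¹).const_mul (m : ℝ)
  have h3 := h1.sub h2
  rw [sub_zero] at h3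
  have hkey : ∀ᶠ y in l, (∑ u ∈ Finset.range (K y) \ A y,
      if c * n y ≤ u ∧ (u : ℝ) ≤ d * n y then 1 / √((u : ℝ) * n y) else 0) =
      ∑ u ∈ Finset.Icc ⌈c * n y⌉₊ ⌊d * n y⌋₊ \ A y, 1 / √((u : ℝ) * n y) := by
    filter_upwards [hK] with y hy
    rw [← Finset.sum_filter]
    refine Finset.sum_congr ?_ fun _ _ => rfl
    ext u
    simp only [Finset.mem_filter, Finset.mem_sdiff, Finset.mem_range, Finset.mem_Icc, Nat.ceil_le,
      Nat.le_floor_iff (by positivity : 0 ≤ d * n y)]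
    exact ⟨fun h => ⟨h.2, h.1.2⟩, fun h => ⟨⟨hy u h.1.2, h.2⟩, h.1⟩⟩
  refine tendsto_of_tendsto_of_tendsto_of_le_of_le' h3 h1 ?_ ?_
  · filter_upwards [hkey, hn.eventually_gt_atTop 0] with y hy hy0
    rw [hy]
    have hy1 : (0 : ℝ) < n y := by exact_mod_cast hy0
    have h4 := Finset.sum_inter_add_sum_sdiff (Finset.Icc ⌈c * n y⌉₊ ⌊d * n y⌋₊) (A y)
      fun u : ℕ => 1 / √((u : ℝ) * n y)
    have h5 : ∑ u ∈ Finset.Icc ⌈c * n y⌉₊ ⌊d * n y⌋₊ ∩ A y, 1 / √((u : ℝ) * n y) ≤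
        m * ((√c)⁻¹ / n y) := by
      calc _ ≤ ∑ u ∈ Finset.Icc ⌈c * n y⌉₊ ⌊d * n y⌋₊ ∩ A y, (√c)⁻¹ / n y := by
            refine Finset.sum_le_sum fun u hu => ?_
            rw [Finset.mem_inter, Finset.mem_Icc, Nat.ceil_le] at hu
            rw [inv_eq_one_div, div_div]
            refine one_div_le_one_div_of_le (by positivity) (Real.le_sqrt_of_sq_le ?_)
            rw [mul_pow, Real.sq_sqrt hc.le, sq, ← mul_assoc]
            gcongr
            exact hu.1.1
        _ = (Finset.Icc ⌈c * n y⌉₊ ⌊d * n y⌋₊ ∩ A y).card * ((√c)⁻¹ / n y) := by simp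
        _ ≤ _ := by
            gcongr
            exact (Finset.card_le_card Finset.inter_subset_right).trans (hA y)
    simp only [Function.comp]
    linarith
  · filter_upwards [hkey] with y hy
    rw [hy]
    exact Finset.sum_le_sum_of_subset_of_nonneg Finset.sdiff_subset fun _ _ _ => by positivity

variable {a b : ℝ} {Y : Type*} {l : Filter Y}

lemma tendsto_sum_kern_item (ha : 0 < a) (hab : a < b) {j : Y → ℕ} (hj : Tendsto j l atTop)
    {K : Y → ℕ} {A : Y → Finset ℕ} (m : ℕ) (hA : ∀ y, (A y).card ≤ m)
    (hK : ∀ᶠ y in l, ∀ i : ℕ, (i : ℝ) ≤ b * j y → i < K y) :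
    Tendsto (fun y => ∑ i ∈ Finset.range (K y) \ A y, kern a b i (j y)) l
      (𝓝 (2 * (√b - √a))) :=
  tendsto_sum_sdiff ha hab hj m hA hK

lemma tendsto_sum_kern_actor (ha : 0 < a) (hab : a < b) {i : Y → ℕ} (hi : Tendsto i l atTop)
    {K : Y → ℕ} {A : Y → Finset ℕ} (m : ℕ) (hA : ∀ y, (A y).card ≤ m)
    (hK : ∀ᶠ y in l, ∀ u : ℕ, a * u ≤ i y → u < K y) :
    Tendsto (fun y => ∑ u ∈ Finset.range (K y) \ A y, kern a b (i y) u) l (𝓝 (gam a b)) := by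
  have hb := ha.trans hab
  have h1 : ∀ (u : ℕ) (x : ℝ), (u : ℝ) ≤ a⁻¹ * x ↔ a * u ≤ x := fun u x => by
    rw [inv_mul_eq_div, le_div_iff₀' ha]
  have h2 : ∀ (u : ℕ) (x : ℝ), b⁻¹ * x ≤ (u : ℝ) ↔ x ≤ b * u := fun u x => by
    rw [inv_mul_eq_div, div_le_iff₀' hb]
  -- For a fixed item the actors range over `[i/b, i/a]`, so the previous limit applies with `c =
  -- 1/b` and `d = 1/a`.
  have h := tendsto_sum_sdiff (inv_pos.2 hb) (inv_strictAnti₀ ha hab) hi (K := K) m hA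
    (hK.mono fun y hy u hu => hy u ((h1 _ _).1 hu))
  rw [Real.sqrt_inv, Real.sqrt_inv] at h
  refine h.congr fun y => Finset.sum_congr rfl fun u _ => ?_
  simp only [kern, h1, h2, and_comm, mul_comm]

end Riemann

/-! ### Weighted averages and iterated limits. -/

section WeightedSums

variable {X : Type*}

/-- The filter of pairs `(x, i)` with `x` along `l` and with `i ∈ S x` of nonzero weight. -/
def extFilter (l : Filter X) (S : X → Finset ℕ) (w : X → ℕ → ℝ) : Filter (X × ℕ) :=
  comap Prod.fst l ⊓ 𝓟 {z | z.2 ∈ S z.1 ∧ w z.1 z.2 ≠ 0}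

lemma tendsto_fst_extFilter (l : Filter X) (S : X → Finset ℕ) (w : X → ℕ → ℝ) :
    Tendsto Prod.fst (extFilter l S w) l := tendsto_comap.mono_left inf_le_left

lemma eventually_extFilter (l : Filter X) (S : X → Finset ℕ) (w : X → ℕ → ℝ) :
    ∀ᶠ z in extFilter l S w, z.2 ∈ S z.1 ∧ w z.1 z.2 ≠ 0 :=
  (eventually_principal.2 fun _ h => h).filter_mono inf_le_right

/-- Convergence along `extFilter` means convergence uniform over the indices of nonzero weight, so
the weighted sum behaves as if `h` were the constant `c`. Iterating this evaluates multiple sums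
without explicit error terms. -/
lemma tendsto_weighted_sum {l : Filter X} {S : X → Finset ℕ} {w : X → ℕ → ℝ} {h : X × ℕ → ℝ}
    {φ c : ℝ} (hw : ∀ x i, 0 ≤ w x i) (hW : Tendsto (fun x => ∑ i ∈ S x, w x i) l (𝓝 φ))
    (hh : Tendsto h (extFilter l S w) (𝓝 c)) :
    Tendsto (fun x => ∑ i ∈ S x, w x i * h (x, i)) l (𝓝 (φ * c)) := by
  have h1 : Tendsto (fun x => ∑ i ∈ S x, w x i * (h (x, i) - c)) l (𝓝 0) := by
    rw [Metric.tendsto_nhds]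
    intro ε hε
    have hpos : 0 < |φ| + 1 := by positivity
    -- Eventually the total weight is below `|φ| + 1`, so this tolerance produces a total error of
    -- at most `ε / 2`.
    have h2 := (Metric.tendsto_nhds.1 hh) (ε / (2 * (|φ| + 1))) (by positivity)
    rw [extFilter, eventually_inf_principal, eventually_comap] at h2
    have h3 : ∀ᶠ x in l, ∑ i ∈ S x, w x i < |φ| + 1 :=
      hW.eventually_lt_const (by linarith [le_abs_self φ])
    filter_upwards [h2, h3] with x hx hx3
    rw [dist_zero_right, Real.norm_eq_abs]
    calc _ ≤ ∑ i ∈ S x, |w x i * (h (x, i) - c)| := Finset.abs_sum_le_sum_abs _ _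
      _ ≤ ∑ i ∈ S x, w x i * (ε / (2 * (|φ| + 1))) := by
          refine Finset.sum_le_sum fun i hi => ?_
          rw [abs_mul, abs_of_nonneg (hw x i)]
          by_cases h0 : w x i = 0
          · simp [h0]
          · have := hx (x, i) rfl ⟨hi, h0⟩
            rw [Real.dist_eq] at this
            exact mul_le_mul_of_nonneg_left this.le (hw x i)
      _ = (∑ i ∈ S x, w x i) * (ε / (2 * (|φ| + 1))) := by rw [Finset.sum_mul]
      _ ≤ (|φ| + 1) * (ε / (2 * (|φ| + 1))) := by gcongr
      _ = ε / 2 := by field_simp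
      _ < ε := by linarith
  have h2 := h1.add (hW.mul_const c)
  rw [zero_add] at h2
  refine h2.congr fun x => ?_
  rw [Finset.sum_mul, ← Finset.sum_add_distrib]
  exact Finset.sum_congr rfl fun i _ => by ring

end WeightedSums

/-- The edges of the path from actor `s` to actor `t` through the item `i`. -/
def path (i s t : ℕ) : Finset (ℕ × ℕ) := {(i, s), (i, t)}

/-! ### Weights of unions of up to three paths, by coincidences of items. -/

section EdgeWeights

variable {a b : ℝ} {mX mY : ℕ → ℝ}

attribute [local simp] edgeWeight path itemDeg actorDeg Finset.filter_insert
  Finset.filter_singleton Finset.insert_union Finset.image_insert Finset.card_insert_of_notMem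
  Finset.prod_insert

/-- In this identity and the following ones the distinctness hypotheses determine all degrees, and
the moments are read off from them. The factor `kern a b i s * kern a b i t` is kept in front
because it is the weight summed in `pairNorm`. -/
lemma edgeWeight_path {i s t : ℕ} (hst : s ≠ t) :
    edgeWeight a b mX mY (path i s t) = kern a b i s * kern a b i t * (mX 2 * mY 1 ^ 2) := by
  simp [hst, hst.symm]
  ring

lemma edgeWeight_two_same {i s t u : ℕ}
    (hst : s ≠ t) (hus : u ≠ s) (hut : u ≠ t) :
    edgeWeight a b mX mY (path i s t ∪ path i s u) =
      kern a b i s * kern a b i t * (mX 3 * mY 1 ^ 3) *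
        kern a b i u := by
  simp [hst, hus, hut,
    hst.symm, hus.symm, hut.symm]
  ring

lemma edgeWeight_two_ne {i i' s t u : ℕ}
    (h1 : i' ≠ i) (hst : s ≠ t) (hus : u ≠ s) (hut : u ≠ t) :
    edgeWeight a b mX mY (path i s t ∪ path i' s u) =
      kern a b i s * kern a b i t * (mX 2 ^ 2 * mY 2 * mY 1 ^ 2) * kern a b i' s *
        kern a b i' u := by
  simp [h1, hst, hus, hut,
    h1.symm, hst.symm, hus.symm, hut.symm]
  ring

lemma edgeWeight_three_ss_same {i s t u u' : ℕ}
    (hst : s ≠ t) (hus : u ≠ s) (hut : u ≠ t) (hus2 : u' ≠ s) (hut2 : u' ≠ t) (huu : u' ≠ u) :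
    edgeWeight a b mX mY (path i s t ∪ (path i s u ∪ path i s u')) =
      kern a b i s * kern a b i t * (mX 4 * mY 1 ^ 4) *
        (kern a b i u * kern a b i u') := by
  simp [hst, hus, hut, hus2, hut2, huu,
    hst.symm, hus.symm, hut.symm, hus2.symm, hut2.symm, huu.symm]
  ring

lemma edgeWeight_three_ss_third {i i'' s t u u' : ℕ}
    (h2 : i'' ≠ i) (hst : s ≠ t) (hus : u ≠ s) (hut : u ≠ t)
    (hus2 : u' ≠ s) (hut2 : u' ≠ t) (huu : u' ≠ u) :
    edgeWeight a b mX mY (path i s t ∪ (path i s u ∪ path i'' s u')) =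
      kern a b i s * kern a b i t * (mX 2 * mX 3 * mY 2 * mY 1 ^ 3) * kern a b i'' s *
        (kern a b i u * kern a b i'' u') := by
  simp [h2, hst, hus, hut, hus2, hut2, huu,
    h2.symm, hst.symm, hus.symm, hut.symm, hus2.symm, hut2.symm, huu.symm]
  ring

lemma edgeWeight_three_ss_second {i i' s t u u' : ℕ}
    (h1 : i' ≠ i) (hst : s ≠ t) (hus : u ≠ s) (hut : u ≠ t)
    (hus2 : u' ≠ s) (hut2 : u' ≠ t) (huu : u' ≠ u) :
    edgeWeight a b mX mY (path i s t ∪ (path i' s u ∪ path i s u')) =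
      kern a b i s * kern a b i t * (mX 2 * mX 3 * mY 2 * mY 1 ^ 3) * kern a b i' s *
        (kern a b i' u * kern a b i u') := by
  simp [h1, hst, hus, hut, hus2, hut2, huu,
    h1.symm, hst.symm, hus.symm, hut.symm, hus2.symm, hut2.symm, huu.symm]
  ring

lemma edgeWeight_three_ss_pair {i i' s t u u' : ℕ}
    (h1 : i' ≠ i) (hst : s ≠ t) (hus : u ≠ s) (hut : u ≠ t)
    (hus2 : u' ≠ s) (hut2 : u' ≠ t) (huu : u' ≠ u) :
    edgeWeight a b mX mY (path i s t ∪ (path i' s u ∪ path i' s u')) =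
      kern a b i s * kern a b i t * (mX 2 * mX 3 * mY 2 * mY 1 ^ 3) * kern a b i' s *
        (kern a b i' u * kern a b i' u') := by
  simp [h1, hst, hus, hut, hus2, hut2, huu,
    h1.symm, hst.symm, hus.symm, hut.symm, hus2.symm, hut2.symm, huu.symm]
  ring

lemma edgeWeight_three_ss_ne {i i' i'' s t u u' : ℕ}
    (h1 : i' ≠ i) (h2 : i'' ≠ i) (h3 : i'' ≠ i') (hst : s ≠ t) (hus : u ≠ s) (hut : u ≠ t)
    (hus2 : u' ≠ s) (hut2 : u' ≠ t) (huu : u' ≠ u) :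
    edgeWeight a b mX mY (path i s t ∪ (path i' s u ∪ path i'' s u')) =
      kern a b i s * kern a b i t * (mX 2 ^ 3 * mY 3 * mY 1 ^ 3) * kern a b i' s * kern a b i'' s *
        (kern a b i' u * kern a b i'' u') := by
  simp [h1, h2, h3, hst, hus, hut, hus2, hut2, huu,
    h1.symm, h2.symm, h3.symm, hst.symm, hus.symm, hut.symm, hus2.symm, hut2.symm, huu.symm]
  ring

lemma edgeWeight_three_st_same {i s t u u' : ℕ}
    (hst : s ≠ t) (hus : u ≠ s) (hut : u ≠ t) (hus2 : u' ≠ s) (hut2 : u' ≠ t) (huu : u' ≠ u) :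
    edgeWeight a b mX mY (path i s t ∪ (path i s u ∪ path i t u')) =
      kern a b i s * kern a b i t * (mX 4 * mY 1 ^ 4) *
        (kern a b i u * kern a b i u') := by
  simp [hst, hus, hut, hus2, hut2, huu,
    hst.symm, hus.symm, hut.symm, hus2.symm, hut2.symm, huu.symm]
  ring

lemma edgeWeight_three_st_third {i i'' s t u u' : ℕ}
    (h2 : i'' ≠ i) (hst : s ≠ t) (hus : u ≠ s) (hut : u ≠ t)
    (hus2 : u' ≠ s) (hut2 : u' ≠ t) (huu : u' ≠ u) :
    edgeWeight a b mX mY (path i s t ∪ (path i s u ∪ path i'' t u')) =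
      kern a b i s * kern a b i t * (mX 2 * mX 3 * mY 2 * mY 1 ^ 3) * kern a b i'' t *
        (kern a b i u * kern a b i'' u') := by
  simp [h2, hst, hus, hut, hus2, hut2, huu,
    h2.symm, hst.symm, hus.symm, hut.symm, hus2.symm, hut2.symm, huu.symm]
  ring

lemma edgeWeight_three_st_second {i i' s t u u' : ℕ}
    (h1 : i' ≠ i) (hst : s ≠ t) (hus : u ≠ s) (hut : u ≠ t)
    (hus2 : u' ≠ s) (hut2 : u' ≠ t) (huu : u' ≠ u) :
    edgeWeight a b mX mY (path i s t ∪ (path i' s u ∪ path i t u')) =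
      kern a b i s * kern a b i t * (mX 2 * mX 3 * mY 2 * mY 1 ^ 3) * kern a b i' s *
        (kern a b i' u * kern a b i u') := by
  simp [h1, hst, hus, hut, hus2, hut2, huu,
    h1.symm, hst.symm, hus.symm, hut.symm, hus2.symm, hut2.symm, huu.symm]
  ring

/-- Here `i'` is joined to both `s` and `t`. The additional factor `kern a b i' t`, which is of
order `1/t`, makes this pattern negligible. -/
lemma edgeWeight_three_st_pair {i i' s t u u' : ℕ}
    (h1 : i' ≠ i) (hst : s ≠ t) (hus : u ≠ s) (hut : u ≠ t)
    (hus2 : u' ≠ s) (hut2 : u' ≠ t) (huu : u' ≠ u) :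
    edgeWeight a b mX mY (path i s t ∪ (path i' s u ∪ path i' t u')) =
      kern a b i s * kern a b i t * (mX 2 * mX 4 * mY 2 ^ 2 * mY 1 ^ 2) *
        kern a b i' s * kern a b i' t *
        (kern a b i' u * kern a b i' u') := by
  simp [h1, hst, hus, hut, hus2, hut2, huu,
    h1.symm, hst.symm, hus.symm, hut.symm, hus2.symm, hut2.symm, huu.symm]
  ring

lemma edgeWeight_three_st_ne {i i' i'' s t u u' : ℕ}
    (h1 : i' ≠ i) (h2 : i'' ≠ i) (h3 : i'' ≠ i') (hst : s ≠ t) (hus : u ≠ s) (hut : u ≠ t)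
    (hus2 : u' ≠ s) (hut2 : u' ≠ t) (huu : u' ≠ u) :
    edgeWeight a b mX mY (path i s t ∪ (path i' s u ∪ path i'' t u')) =
      kern a b i s * kern a b i t * (mX 2 ^ 3 * mY 2 ^ 2 * mY 1 ^ 2) *
        kern a b i' s * kern a b i'' t *
        (kern a b i' u * kern a b i'' u') := by
  simp [h1, h2, h3, hst, hus, hut, hus2, hut2, huu,
    h1.symm, h2.symm, h3.symm, hst.symm, hus.symm, hut.symm, hus2.symm, hut2.symm, huu.symm]
  ring

lemma edgeWeight_common_same {i s t u : ℕ}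
    (hst : s ≠ t) (hus : u ≠ s) (hut : u ≠ t) :
    edgeWeight a b mX mY (path i s t ∪ (path i s u ∪ path i t u)) =
      kern a b i s * kern a b i t * (mX 3 * mY 1 ^ 3) *
        kern a b i u := by
  simp [hst, hus, hut,
    hst.symm, hus.symm, hut.symm]
  ring

lemma edgeWeight_common_third {i i'' s t u : ℕ}
    (h2 : i'' ≠ i) (hst : s ≠ t) (hus : u ≠ s) (hut : u ≠ t) :
    edgeWeight a b mX mY (path i s t ∪ (path i s u ∪ path i'' t u)) =
      kern a b i s * kern a b i t * (mX 2 * mX 3 * mY 2 ^ 2 * mY 1) * kern a b i'' t *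
        (kern a b i u * kern a b i'' u) := by
  simp [h2, hst, hus, hut,
    h2.symm, hst.symm, hus.symm, hut.symm]
  ring

lemma edgeWeight_common_second {i i' s t u : ℕ}
    (h1 : i' ≠ i) (hst : s ≠ t) (hus : u ≠ s) (hut : u ≠ t) :
    edgeWeight a b mX mY (path i s t ∪ (path i' s u ∪ path i t u)) =
      kern a b i s * kern a b i t * (mX 2 * mX 3 * mY 2 ^ 2 * mY 1) * kern a b i' s *
        (kern a b i' u * kern a b i u) := by
  simp [h1, hst, hus, hut,
    h1.symm, hst.symm, hus.symm, hut.symm]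
  ring

lemma edgeWeight_common_pair {i i' s t u : ℕ}
    (h1 : i' ≠ i) (hst : s ≠ t) (hus : u ≠ s) (hut : u ≠ t) :
    edgeWeight a b mX mY (path i s t ∪ (path i' s u ∪ path i' t u)) =
      kern a b i s * kern a b i t * (mX 2 * mX 3 * mY 2 ^ 2 * mY 1) *
        kern a b i' s * kern a b i' t *
        kern a b i' u := by
  simp [h1, hst, hus, hut,
    h1.symm, hst.symm, hus.symm, hut.symm]
  ring

lemma edgeWeight_common_ne {i i' i'' s t u : ℕ}
    (h1 : i' ≠ i) (h2 : i'' ≠ i) (h3 : i'' ≠ i') (hst : s ≠ t) (hus : u ≠ s) (hut : u ≠ t) :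
    edgeWeight a b mX mY (path i s t ∪ (path i' s u ∪ path i'' t u)) =
      kern a b i s * kern a b i t * (mX 2 ^ 3 * mY 2 ^ 3) * kern a b i' s * kern a b i'' t *
        (kern a b i' u * kern a b i'' u) := by
  simp [h1, h2, h3, hst, hus, hut,
    h1.symm, h2.symm, h3.symm, hst.symm, hus.symm, hut.symm]
  ring

end EdgeWeights

/-! ### Finite ranges of summation and limits of inner sums. -/

/-- A bound for the indices of the items and actors within reach of the actors `p.1`, `p.2`. -/
def indexBound (a b : ℝ) (p : ℕ × ℕ) : ℕ := ⌈(b + b / a) * (p.1 + p.2)⌉₊ + 1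

/-- A range of indices containing all items and actors within reach of the actors `p.1`, `p.2`. -/
def reach (a b : ℝ) (p : ℕ × ℕ) : Finset ℕ := Finset.range (indexBound a b p)

/-- The actors within reach of `p.1`, `p.2` and different from these two. -/
def others (a b : ℝ) (p : ℕ × ℕ) : Finset ℕ := reach a b p \ {p.1, p.2}

/-- The normalization `∑ 1 / (i √(s t))` over the common items of two actors. -/
def pairNorm (a b : ℝ) (p : ℕ × ℕ) : ℝ := ∑ i ∈ reach a b p, kern a b i p.1 * kern a b i p.2

/-- Filters of pairs of distinct actors with indices tending to infinity and having a common
item. -/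
structure IsPairFilter (a b : ℝ) (l : Filter (ℕ × ℕ)) : Prop where
  fst : Tendsto Prod.fst l atTop
  snd : Tendsto Prod.snd l atTop
  ne : ∀ᶠ p in l, p.1 ≠ p.2
  pos : ∀ᶠ p in l, 0 < pairNorm a b p

lemma others_swap (a b : ℝ) (p : ℕ × ℕ) : others a b p.swap = others a b p := by
  simp [others, reach, indexBound, Finset.pair_comm, add_comm]

lemma reach_swap (a b : ℝ) (p : ℕ × ℕ) : reach a b p.swap = reach a b p := by
  simp [reach, indexBound, add_comm]

lemma pairNorm_swap (a b : ℝ) (p : ℕ × ℕ) : pairNorm a b p.swap = pairNorm a b p := by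
  simp [pairNorm, reach_swap, mul_comm]

/-- This symmetry, which the condition `s < t` lacks, lets statements about the second actor be
deduced from those about the first. -/
lemma IsPairFilter.swap {a b : ℝ} {l : Filter (ℕ × ℕ)} (h : IsPairFilter a b l) :
    IsPairFilter a b (l.map Prod.swap) where
  fst := tendsto_map'_iff.2 h.snd
  snd := tendsto_map'_iff.2 h.fst
  ne := eventually_map.2 (h.ne.mono fun _ hp => hp.symm)
  pos := eventually_map.2 (h.pos.mono fun p hp => by rwa [pairNorm_swap])

lemma mem_others {a b : ℝ} {p : ℕ × ℕ} {u : ℕ} :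
    u ∈ others a b p ↔ u ∈ reach a b p ∧ u ≠ p.1 ∧ u ≠ p.2 := by
  simp [others]

section Reach

variable {a b : ℝ}

/-- The summand `b` of the factor in `indexBound` covers the items of the two actors; the summand `b
/ a` covers, in the next lemma, the actors of these items. -/
lemma lt_indexBound (ha : 0 < a) (hab : a < b) {p : ℕ × ℕ} {i : ℕ}
    (h : (i : ℝ) ≤ b * p.1 ∨ (i : ℝ) ≤ b * p.2) : i < indexBound a b p := by
  have hb := ha.trans hab
  refine Nat.lt_succ_of_le (Nat.cast_le (α := ℝ) |>.1 (le_trans ?_ (Nat.le_ceil _)))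
  have h1 : 0 ≤ b * p.1 := by positivity
  have h2 : 0 ≤ b * p.2 := by positivity
  have h3 : 0 ≤ b / a * (p.1 + p.2) := by positivity
  rcases h with h | h <;> nlinarith

lemma lt_indexBound_actor (ha : 0 < a) (hab : a < b) {p : ℕ × ℕ} {i u : ℕ}
    (h : (i : ℝ) ≤ b * p.1 ∨ (i : ℝ) ≤ b * p.2) (hu : a * u ≤ i) : u < indexBound a b p := by
  have hb := ha.trans hab
  refine Nat.lt_succ_of_le (Nat.cast_le (α := ℝ) |>.1 (le_trans ?_ (Nat.le_ceil _)))
  have h1 : 0 ≤ b / a * p.1 := by positivity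
  have h2 : 0 ≤ b / a * p.2 := by positivity
  have h3 : 0 ≤ b * (p.1 + p.2) := by positivity
  have h4 : (u : ℝ) ≤ i / a := by rwa [le_div_iff₀' ha]
  have h5 : (i : ℝ) / a ≤ b / a * p.1 ∨ (i : ℝ) / a ≤ b / a * p.2 := by
    rcases h with h | h
    · left; rw [div_mul_eq_mul_div]; gcongr
    · right; rw [div_mul_eq_mul_div]; gcongr
  rcases h5 with h | h <;> nlinarith

lemma mem_reach_of_kern (ha : 0 < a) (hab : a < b) {p : ℕ × ℕ} {i : ℕ}
    (h : kern a b i p.1 ≠ 0 ∨ kern a b i p.2 ≠ 0) : i ∈ reach a b p :=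
  Finset.mem_range.2 (lt_indexBound ha hab
    (h.imp (fun h => (kern_ne_zero h).2.1) fun h => (kern_ne_zero h).2.1))

lemma mem_reach_of_kern_kern (ha : 0 < a) (hab : a < b) {p : ℕ × ℕ} {i u : ℕ}
    (h : kern a b i p.1 ≠ 0 ∨ kern a b i p.2 ≠ 0) (hu : kern a b i u ≠ 0) : u ∈ reach a b p :=
  Finset.mem_range.2 (lt_indexBound_actor ha hab
    (h.imp (fun h => (kern_ne_zero h).2.1) fun h => (kern_ne_zero h).2.1) (kern_ne_zero hu).1)

variable {Y : Type*}

/-- Items `i y` tending to infinity all of whose actors are within reach of `p y`. -/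
structure IsItem (a b : ℝ) (l : Filter Y) (p : Y → ℕ × ℕ) (i : Y → ℕ) : Prop where
  tendsto : Tendsto i l atTop
  reach : ∀ᶠ y in l, ∀ u : ℕ, a * u ≤ i y → u < indexBound a b (p y)

lemma IsItem.ext {l : Filter Y} {p : Y → ℕ × ℕ} {i : Y → ℕ} (h : IsItem a b l p i)
    (S : Y → Finset ℕ) (w : Y → ℕ → ℝ) :
    IsItem a b (extFilter l S w) (fun z => p z.1) (fun z => i z.1) where
  tendsto := h.tendsto.comp (tendsto_fst_extFilter l S w)
  reach := (tendsto_fst_extFilter l S w).eventually h.reach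

/-- A nonzero kernel gives `a α ≤ i ≤ b α`: the left inequality sends `i` to infinity with `α`, the
right one keeps the actors of `i` within reach. -/
lemma isItem_ext (ha : 0 < a) (hab : a < b) {l : Filter Y} {p : Y → ℕ × ℕ} {α : ℕ × ℕ → ℕ}
    (hα : α = Prod.fst ∨ α = Prod.snd) (ht : Tendsto (fun y => α (p y)) l atTop)
    (S : Y → Finset ℕ) (w : Y → ℕ → ℝ) (hw : ∀ y i, w y i ≠ 0 → kern a b i (α (p y)) ≠ 0) :
    IsItem a b (extFilter l S w) (fun z => p z.1) (fun z => z.2) where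
  tendsto := by
    have h1 : Tendsto (fun z : Y × ℕ => a * (α (p z.1) : ℝ)) (extFilter l S w) atTop :=
      ((tendsto_natCast_atTop_atTop.comp ht).const_mul_atTop ha).comp
        (tendsto_fst_extFilter l S w)
    refine tendsto_natCast_atTop_iff (R := ℝ) |>.1 (tendsto_atTop_mono' _ ?_ h1)
    filter_upwards [eventually_extFilter l S w] with z hz
    exact (kern_ne_zero (hw _ _ hz.2)).1
  reach := by
    filter_upwards [eventually_extFilter l S w] with z hz u hu
    have h := (kern_ne_zero (hw _ _ hz.2)).2.1
    refine lt_indexBound_actor ha hab ?_ hu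
    rcases hα with rfl | rfl
    exacts [Or.inl h, Or.inr h]

/-- The sum of the kernel over the actors other than `p.1` and `p.2`. -/
def actorSum (a b : ℝ) (p : ℕ × ℕ) (i : ℕ) : ℝ := ∑ u ∈ others a b p, kern a b i u

/-- The sum of products of the kernel over pairs of distinct actors other than `p.1`, `p.2`. -/
def actorPairSum (a b : ℝ) (p : ℕ × ℕ) (i j : ℕ) : ℝ :=
  ∑ r ∈ (others a b p).offDiag, kern a b i r.1 * kern a b j r.2

/-- The sum of products of the kernel over the actors other than `p.1`, `p.2`. -/
def actorCrossSum (a b : ℝ) (p : ℕ × ℕ) (i j : ℕ) : ℝ :=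
  ∑ u ∈ others a b p, kern a b i u * kern a b j u

lemma sum_offDiag_eq (U : Finset ℕ) (f : ℕ × ℕ → ℝ) :
    ∑ r ∈ U.offDiag, f r = ∑ u ∈ U, ∑ u' ∈ U \ {u}, f (u, u') := by
  have h : U.offDiag = (U ×ˢ U).filter fun r => r.2 ≠ r.1 := by
    ext r
    simp only [Finset.mem_offDiag, Finset.mem_filter, Finset.mem_product, and_assoc]
    exact ⟨fun h => ⟨h.1, h.2.1, h.2.2.symm⟩, fun h => ⟨h.1, h.2.1, h.2.2.symm⟩⟩
  rw [h, Finset.sum_filter, Finset.sum_product]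
  refine Finset.sum_congr rfl fun u _ => ?_
  rw [← Finset.sum_filter]
  refine Finset.sum_congr ?_ fun _ _ => rfl
  ext; simp

variable {l : Filter Y} {p : Y → ℕ × ℕ} {i j : Y → ℕ}

lemma tendsto_actorSum (ha : 0 < a) (hab : a < b) (hi : IsItem a b l p i) :
    Tendsto (fun y => actorSum a b (p y) (i y)) l (𝓝 (gam a b)) :=
  tendsto_sum_kern_actor ha hab hi.tendsto 2 (fun _ => Finset.card_le_two) hi.reach

lemma tendsto_actorPairSum (ha : 0 < a) (hab : a < b) (hi : IsItem a b l p i)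
    (hj : IsItem a b l p j) :
    Tendsto (fun y => actorPairSum a b (p y) (i y) (j y)) l (𝓝 (gam a b ^ 2)) := by
  have h1 : Tendsto (fun z : Y × ℕ => ∑ u' ∈ others a b (p z.1) \ {z.2}, kern a b (j z.1) u')
      (extFilter l (fun y => others a b (p y)) fun y u => kern a b (i y) u) (𝓝 (gam a b)) := by
    have h := hj.ext (fun y => others a b (p y)) fun y u => kern a b (i y) u
    -- Three actors are deleted: `p.1`, `p.2` and the actor `u` of the outer sum.
    have h2 := tendsto_sum_kern_actor ha hab h.tendsto
      (A := fun z => {(p z.1).1, (p z.1).2, z.2}) 3 (fun _ => Finset.card_le_three) h.reach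
    refine h2.congr fun z => ?_
    refine Finset.sum_congr ?_ fun _ _ => rfl
    ext; simp [others, reach, and_assoc]
  have h2 := tendsto_weighted_sum (fun y u => kern_nonneg a b (i y) u)
    (tendsto_actorSum ha hab hi) h1
  rw [sq]
  refine h2.congr fun y => ?_
  rw [actorPairSum, sum_offDiag_eq]
  simp only [Finset.mul_sum]

/-- Requiring both items to meet the same actor costs a factor at most `√b / j`, while the sum of
the remaining kernel stays bounded. -/
lemma tendsto_actorCrossSum (ha : 0 < a) (hab : a < b) (hi : IsItem a b l p i)
    (hj : IsItem a b l p j) :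
    Tendsto (fun y => actorCrossSum a b (p y) (i y) (j y)) l (𝓝 0) := by
  have h1 : Tendsto (fun y => √b / (j y : ℝ) * actorSum a b (p y) (i y)) l (𝓝 (0 * gam a b)) :=
    ((tendsto_natCast_atTop_atTop.comp hj.tendsto).const_div_atTop (√b)).mul
      (tendsto_actorSum ha hab hi)
  rw [zero_mul] at h1
  refine squeeze_zero (fun y => Finset.sum_nonneg fun u _ =>
    mul_nonneg (kern_nonneg _ _ _ _) (kern_nonneg _ _ _ _)) (fun y => ?_) h1
  rw [actorCrossSum, actorSum, Finset.mul_sum]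
  refine Finset.sum_le_sum fun u _ => ?_
  rw [mul_comm]
  exact mul_le_mul_of_nonneg_right (kern_le_div_item ha hab _ _) (kern_nonneg _ _ _ _)

/-- The filter of triples `(y, i)`, where `i ∉ J y` is an item of the actor `α (p y)`. -/
abbrev itemFilter (a b : ℝ) (l : Filter Y) (p : Y → ℕ × ℕ) (α : ℕ × ℕ → ℕ) (J : Y → Finset ℕ) :
    Filter (Y × ℕ) :=
  extFilter l (fun y => reach a b (p y) \ J y) fun y i => kern a b i (α (p y))

/-- Each free item attached to an actor contributes the factor `2(√b - √a)`; the deleted set `J`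
keeps it distinct from items chosen earlier. -/
lemma tendsto_item_sum (ha : 0 < a) (hab : a < b) {α : ℕ × ℕ → ℕ}
    (hα : α = Prod.fst ∨ α = Prod.snd) (ht : Tendsto (fun y => α (p y)) l atTop)
    {J : Y → Finset ℕ} (m : ℕ) (hJ : ∀ y, (J y).card ≤ m) {h : Y × ℕ → ℝ} {c : ℝ}
    (hh : Tendsto h (itemFilter a b l p α J) (𝓝 c)) :
    Tendsto (fun y => ∑ i ∈ reach a b (p y) \ J y, kern a b i (α (p y)) * h (y, i)) l
      (𝓝 (2 * (√b - √a) * c)) := by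
  refine tendsto_weighted_sum (fun y i => kern_nonneg a b i _)
    (tendsto_sum_kern_item ha hab ht m hJ ?_) hh
  refine Eventually.of_forall fun y i hi => lt_indexBound ha hab ?_
  rcases hα with rfl | rfl
  exacts [Or.inl hi, Or.inr hi]

/-- The filter of pairs `(p, i)`, where `i` is a common item of the actors `p.1`, `p.2`. -/
abbrev commonFilter (a b : ℝ) (l : Filter (ℕ × ℕ)) : Filter ((ℕ × ℕ) × ℕ) :=
  extFilter l (reach a b) fun p i => kern a b i p.1 * kern a b i p.2 / pairNorm a b p

/-- After division by `pairNorm` the weights have total mass one, so this is an average over the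
common item and no asymptotics of `pairNorm` are required. -/
lemma tendsto_common_sum {l : Filter (ℕ × ℕ)} (hl : IsPairFilter a b l) {h : (ℕ × ℕ) × ℕ → ℝ}
    {c : ℝ} (hh : Tendsto h (commonFilter a b l) (𝓝 c)) :
    Tendsto (fun p => (∑ i ∈ reach a b p, kern a b i p.1 * kern a b i p.2 * h (p, i)) /
      pairNorm a b p) l (𝓝 c) := by
  have hnn : ∀ p, 0 ≤ pairNorm a b p := fun p => Finset.sum_nonneg fun i _ =>
    mul_nonneg (kern_nonneg _ _ _ _) (kern_nonneg _ _ _ _)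
  have h1 := tendsto_weighted_sum (l := l) (S := reach a b)
    (w := fun p i => kern a b i p.1 * kern a b i p.2 / pairNorm a b p) (h := h) (φ := 1) (c := c)
    (fun p i => div_nonneg (mul_nonneg (kern_nonneg _ _ _ _) (kern_nonneg _ _ _ _)) (hnn p)) ?_ hh
  · rw [one_mul] at h1
    refine h1.congr fun p => ?_
    rw [Finset.sum_div]
    exact Finset.sum_congr rfl fun i _ => by ring
  · refine tendsto_const_nhds.congr' ?_
    filter_upwards [hl.pos] with p hp
    rw [← Finset.sum_div]
    exact (div_self hp.ne').symm

lemma isItem_common (ha : 0 < a) (hab : a < b) {l : Filter (ℕ × ℕ)} (hl : IsPairFilter a b l) :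
    IsItem a b (commonFilter a b l) (fun z => z.1) (fun z => z.2) :=
  isItem_ext ha hab (p := fun p => p) (Or.inl rfl) hl.fst _ _ fun p i h hk => by simp [hk] at h

end Reach

/-! ### Limits of the total weights of one and two paths. -/

section Sums

variable (a b : ℝ) (mX mY : ℕ → ℝ) (p : ℕ × ℕ)

/-- The total weight of the paths between `p.1` and `p.2`. -/
def oneSum : ℝ := ∑ i ∈ reach a b p, edgeWeight a b mX mY (path i p.1 p.2)

/-- The total weight of pairs of paths, between `p.1` and `p.2` and between `p.1` and another
actor. -/
def twoSum : ℝ := ∑ q ∈ reach a b p ×ˢ reach a b p, ∑ u ∈ others a b p,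
  edgeWeight a b mX mY (path q.1 p.1 p.2 ∪ path q.2 p.1 u)

/-- The total weight of triples of paths, between `p.1` and `p.2`, between `α` and another actor, and
between `β` and a further actor. -/
def threeSum (α β : ℕ) : ℝ :=
  ∑ q ∈ reach a b p ×ˢ reach a b p ×ˢ reach a b p, ∑ r ∈ (others a b p).offDiag,
    edgeWeight a b mX mY (path q.1 p.1 p.2 ∪ (path q.2.1 α r.1 ∪ path q.2.2 β r.2))

/-- The total weight of triples of paths between `p.1`, `p.2` and another actor. -/
def commonSum : ℝ :=
  ∑ q ∈ reach a b p ×ˢ reach a b p ×ˢ reach a b p, ∑ u ∈ others a b p,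
    edgeWeight a b mX mY (path q.1 p.1 p.2 ∪ (path q.2.1 p.1 u ∪ path q.2.2 p.2 u))

variable {a b p}

lemma sum_split_one {R : Finset ℕ} {i : ℕ} (hi : i ∈ R) (f : ℕ → ℝ) :
    ∑ j ∈ R, f j = f i + ∑ j ∈ R \ {i}, f j := by
  rw [Finset.sdiff_singleton_eq_erase, Finset.add_sum_erase _ _ hi]

/-- These are the five coincidence patterns of the triple `(i, j, k)`: all equal, exactly two equal
in three ways, all distinct. -/
lemma sum_split_two {R : Finset ℕ} {i : ℕ} (hi : i ∈ R) (f : ℕ → ℕ → ℝ) :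
    ∑ j ∈ R, ∑ k ∈ R, f j k = (f i i + ∑ k ∈ R \ {i}, f i k) +
      ∑ j ∈ R \ {i}, (f j i + f j j + ∑ k ∈ R \ {i, j}, f j k) := by
  rw [sum_split_one hi fun j => ∑ k ∈ R, f j k, sum_split_one hi (f i)]
  congr 1
  refine Finset.sum_congr rfl fun j hj => ?_
  have h1 : j ∈ R \ {i} := hj
  have h2 : R \ {i, j} = (R \ {i}) \ {j} := by ext; simp [and_assoc]
  rw [sum_split_one hi (f j), sum_split_one h1 (f j), h2]
  ring

lemma sum_others_eq {f : ℕ → ℝ} {g : ℕ → ℝ} {C : ℝ}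
    (h : ∀ u, u ≠ p.1 → u ≠ p.2 → f u = C * g u) :
    ∑ u ∈ others a b p, f u = C * ∑ u ∈ others a b p, g u := by
  rw [Finset.mul_sum]
  refine Finset.sum_congr rfl fun u hu => ?_
  rw [mem_others] at hu
  exact h u hu.2.1 hu.2.2

lemma sum_others_offDiag_eq {f : ℕ × ℕ → ℝ} {i j : ℕ} {C : ℝ}
    (h : ∀ u u', u ≠ p.1 → u ≠ p.2 → u' ≠ p.1 → u' ≠ p.2 → u' ≠ u →
      f (u, u') = C * (kern a b i u * kern a b j u')) :
    ∑ r ∈ (others a b p).offDiag, f r = C * actorPairSum a b p i j := by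
  rw [actorPairSum, Finset.mul_sum]
  refine Finset.sum_congr rfl fun r hr => ?_
  rw [Finset.mem_offDiag, mem_others, mem_others] at hr
  exact h _ _ hr.1.2.1 hr.1.2.2 hr.2.1.2.1 hr.2.1.2.2 hr.2.2.symm

variable {l : Filter (ℕ × ℕ)}

lemma tendsto_oneSum (hl : IsPairFilter a b l) :
    Tendsto (fun p => oneSum a b mX mY p / pairNorm a b p) l (𝓝 (mX 2 * mY 1 ^ 2)) := by
  refine (tendsto_common_sum hl (h := fun _ => mX 2 * mY 1 ^ 2) tendsto_const_nhds).congr' ?_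
  filter_upwards [hl.ne] with p hp
  rw [oneSum]
  congr 1
  exact Finset.sum_congr rfl fun i _ => (edgeWeight_path hp).symm

/-- The second path either reuses the common item, which gives only a sum over actors, or takes a
new item of `p.1`, which gives the additional factor `2(√b - √a)`. -/
lemma tendsto_twoSum (ha : 0 < a) (hab : a < b) (hl : IsPairFilter a b l) :
    Tendsto (fun p => twoSum a b mX mY p / pairNorm a b p) l
      (𝓝 (mX 3 * mY 1 ^ 3 * gam a b + 2 * (√b - √a) * (mX 2 ^ 2 * mY 2 * mY 1 ^ 2 * gam a b))) := by
  have hi := isItem_common ha hab hl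
  have hs : Tendsto (fun z : (ℕ × ℕ) × ℕ => z.1.1) (commonFilter a b l) atTop :=
    hl.fst.comp (tendsto_fst_extFilter _ _ _)
  have h1 := (tendsto_actorSum ha hab hi).const_mul (mX 3 * mY 1 ^ 3)
  have hj := isItem_ext ha hab (p := fun z : (ℕ × ℕ) × ℕ => z.1) (Or.inl rfl) hs
    (fun z => reach a b z.1 \ {z.2}) _ fun _ _ h => h
  have h2 := tendsto_item_sum ha hab (p := fun z : (ℕ × ℕ) × ℕ => z.1) (Or.inl rfl) hs
    (J := fun z => {z.2}) 1 (fun _ => (Finset.card_singleton _).le)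
    ((tendsto_actorSum ha hab hj).const_mul (mX 2 ^ 2 * mY 2 * mY 1 ^ 2))
  refine (tendsto_common_sum hl (h1.add h2)).congr' ?_
  filter_upwards [hl.ne] with p hp
  rw [twoSum, Finset.sum_product]
  congr 1
  refine Finset.sum_congr rfl fun i hi => ?_
  dsimp only
  rw [sum_split_one hi, mul_add, Finset.mul_sum]
  congr 1
  · rw [sum_others_eq (C := kern a b i p.1 * kern a b i p.2 * (mX 3 * mY 1 ^ 3))
      fun u h1 h2 => edgeWeight_two_same hp h1 h2, actorSum]
    ring
  · refine Finset.sum_congr rfl fun j hj => ?_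
    have hji : j ≠ i := by simpa using (Finset.mem_sdiff.1 hj).2
    rw [sum_others_eq fun u h1 h2 => edgeWeight_two_ne hji hp h1 h2, actorSum]
    ring

end Sums

/-! ### Limits of the total weights of three paths. -/

section TripleSums

variable {a b : ℝ} (mX mY : ℕ → ℝ) {l : Filter (ℕ × ℕ)}

/-- The filter of pairs `(p, i, j)`, where `i` is a common item of `p.1`, `p.2`, and `j ≠ i` is an
item of `α p`. -/
abbrev secondFilter (a b : ℝ) (l : Filter (ℕ × ℕ)) (α : ℕ × ℕ → ℕ) :
    Filter (((ℕ × ℕ) × ℕ) × ℕ) :=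
  itemFilter a b (commonFilter a b l) (fun z => z.1) α fun z => {z.2}

/-- The filter of tuples `(p, i, j, k)`, where `i` is a common item of `p.1`, `p.2`, and `j ≠ i` is an
item of `α p`, and `k ≠ i, j` an item of `β p`. -/
abbrev thirdFilter (a b : ℝ) (l : Filter (ℕ × ℕ)) (α β : ℕ × ℕ → ℕ) :
    Filter ((((ℕ × ℕ) × ℕ) × ℕ) × ℕ) :=
  itemFilter a b (secondFilter a b l α) (fun z => z.1.1) β fun z => {z.1.2, z.2}

/-- The limit of a sum over triples of items, of which the first one is a common item of `p.1`,
`p.2`, the second one an item of `α p` and the third one an item of `β p`. -/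
lemma tendsto_triple_sum (ha : 0 < a) (hab : a < b) (hl : IsPairFilter a b l) {α β : ℕ × ℕ → ℕ}
    (hα : α = Prod.fst ∨ α = Prod.snd) (hβ : β = Prod.fst ∨ β = Prod.snd)
    {S : ℕ × ℕ → ℝ} {f₁ : (ℕ × ℕ) × ℕ → ℝ} {f₂ f₃ f₄ : ((ℕ × ℕ) × ℕ) × ℕ → ℝ}
    {f₅ : (((ℕ × ℕ) × ℕ) × ℕ) × ℕ → ℝ} {c₁ c₂ c₃ c₄ c₅ : ℝ}
    {V : ℕ × ℕ → ℕ → ℕ → ℕ → ℝ}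
    (hS : ∀ p, S p = ∑ q ∈ reach a b p ×ˢ reach a b p ×ˢ reach a b p, V p q.1 q.2.1 q.2.2)
    (h₁ : ∀ p i, p.1 ≠ p.2 → V p i i i = kern a b i p.1 * kern a b i p.2 * f₁ (p, i))
    (h₂ : ∀ p i k, p.1 ≠ p.2 → k ≠ i → V p i i k = kern a b i p.1 * kern a b i p.2 *
      (kern a b k (β p) * f₂ ((p, i), k)))
    (h₃ : ∀ p i j, p.1 ≠ p.2 → j ≠ i → V p i j i = kern a b i p.1 * kern a b i p.2 *
      (kern a b j (α p) * f₃ ((p, i), j)))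
    (h₄ : ∀ p i j, p.1 ≠ p.2 → j ≠ i → V p i j j = kern a b i p.1 * kern a b i p.2 *
      (kern a b j (α p) * f₄ ((p, i), j)))
    (h₅ : ∀ p i j k, p.1 ≠ p.2 → j ≠ i → k ≠ i → k ≠ j → V p i j k =
      kern a b i p.1 * kern a b i p.2 * (kern a b j (α p) * (kern a b k (β p) *
        f₅ (((p, i), j), k))))
    (l₁ : Tendsto f₁ (commonFilter a b l) (𝓝 c₁))
    (l₂ : Tendsto f₂ (secondFilter a b l β) (𝓝 c₂))
    (l₃ : Tendsto f₃ (secondFilter a b l α) (𝓝 c₃))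
    (l₄ : Tendsto f₄ (secondFilter a b l α) (𝓝 c₄))
    (l₅ : Tendsto f₅ (thirdFilter a b l α β) (𝓝 c₅)) :
    Tendsto (fun p => S p / pairNorm a b p) l
      (𝓝 (c₁ + 2 * (√b - √a) * c₂ + 2 * (√b - √a) * (c₃ + c₄ + 2 * (√b - √a) * c₅))) := by
  have hα' : Tendsto (fun z : (ℕ × ℕ) × ℕ => α z.1) (commonFilter a b l) atTop := by
    rcases hα with rfl | rfl
    exacts [hl.fst.comp (tendsto_fst_extFilter _ _ _), hl.snd.comp (tendsto_fst_extFilter _ _ _)]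
  have hβ' : Tendsto (fun z : (ℕ × ℕ) × ℕ => β z.1) (commonFilter a b l) atTop := by
    rcases hβ with rfl | rfl
    exacts [hl.fst.comp (tendsto_fst_extFilter _ _ _), hl.snd.comp (tendsto_fst_extFilter _ _ _)]
  have hβ'' : Tendsto (fun z : ((ℕ × ℕ) × ℕ) × ℕ => β z.1.1) (secondFilter a b l α) atTop :=
    hβ'.comp (tendsto_fst_extFilter _ _ _)
  have t₂ := tendsto_item_sum ha hab (p := fun z : (ℕ × ℕ) × ℕ => z.1) hβ hβ'
    (J := fun z => {z.2}) 1 (fun _ => (Finset.card_singleton _).le) l₂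
  have t₅ := tendsto_item_sum ha hab (p := fun z : ((ℕ × ℕ) × ℕ) × ℕ => z.1.1) hβ hβ''
    (J := fun z => {z.1.2, z.2}) 2 (fun _ => Finset.card_le_two) l₅
  have t₃ := tendsto_item_sum ha hab (p := fun z : (ℕ × ℕ) × ℕ => z.1) hα hα'
    (J := fun z => {z.2}) 1 (fun _ => (Finset.card_singleton _).le) ((l₃.add l₄).add t₅)
  refine (tendsto_common_sum hl ((l₁.add t₂).add t₃)).congr' ?_
  filter_upwards [hl.ne] with p hp
  rw [hS, Finset.sum_product]
  congr 1
  refine Finset.sum_congr rfl fun i hi => ?_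
  rw [Finset.sum_product]
  dsimp only
  rw [sum_split_two hi fun j k => V p i j k, mul_add, mul_add, Finset.mul_sum, Finset.mul_sum,
    h₁ p i hp]
  congr 1
  · congr 1
    refine Finset.sum_congr rfl fun k hk => ?_
    rw [h₂ p i k hp (by simpa using (Finset.mem_sdiff.1 hk).2)]
  · refine Finset.sum_congr rfl fun j hj => ?_
    have hji : j ≠ i := by simpa using (Finset.mem_sdiff.1 hj).2
    rw [h₃ p i j hp hji, h₄ p i j hp hji, mul_add, mul_add, mul_add, mul_add, Finset.mul_sum,
      Finset.mul_sum]
    congr 1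
    refine Finset.sum_congr rfl fun k hk => ?_
    have hk' : k ≠ i ∧ k ≠ j := by simpa using (Finset.mem_sdiff.1 hk).2
    rw [h₅ p i j k hp hji hk'.1 hk'.2]

lemma isItem_second (ha : 0 < a) (hab : a < b) (hl : IsPairFilter a b l) {α : ℕ × ℕ → ℕ}
    (hα : α = Prod.fst ∨ α = Prod.snd) :
    IsItem a b (secondFilter a b l α) (fun z => z.1.1) (fun z => z.2) := by
  refine isItem_ext ha hab (p := fun z : (ℕ × ℕ) × ℕ => z.1) hα ?_ _ _ fun _ _ h => h
  rcases hα with rfl | rfl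
  exacts [hl.fst.comp (tendsto_fst_extFilter _ _ _), hl.snd.comp (tendsto_fst_extFilter _ _ _)]

lemma isItem_third (ha : 0 < a) (hab : a < b) (hl : IsPairFilter a b l) (α : ℕ × ℕ → ℕ)
    {β : ℕ × ℕ → ℕ} (hβ : β = Prod.fst ∨ β = Prod.snd) :
    IsItem a b (thirdFilter a b l α β) (fun z => z.1.1.1) (fun z => z.2) := by
  refine isItem_ext ha hab (p := fun z : ((ℕ × ℕ) × ℕ) × ℕ => z.1.1) hβ ?_ _ _ fun _ _ h => h
  rcases hβ with rfl | rfl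
  exacts [hl.fst.comp ((tendsto_fst_extFilter _ _ _).comp (tendsto_fst_extFilter _ _ _)),
    hl.snd.comp ((tendsto_fst_extFilter _ _ _).comp (tendsto_fst_extFilter _ _ _))]

lemma tendsto_kern_snd (ha : 0 < a) (hl : IsPairFilter a b l) (α : ℕ × ℕ → ℕ) :
    Tendsto (fun z : ((ℕ × ℕ) × ℕ) × ℕ => kern a b z.2 z.1.1.2) (secondFilter a b l α) (𝓝 0) := by
  have h : Tendsto (fun z : ((ℕ × ℕ) × ℕ) × ℕ => z.1.1.2) (secondFilter a b l α) atTop :=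
    hl.snd.comp ((tendsto_fst_extFilter _ _ _).comp (tendsto_fst_extFilter _ _ _))
  exact squeeze_zero (fun z => kern_nonneg _ _ _ _) (fun z => kern_le_div_actor ha _ _)
    ((tendsto_natCast_atTop_atTop.comp h).const_div_atTop _)

/-- The three patterns with two distinct items have equal weight and one free item each, whence `6 =
3 · 2`; the pattern with three distinct items has two free items, whence `4 = 2²`. -/
lemma tendsto_threeSum_ss (ha : 0 < a) (hab : a < b) (hl : IsPairFilter a b l) :
    Tendsto (fun p => threeSum a b mX mY p p.1 p.1 / pairNorm a b p) l
      (𝓝 (mX 4 * mY 1 ^ 4 * gam a b ^ 2 +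
        6 * (√b - √a) * (mX 2 * mX 3 * mY 2 * mY 1 ^ 3 * gam a b ^ 2) +
        4 * (√b - √a) ^ 2 * (mX 2 ^ 3 * mY 3 * mY 1 ^ 3 * gam a b ^ 2))) := by
  have hi := isItem_common ha hab hl
  have hj := isItem_second ha hab hl (Or.inl rfl)
  have hk := isItem_third ha hab hl Prod.fst (Or.inl rfl)
  have hi' := hi.ext (fun z => reach a b z.1 \ {z.2}) fun y i => kern a b i y.1.1
  have hj' := hj.ext (fun z => reach a b z.1.1 \ {z.1.2, z.2}) fun y i => kern a b i y.1.1.1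
  have h := tendsto_triple_sum ha hab hl (α := Prod.fst) (β := Prod.fst) (Or.inl rfl) (Or.inl rfl)
    (S := fun p => threeSum a b mX mY p p.1 p.1)
    (V := fun p i j k => ∑ r ∈ (others a b p).offDiag,
      edgeWeight a b mX mY (path i p.1 p.2 ∪ (path j p.1 r.1 ∪ path k p.1 r.2)))
    (fun p => rfl)
    (f₁ := fun z => mX 4 * mY 1 ^ 4 * actorPairSum a b z.1 z.2 z.2)
    (f₂ := fun z => mX 2 * mX 3 * mY 2 * mY 1 ^ 3 * actorPairSum a b z.1.1 z.1.2 z.2)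
    (f₃ := fun z => mX 2 * mX 3 * mY 2 * mY 1 ^ 3 * actorPairSum a b z.1.1 z.2 z.1.2)
    (f₄ := fun z => mX 2 * mX 3 * mY 2 * mY 1 ^ 3 * actorPairSum a b z.1.1 z.2 z.2)
    (f₅ := fun z => mX 2 ^ 3 * mY 3 * mY 1 ^ 3 * actorPairSum a b z.1.1.1 z.1.2 z.2)
    ?_ ?_ ?_ ?_ ?_ ((tendsto_actorPairSum ha hab hi hi).const_mul _)
    ((tendsto_actorPairSum ha hab hi' hj).const_mul _)
    ((tendsto_actorPairSum ha hab hj hi').const_mul _)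
    ((tendsto_actorPairSum ha hab hj hj).const_mul _)
    ((tendsto_actorPairSum ha hab hj' hk).const_mul _)
  · convert h using 2
    ring
  · intro p i hp
    refine (sum_others_offDiag_eq fun u u' h1 h2 h3 h4 h5 =>
      edgeWeight_three_ss_same hp h1 h2 h3 h4 h5).trans ?_
    ring
  · intro p i k hp hk
    refine (sum_others_offDiag_eq fun u u' h1 h2 h3 h4 h5 =>
      edgeWeight_three_ss_third hk hp h1 h2 h3 h4 h5).trans ?_
    ring
  · intro p i j hp hj
    refine (sum_others_offDiag_eq fun u u' h1 h2 h3 h4 h5 =>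
      edgeWeight_three_ss_second hj hp h1 h2 h3 h4 h5).trans ?_
    ring
  · intro p i j hp hj
    refine (sum_others_offDiag_eq fun u u' h1 h2 h3 h4 h5 =>
      edgeWeight_three_ss_pair hj hp h1 h2 h3 h4 h5).trans ?_
    ring
  · intro p i j k hp hj hk hkj
    refine (sum_others_offDiag_eq fun u u' h1 h2 h3 h4 h5 =>
      edgeWeight_three_ss_ne hj hk hkj hp h1 h2 h3 h4 h5).trans ?_
    ring

/-- Two changes against the case of one end: the pattern `j = k ≠ i` vanishes, since `j` must be an
item of both actors, so `6` becomes `4`; with distinct items both ends have degree two, so `mY 3 *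
mY 1` becomes `mY 2 ^ 2`. -/
lemma tendsto_threeSum_st (ha : 0 < a) (hab : a < b) (hl : IsPairFilter a b l) :
    Tendsto (fun p => threeSum a b mX mY p p.1 p.2 / pairNorm a b p) l
      (𝓝 (mX 4 * mY 1 ^ 4 * gam a b ^ 2 +
        4 * (√b - √a) * (mX 2 * mX 3 * mY 2 * mY 1 ^ 3 * gam a b ^ 2) +
        4 * (√b - √a) ^ 2 * (mX 2 ^ 3 * mY 2 ^ 2 * mY 1 ^ 2 * gam a b ^ 2))) := by
  have hi := isItem_common ha hab hl
  have hj := isItem_second ha hab hl (Or.inl rfl)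
  have hj2 := isItem_second ha hab hl (Or.inr rfl)
  have hk := isItem_third ha hab hl Prod.fst (Or.inr rfl)
  have hi' := hi.ext (fun z => reach a b z.1 \ {z.2}) fun y i => kern a b i y.1.1
  have hi2 := hi.ext (fun z => reach a b z.1 \ {z.2}) fun y i => kern a b i y.1.2
  have hj' := hj.ext (fun z => reach a b z.1.1 \ {z.1.2, z.2}) fun y i => kern a b i y.1.1.2
  have h := tendsto_triple_sum ha hab hl (α := Prod.fst) (β := Prod.snd) (Or.inl rfl) (Or.inr rfl)
    (S := fun p => threeSum a b mX mY p p.1 p.2)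
    (V := fun p i j k => ∑ r ∈ (others a b p).offDiag,
      edgeWeight a b mX mY (path i p.1 p.2 ∪ (path j p.1 r.1 ∪ path k p.2 r.2)))
    (fun p => rfl)
    (f₁ := fun z => mX 4 * mY 1 ^ 4 * actorPairSum a b z.1 z.2 z.2)
    (f₂ := fun z => mX 2 * mX 3 * mY 2 * mY 1 ^ 3 * actorPairSum a b z.1.1 z.1.2 z.2)
    (f₃ := fun z => mX 2 * mX 3 * mY 2 * mY 1 ^ 3 * actorPairSum a b z.1.1 z.2 z.1.2)
    (f₄ := fun z => mX 2 * mX 4 * mY 2 ^ 2 * mY 1 ^ 2 *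
      (kern a b z.2 z.1.1.2 * actorPairSum a b z.1.1 z.2 z.2))
    (f₅ := fun z => mX 2 ^ 3 * mY 2 ^ 2 * mY 1 ^ 2 * actorPairSum a b z.1.1.1 z.1.2 z.2)
    ?_ ?_ ?_ ?_ ?_ ((tendsto_actorPairSum ha hab hi hi).const_mul _)
    ((tendsto_actorPairSum ha hab hi2 hj2).const_mul _)
    ((tendsto_actorPairSum ha hab hj hi').const_mul _)
    (((tendsto_kern_snd ha hl _).mul (tendsto_actorPairSum ha hab hj hj)).const_mul _)
    ((tendsto_actorPairSum ha hab hj' hk).const_mul _)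
  · convert h using 2
    ring
  · intro p i hp
    refine (sum_others_offDiag_eq fun u u' h1 h2 h3 h4 h5 =>
      edgeWeight_three_st_same hp h1 h2 h3 h4 h5).trans ?_
    ring
  · intro p i k hp hk
    refine (sum_others_offDiag_eq fun u u' h1 h2 h3 h4 h5 =>
      edgeWeight_three_st_third hk hp h1 h2 h3 h4 h5).trans ?_
    ring
  · intro p i j hp hj
    refine (sum_others_offDiag_eq fun u u' h1 h2 h3 h4 h5 =>
      edgeWeight_three_st_second hj hp h1 h2 h3 h4 h5).trans ?_
    ring
  · intro p i j hp hj
    refine (sum_others_offDiag_eq fun u u' h1 h2 h3 h4 h5 =>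
      edgeWeight_three_st_pair hj hp h1 h2 h3 h4 h5).trans ?_
    ring
  · intro p i j k hp hj hk hkj
    refine (sum_others_offDiag_eq fun u u' h1 h2 h3 h4 h5 =>
      edgeWeight_three_st_ne hj hk hkj hp h1 h2 h3 h4 h5).trans ?_
    ring

/-- Only the pattern with one item survives. Every other pattern carries either a cross sum over one
actor of two distinct items or an additional kernel factor at `p.2`, and both tend to zero. -/
lemma tendsto_commonSum (ha : 0 < a) (hab : a < b) (hl : IsPairFilter a b l) :
    Tendsto (fun p => commonSum a b mX mY p / pairNorm a b p) l
      (𝓝 (mX 3 * mY 1 ^ 3 * gam a b)) := by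
  have hi := isItem_common ha hab hl
  have hj := isItem_second ha hab hl (Or.inl rfl)
  have hj2 := isItem_second ha hab hl (Or.inr rfl)
  have hk := isItem_third ha hab hl Prod.fst (Or.inr rfl)
  have hi' := hi.ext (fun z => reach a b z.1 \ {z.2}) fun y i => kern a b i y.1.1
  have hi2 := hi.ext (fun z => reach a b z.1 \ {z.2}) fun y i => kern a b i y.1.2
  have hj' := hj.ext (fun z => reach a b z.1.1 \ {z.1.2, z.2}) fun y i => kern a b i y.1.1.2
  have h := tendsto_triple_sum ha hab hl (α := Prod.fst) (β := Prod.snd) (Or.inl rfl) (Or.inr rfl)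
    (S := fun p => commonSum a b mX mY p)
    (V := fun p i j k => ∑ u ∈ others a b p,
      edgeWeight a b mX mY (path i p.1 p.2 ∪ (path j p.1 u ∪ path k p.2 u)))
    (fun p => rfl)
    (f₁ := fun z => mX 3 * mY 1 ^ 3 * actorSum a b z.1 z.2)
    (f₂ := fun z => mX 2 * mX 3 * mY 2 ^ 2 * mY 1 * actorCrossSum a b z.1.1 z.1.2 z.2)
    (f₃ := fun z => mX 2 * mX 3 * mY 2 ^ 2 * mY 1 * actorCrossSum a b z.1.1 z.2 z.1.2)
    (f₄ := fun z => mX 2 * mX 3 * mY 2 ^ 2 * mY 1 *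
      (kern a b z.2 z.1.1.2 * actorSum a b z.1.1 z.2))
    (f₅ := fun z => mX 2 ^ 3 * mY 2 ^ 3 * actorCrossSum a b z.1.1.1 z.1.2 z.2)
    ?_ ?_ ?_ ?_ ?_ ((tendsto_actorSum ha hab hi).const_mul _)
    ((tendsto_actorCrossSum ha hab hi2 hj2).const_mul _)
    ((tendsto_actorCrossSum ha hab hj hi').const_mul _)
    (((tendsto_kern_snd ha hl _).mul (tendsto_actorSum ha hab hj)).const_mul _)
    ((tendsto_actorCrossSum ha hab hj' hk).const_mul _)
  · convert h using 2
    ring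
  · intro p i hp
    rw [sum_others_eq fun u h1 h2 => edgeWeight_common_same hp h1 h2, actorSum]
    ring
  · intro p i k hp hk
    rw [sum_others_eq fun u h1 h2 => edgeWeight_common_third hk hp h1 h2, actorCrossSum]
    ring
  · intro p i j hp hj
    rw [sum_others_eq fun u h1 h2 => edgeWeight_common_second hj hp h1 h2, actorCrossSum]
    ring
  · intro p i j hp hj
    rw [sum_others_eq fun u h1 h2 => edgeWeight_common_pair hj hp h1 h2, actorSum]
    ring
  · intro p i j k hp hj hk hkj
    rw [sum_others_eq fun u h1 h2 => edgeWeight_common_ne hj hk hkj hp h1 h2, actorCrossSum]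
    ring

end TripleSums

/-! ### Indicators, path counts and Bonferroni inequalities. -/

section Indicators

/-- The indicator of the event `cyl T F`. -/
def edgeInd (T : Set ℝ≥0) (F : Finset (ℕ × ℕ)) (ω : Sample) : ℝ := (cyl T F).indicator 1 ω

/-- The indicator of the event `v_s ∼ v_t`. -/
def adjInd (s t : ℕ) (ω : Sample) : ℝ := (adjEvent s t).indicator 1 ω

/-- The number of paths between two actors. -/
def pathCount (T : Set ℝ≥0) (R : Finset ℕ) (s t : ℕ) (ω : Sample) : ℝ :=
  ∑ i ∈ R, edgeInd T (path i s t) ω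

/-- The number of ordered pairs of paths between two actors. -/
def pathPairCount (T : Set ℝ≥0) (R : Finset ℕ) (s t : ℕ) (ω : Sample) : ℝ :=
  ∑ r ∈ R.offDiag, edgeInd T (path r.1 s t ∪ path r.2 s t) ω

lemma edgeInd_nonneg (T : Set ℝ≥0) (F : Finset (ℕ × ℕ)) (ω : Sample) : 0 ≤ edgeInd T F ω :=
  Set.indicator_nonneg (fun _ _ => zero_le_one) _

lemma edgeInd_eq (T : Set ℝ≥0) (F : Finset (ℕ × ℕ)) (ω : Sample) :
    edgeInd T F ω = 0 ∨ edgeInd T F ω = 1 := by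
  by_cases h : ω ∈ cyl T F <;> simp [edgeInd, h]

lemma edgeInd_mul (T : Set ℝ≥0) (F F' : Finset (ℕ × ℕ)) (ω : Sample) :
    edgeInd T F ω * edgeInd T F' ω = edgeInd T (F ∪ F') ω := by
  rw [edgeInd, edgeInd, edgeInd, cyl_union, Set.inter_indicator_one, Pi.mul_apply]

lemma edgeInd_anti (T : Set ℝ≥0) {F F' : Finset (ℕ × ℕ)} (h : F ⊆ F') (ω : Sample) :
    edgeInd T F' ω ≤ edgeInd T F ω :=
  Set.indicator_le_indicator_of_subset
    (show cyl T F' ⊆ cyl T F from fun _ (hω : ∀ e ∈ F', _) e he => hω e (h he))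
    (fun _ => zero_le_one) ω

lemma adjInd_nonneg (s t : ℕ) (ω : Sample) : 0 ≤ adjInd s t ω :=
  Set.indicator_nonneg (fun _ _ => zero_le_one) _

lemma adjInd_le_one (s t : ℕ) (ω : Sample) : adjInd s t ω ≤ 1 := by
  by_cases h : ω ∈ adjEvent s t <;> simp [adjInd, h]

lemma adjInd_mul_self (s t : ℕ) (ω : Sample) : adjInd s t ω * adjInd s t ω = adjInd s t ω := by
  by_cases h : ω ∈ adjEvent s t <;> simp [adjInd, h]

lemma adjEvent_comm (s t : ℕ) : adjEvent s t = adjEvent t s := by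
  ext ω
  exact (graph ω).adj_comm s t

lemma adjInd_comm (s t : ℕ) : adjInd s t = adjInd t s := by
  funext ω; rw [adjInd, adjInd, adjEvent_comm]

lemma pathCount_nonneg (T : Set ℝ≥0) (R : Finset ℕ) (s t : ℕ) (ω : Sample) :
    0 ≤ pathCount T R s t ω := Finset.sum_nonneg fun _ _ => edgeInd_nonneg _ _ _

lemma pathPairCount_nonneg (T : Set ℝ≥0) (R : Finset ℕ) (s t : ℕ) (ω : Sample) :
    0 ≤ pathPairCount T R s t ω := Finset.sum_nonneg fun _ _ => edgeInd_nonneg _ _ _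

lemma measurableSet_adjEvent (s t : ℕ) : MeasurableSet (adjEvent s t) := by
  by_cases hst : s = t
  · have : adjEvent s t = ∅ := by ext ω; simp [adjEvent, graph, hst]
    rw [this]; exact MeasurableSet.empty
  · have : adjEvent s t = ⋃ i, cyl Set.univ (path i s t) := by
      ext ω; simp [adjEvent, graph, hst, cyl, path]
    rw [this]
    exact MeasurableSet.iUnion fun i => measurableSet_cyl MeasurableSet.univ _

lemma measurable_adjInd (s t : ℕ) : Measurable (adjInd s t) :=
  measurable_one.indicator (measurableSet_adjEvent s t)

/-- A Bonferroni inequality. -/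
lemma sum_sub_sum_offDiag_le {R : Finset ℕ} {x : ℕ → ℝ} (hx : ∀ i, x i = 0 ∨ x i = 1) {y : ℝ}
    (hy : 0 ≤ y) (h : ∀ i ∈ R, x i = 1 → 1 ≤ y) :
    ∑ i ∈ R, x i - ∑ r ∈ R.offDiag, x r.1 * x r.2 ≤ y := by
  have h1 : ∑ r ∈ R.offDiag, x r.1 * x r.2 = (∑ i ∈ R, x i) ^ 2 - ∑ i ∈ R, x i := by
    rw [sum_offDiag_eq, sq, Finset.sum_mul_sum, ← Finset.sum_sub_distrib]
    refine Finset.sum_congr rfl fun i hi => ?_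
    rw [sum_split_one hi fun j => x i * x j]
    rcases hx i with h | h <;> simp [h]
  rw [h1]
  by_cases h2 : ∃ i ∈ R, x i = 1
  · obtain ⟨i, hi, hxi⟩ := h2
    -- With `n = ∑ x i` the left side is `2n - n² = 1 - (n - 1)² ≤ 1 ≤ y`.
    nlinarith [h i hi hxi, sq_nonneg (∑ i ∈ R, x i - 1)]
  · push Not at h2
    have : ∑ i ∈ R, x i = 0 := Finset.sum_eq_zero fun i hi => (hx i).resolve_right (h2 i hi)
    rw [this]
    simpa using hy

lemma one_le_adjInd {T : Set ℝ≥0} {s t i : ℕ} {ω : Sample} (hst : s ≠ t)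
    (h : edgeInd T (path i s t) ω = 1) : 1 ≤ adjInd s t ω := by
  have h1 : ω ∈ cyl T (path i s t) := by
    by_contra h2
    simp [edgeInd, h2] at h
  have h2 : ω ∈ adjEvent s t :=
    ⟨hst, i, (h1 (i, s) (by simp [path])).1, (h1 (i, t) (by simp [path])).1⟩
  simp [adjInd, h2]

lemma pathCount_sub_le_adjInd (T : Set ℝ≥0) (R : Finset ℕ) {s t : ℕ} (hst : s ≠ t) (ω : Sample) :
    pathCount T R s t ω - pathPairCount T R s t ω ≤ adjInd s t ω := by
  have h := sum_sub_sum_offDiag_le (R := R) (fun i => edgeInd_eq T (path i s t) ω)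
    (adjInd_nonneg s t ω) fun i _ hi => one_le_adjInd hst hi
  simpa only [edgeInd_mul, pathCount, pathPairCount] using h

/-- Two actors with a common neighbour among the items of `R` are joined by a path. -/
lemma adjInd_le_pathCount {R : Finset ℕ} {s t : ℕ} {ω : Sample}
    (h : ∀ i, ω.2 (i, s) = true → i ∈ R) : adjInd s t ω ≤ pathCount Set.univ R s t ω := by
  by_cases h1 : ω ∈ adjEvent s t
  · obtain ⟨_, i, hs, ht⟩ := h1
    refine (adjInd_le_one s t ω).trans ?_
    have h2 : edgeInd Set.univ (path i s t) ω = 1 := by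
      refine Set.indicator_of_mem (?_ : ω ∈ cyl _ _) _
      simp [cyl, path, hs, ht]
    rw [← h2]
    exact Finset.single_le_sum (f := fun i => edgeInd Set.univ (path i s t) ω)
      (fun _ _ => edgeInd_nonneg _ _ _) (h i hs)
  · rw [adjInd, Set.indicator_of_notMem h1]
    exact pathCount_nonneg _ _ _ _ _

/-- Multiplies two Bonferroni bounds. As `A - A₂` and `B - B₂` may be negative they cannot be
multiplied directly; the nonnegative quantities `min x A` and `min y B` are used in between. -/
lemma mul_sub_le_mul {x y A B A₂ B₂ : ℝ} (hx : 0 ≤ x) (hy : 0 ≤ y) (hA : 0 ≤ A) (hB : 0 ≤ B)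
    (hA₂ : 0 ≤ A₂) (hB₂ : 0 ≤ B₂) (h₁ : A - A₂ ≤ x) (h₂ : B - B₂ ≤ y) :
    A * B - (A₂ * B + A * B₂) ≤ x * y := by
  have h3 : A - A₂ ≤ min x A := le_min h₁ (by linarith)
  have h4 : B - B₂ ≤ min y B := le_min h₂ (by linarith)
  have h5 : min x A * min y B ≤ x * y :=
    mul_le_mul (min_le_left _ _) (min_le_left _ _) (le_min hy hB) hx
  have h6 : (A - min x A) * B ≤ A₂ * B := mul_le_mul_of_nonneg_right (by linarith) hB
  have h7 : min x A * (B - min y B) ≤ A * B₂ :=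
    mul_le_mul (min_le_right _ _) (by linarith) (by linarith [min_le_right y B]) hA
  nlinarith

lemma sum_mul_sum_eq {ι κ : Type*} (s : Finset ι) (t : Finset κ) (f : ι → ℝ) (g : κ → ℝ) :
    (∑ i ∈ s, f i) * ∑ j ∈ t, g j = ∑ q ∈ s ×ˢ t, f q.1 * g q.2 := by
  rw [Finset.sum_mul_sum, Finset.sum_product]

lemma integral_edgeInd {P : Measure Sample} {T : Set ℝ≥0} (hT : MeasurableSet T)
    (F : Finset (ℕ × ℕ)) :
    ∫ ω, edgeInd T F ω ∂P = P.real (cyl T F) := integral_indicator_one (measurableSet_cyl hT F)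

variable {P : Measure Sample} [IsProbabilityMeasure P]

lemma integrable_edgeInd {T : Set ℝ≥0} (hT : MeasurableSet T) (F : Finset (ℕ × ℕ)) :
    Integrable (edgeInd T F) P :=
  (integrable_const 1).indicator (measurableSet_cyl hT F)

lemma integrable_sum_edgeInd {ι κ : Type*} {T : Set ℝ≥0} (hT : MeasurableSet T) (Q : Finset ι)
    (S : Finset κ) (F : ι → κ → Finset (ℕ × ℕ)) :
    Integrable (fun ω => ∑ q ∈ Q, ∑ r ∈ S, edgeInd T (F q r) ω) P :=
  integrable_finsetSum _ fun _ _ => integrable_finsetSum _ fun _ _ => integrable_edgeInd hT _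

lemma integral_sum_edgeInd {ι κ : Type*} {T : Set ℝ≥0} (hT : MeasurableSet T) (Q : Finset ι)
    (S : Finset κ) (F : ι → κ → Finset (ℕ × ℕ)) :
    ∫ ω, ∑ q ∈ Q, ∑ r ∈ S, edgeInd T (F q r) ω ∂P =
      ∑ q ∈ Q, ∑ r ∈ S, P.real (cyl T (F q r)) := by
  rw [integral_finsetSum _ fun _ _ => integrable_finsetSum _ fun _ _ => integrable_edgeInd hT _]
  refine Finset.sum_congr rfl fun q _ => ?_
  rw [integral_finsetSum _ fun _ _ => integrable_edgeInd hT _]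
  exact Finset.sum_congr rfl fun r _ => integral_edgeInd hT _

end Indicators

/-! ### Crude bounds for configurations with a doubled path. -/

section CrudeBounds

variable {a b : ℝ} {c : ℝ}

/-- The product of the kernel, multiplied by a constant `c`, over a finite set of edges. -/
def crude (a b c : ℝ) (F : Finset (ℕ × ℕ)) : ℝ := ∏ e ∈ F, (c * kern a b e.1 e.2)

lemma crude_nonneg (hc : 0 ≤ c) (F : Finset (ℕ × ℕ)) : 0 ≤ crude a b c F :=
  Finset.prod_nonneg fun _ _ => mul_nonneg hc (kern_nonneg _ _ _ _)

/-- An edge already present costs the factor `1`, a new one `c * kern`. Bounding by the sum of both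
avoids a case distinction over coincidences in the error sums. -/
lemma crude_insert_le (hc : 0 ≤ c) (e : ℕ × ℕ) (F : Finset (ℕ × ℕ)) :
    crude a b c (insert e F) ≤
      ((if e ∈ F then 1 else 0) + c * kern a b e.1 e.2) * crude a b c F := by
  by_cases h : e ∈ F
  · rw [Finset.insert_eq_of_mem h, if_pos h]
    have := mul_nonneg (mul_nonneg hc (kern_nonneg a b e.1 e.2))
      (crude_nonneg (a := a) (b := b) hc F)
    linarith
  · rw [if_neg h, zero_add, crude, Finset.prod_insert h, crude]

/-- The factor by which adding a path to at most `m` edges increases the crude bound. -/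
def extConst (a b c : ℝ) (m : ℕ) : ℝ := (m + c * itemBound a b) * (m + 1 + c * actorBound a b)

lemma sum_ite_mem_le {m : ℕ} (S : Finset ℕ) (F : Finset (ℕ × ℕ)) (hF : F.card ≤ m) (g : ℕ → ℕ × ℕ)
    (hg : Function.Injective g) : ∑ x ∈ S, (if g x ∈ F then (1 : ℝ) else 0) ≤ m := by
  rw [← Finset.sum_filter, Finset.sum_const, nsmul_eq_mul, mul_one]
  have h : (S.filter fun x => g x ∈ F).card ≤ F.card :=
    Finset.card_le_card_of_injOn g (fun x hx => (Finset.mem_filter.1 hx).2) hg.injOn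
  exact_mod_cast h.trans hF

/-- Summing first over `u` and then over `i`, new edges give the bounded kernel sums, while
coincidences with the edges already present number at most `m + 1` and `m`. Hence attaching a path
multiplies an error term only by a constant. -/
lemma sum_crude_union_path_le (ha : 0 < a) (hab : a < b) (hc : 0 ≤ c) {m : ℕ}
    (F : Finset (ℕ × ℕ)) (hF : F.card ≤ m) (R S : Finset ℕ) (α : ℕ) :
    ∑ i ∈ R, ∑ u ∈ S, crude a b c (F ∪ path i α u) ≤ extConst a b c m * crude a b c F := by
  have hF0 := crude_nonneg (a := a) (b := b) hc F
  have hk : ∀ i j, 0 ≤ c * kern a b i j := fun i j => mul_nonneg hc (kern_nonneg _ _ _ _)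
  have hite : ∀ q : Prop, [Decidable q] → (0 : ℝ) ≤ if q then 1 else 0 := fun q _ => by
    split_ifs <;> simp
  have h1 : ∀ i u, crude a b c (F ∪ path i α u) ≤
      ((if (i, u) ∈ insert (i, α) F then 1 else 0) + c * kern a b i u) *
        (((if (i, α) ∈ F then 1 else 0) + c * kern a b i α) * crude a b c F) := by
    intro i u
    have h2 : F ∪ path i α u = insert (i, u) (insert (i, α) F) := by
      ext; simp [path]; tauto
    rw [h2]
    refine (crude_insert_le hc _ _).trans ?_
    exact mul_le_mul_of_nonneg_left (crude_insert_le hc _ _) (add_nonneg (hite _) (hk _ _))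
  calc _ ≤ ∑ i ∈ R, ∑ u ∈ S, ((if (i, u) ∈ insert (i, α) F then 1 else 0) + c * kern a b i u) *
        (((if (i, α) ∈ F then 1 else 0) + c * kern a b i α) * crude a b c F) :=
        Finset.sum_le_sum fun i _ => Finset.sum_le_sum fun u _ => h1 i u
    _ ≤ ∑ i ∈ R, (m + 1 + c * actorBound a b) *
        (((if (i, α) ∈ F then 1 else 0) + c * kern a b i α) * crude a b c F) := by
        refine Finset.sum_le_sum fun i _ => ?_
        rw [← Finset.sum_mul]
        refine mul_le_mul_of_nonneg_right ?_ (mul_nonneg (add_nonneg (hite _) (hk _ _)) hF0)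
        rw [Finset.sum_add_distrib, ← Finset.mul_sum]
        refine add_le_add ?_ (mul_le_mul_of_nonneg_left (sum_kern_actor_le ha hab i S) hc)
        have h3 := sum_ite_mem_le (m := m + 1) S (insert (i, α) F)
          ((Finset.card_insert_le _ _).trans (by omega)) (fun u => (i, u))
          (Prod.mk_right_injective i)
        exact_mod_cast h3
    _ = (m + 1 + c * actorBound a b) * ((∑ i ∈ R, (if (i, α) ∈ F then (1 : ℝ) else 0) +
        c * ∑ i ∈ R, kern a b i α) * crude a b c F) := by
        rw [← Finset.mul_sum, ← Finset.sum_mul, Finset.sum_add_distrib, Finset.mul_sum]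
    _ ≤ (m + 1 + c * actorBound a b) * ((m + c * itemBound a b) * crude a b c F) := by
        have hG : 0 ≤ actorBound a b := by unfold actorBound; positivity
        refine mul_le_mul_of_nonneg_left (mul_le_mul_of_nonneg_right ?_ hF0) (by positivity)
        exact add_le_add (sum_ite_mem_le R F hF (fun i => (i, α)) (Prod.mk_left_injective α))
          (mul_le_mul_of_nonneg_left (sum_kern_item_le ha hab α R) hc)
    _ = _ := by rw [extConst]; ring

/-- The total crude bound for pairs of paths between `p.1` and `p.2`. -/
lemma sum_crude_pair_le (ha : 0 < a) (hab : a < b) {p : ℕ × ℕ} (hp : p.1 ≠ p.2) :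
    ∑ r ∈ (reach a b p).offDiag, crude a b c (path r.1 p.1 p.2 ∪ path r.2 p.1 p.2) ≤
      c ^ 4 * itemBound a b * (√a)⁻¹ * pairNorm a b p * (p.2 : ℝ)⁻¹ := by
  have hk := kern_nonneg a b
  calc _ ≤ ∑ r ∈ (reach a b p).offDiag, c ^ 4 * ((kern a b r.1 p.1 * kern a b r.1 p.2) *
        (kern a b r.2 p.1 * kern a b r.2 p.2)) := by
        refine Finset.sum_le_sum fun r hr => ?_
        have h := (Finset.mem_offDiag.1 hr).2.2
        refine le_of_eq ?_
        simp [crude, path, h, h.symm, hp, Finset.insert_union]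
        ring
    _ ≤ ∑ r ∈ reach a b p ×ˢ reach a b p, c ^ 4 * ((kern a b r.1 p.1 * kern a b r.1 p.2) *
        (kern a b r.2 p.1 * kern a b r.2 p.2)) := by
        refine Finset.sum_le_sum_of_subset_of_nonneg (fun r hr => ?_) fun r _ _ => ?_
        · rw [Finset.mem_offDiag] at hr
          exact Finset.mem_product.2 ⟨hr.1, hr.2.1⟩
        · have := mul_nonneg (mul_nonneg (hk r.1 p.1) (hk r.1 p.2))
            (mul_nonneg (hk r.2 p.1) (hk r.2 p.2))
          positivity
    _ = c ^ 4 * (pairNorm a b p * pairNorm a b p) := by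
        rw [pairNorm, sum_mul_sum_eq, Finset.mul_sum]
    -- One of the two factors `pairNorm` is sacrificed: the kernel at `p.2` is at most `(√a)⁻¹ /
    -- p.2`, and the kernel at `p.1` has bounded sum.
    _ ≤ c ^ 4 * (pairNorm a b p * ((√a)⁻¹ / p.2 * itemBound a b)) := by
        have h0 : 0 ≤ pairNorm a b p := Finset.sum_nonneg fun i _ => mul_nonneg (hk _ _) (hk _ _)
        refine mul_le_mul_of_nonneg_left (mul_le_mul_of_nonneg_left ?_ h0) (by positivity)
        calc pairNorm a b p ≤ ∑ i ∈ reach a b p, (√a)⁻¹ / p.2 * kern a b i p.1 := by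
              refine Finset.sum_le_sum fun i _ => ?_
              rw [mul_comm]
              exact mul_le_mul_of_nonneg_right (kern_le_div_actor ha _ _) (hk _ _)
          _ ≤ _ := by
              rw [← Finset.mul_sum]
              exact mul_le_mul_of_nonneg_left (sum_kern_item_le ha hab _ _) (by positivity)
    _ = _ := by ring

/-- The total crude bound for a path between `p.1` and `p.2` together with pairs of paths between `α`
and another actor. -/
lemma sum_crude_loop_le (ha : 0 < a) (hab : a < b) (hc : 0 ≤ c) {p : ℕ × ℕ} (hp : p.1 ≠ p.2)
    {α : ℕ} (hα : α = p.1 ∨ α = p.2) (hα0 : 0 < α) :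
    ∑ i ∈ reach a b p, ∑ r ∈ (reach a b p).offDiag, ∑ u ∈ others a b p,
      crude a b c (path i p.1 p.2 ∪ (path r.1 α u ∪ path r.2 α u)) ≤
      c ^ 4 * (1 + c * itemBound a b) ^ 2 * actorBound a b * (√b / a) * pairNorm a b p *
        (α : ℝ)⁻¹ := by
  have hk := kern_nonneg a b
  have hb := ha.trans hab
  have hα' : (0 : ℝ) < α := by exact_mod_cast hα0
  -- `δ i j` bounds the cost of the edge `(j, α)` in the presence of the path through `i`, which
  -- already contains that edge when `j = i`.
  set δ : ℕ → ℕ → ℝ := fun i j => (if j = i then 1 else 0) + c * kern a b j α with hδ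
  have hδ0 : ∀ i j, 0 ≤ δ i j := fun i j => add_nonneg (by split_ifs <;> simp)
    (mul_nonneg hc (hk _ _))
  have hG : 0 ≤ actorBound a b := by unfold actorBound; positivity
  have hI : 0 ≤ itemBound a b := by unfold itemBound; positivity
  have hterm : ∀ i, ∀ r ∈ (reach a b p).offDiag, ∀ u ∈ others a b p,
      crude a b c (path i p.1 p.2 ∪ (path r.1 α u ∪ path r.2 α u)) ≤
        c ^ 4 * (√b / (a * α)) * (kern a b i p.1 * kern a b i p.2) * δ i r.1 * δ i r.2 *
          kern a b r.1 u := by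
    intro i r hr u hu
    have hr' := (Finset.mem_offDiag.1 hr).2.2
    have hu' := (mem_others.1 hu).2
    have huα : u ≠ α := by rcases hα with rfl | rfl; exacts [hu'.1, hu'.2]
    have h1 : path i p.1 p.2 ∪ (path r.1 α u ∪ path r.2 α u) =
        insert (r.1, u) (insert (r.2, u) (insert (r.1, α) (insert (r.2, α) (path i p.1 p.2)))) := by
      ext; simp [path]; tauto
    have h2 : (r.1, u) ∉ insert (r.2, u) (insert (r.1, α) (insert (r.2, α) (path i p.1 p.2))) := by
      simp [path, hr', huα, hu'.1, hu'.2]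
    have h3 : (r.2, u) ∉ insert (r.1, α) (insert (r.2, α) (path i p.1 p.2)) := by
      simp [path, huα, hu'.1, hu'.2]
    have h4 : crude a b c (insert (r.1, α) (insert (r.2, α) (path i p.1 p.2))) ≤
        δ i r.1 * (δ i r.2 * (c ^ 2 * (kern a b i p.1 * kern a b i p.2))) := by
      have h5 : crude a b c (path i p.1 p.2) = c ^ 2 * (kern a b i p.1 * kern a b i p.2) := by
        simp [crude, path, hp]; ring
      have h6 : ∀ j, (j, α) ∈ path i p.1 p.2 → j = i := fun j h => by
        simp only [path, Finset.mem_insert, Finset.mem_singleton, Prod.mk.injEq] at h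
        exact h.elim And.left And.left
      have h7 := crude_nonneg (a := a) (b := b) hc (path i p.1 p.2)
      rw [← h5]
      refine (crude_insert_le hc _ _).trans (mul_le_mul ?_ ?_ (crude_nonneg hc _) (hδ0 _ _))
      · refine add_le_add ?_ le_rfl
        split_ifs with h8 h9 h9
        · exact le_rfl
        · rcases Finset.mem_insert.1 h8 with h8 | h8
          · exact absurd (Prod.mk.injEq _ _ _ _ ▸ h8).1 hr'
          · exact absurd (h6 _ h8) h9
        · exact zero_le_one
        · exact le_rfl
      · refine (crude_insert_le hc _ _).trans (mul_le_mul_of_nonneg_right ?_ h7)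
        refine add_le_add ?_ le_rfl
        split_ifs with h8 h9 h9
        · exact le_rfl
        · exact absurd (h6 _ h8) h9
        · exact zero_le_one
        · exact le_rfl
    -- The gain of `1 / α`: if the product is nonzero, `r.2` is the common item or an item of `α`,
    -- so `r.2 ≥ a α` and `kern a b r.2 u ≤ √b / (a α)`.
    have h8 : (kern a b i p.1 * kern a b i p.2) * δ i r.2 * kern a b r.2 u ≤
        √b / (a * α) * ((kern a b i p.1 * kern a b i p.2) * δ i r.2) := by
      by_cases h0 : (kern a b i p.1 * kern a b i p.2) * δ i r.2 = 0
      · simp [h0]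
      rw [mul_comm (√b / (a * α))]
      refine mul_le_mul_of_nonneg_left ((kern_le_div_item ha hab _ _).trans ?_)
        (mul_nonneg (mul_nonneg (hk _ _) (hk _ _)) (hδ0 _ _))
      have h9 : a * α ≤ r.2 := by
        by_cases h10 : r.2 = i
        · rw [h10]
          rcases hα with rfl | rfl
          · exact (kern_ne_zero (b := b) fun h => h0 (by simp [h])).1
          · exact (kern_ne_zero (b := b) fun h => h0 (by simp [h])).1
        · exact (kern_ne_zero (b := b) fun h => h0 (by simp [hδ, h, h10])).1
      gcongr
    rw [h1, crude, Finset.prod_insert h2, Finset.prod_insert h3]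
    change c * kern a b r.1 u * (c * kern a b r.2 u * crude a b c _) ≤ _
    calc _ ≤ c * kern a b r.1 u * (c * kern a b r.2 u *
          (δ i r.1 * (δ i r.2 * (c ^ 2 * (kern a b i p.1 * kern a b i p.2))))) := by
          refine mul_le_mul_of_nonneg_left (mul_le_mul_of_nonneg_left h4 ?_) ?_ <;>
          exact mul_nonneg hc (hk _ _)
      _ = c ^ 4 * kern a b r.1 u * δ i r.1 *
          ((kern a b i p.1 * kern a b i p.2) * δ i r.2 * kern a b r.2 u) := by ring
      _ ≤ c ^ 4 * kern a b r.1 u * δ i r.1 *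
          (√b / (a * α) * ((kern a b i p.1 * kern a b i p.2) * δ i r.2)) :=
          mul_le_mul_of_nonneg_left h8
            (mul_nonneg (mul_nonneg (by positivity) (hk _ _)) (hδ0 _ _))
      _ = _ := by ring
  have hsumδ : ∀ i, ∑ j ∈ reach a b p, δ i j ≤ 1 + c * itemBound a b := by
    intro i
    rw [hδ, Finset.sum_add_distrib, ← Finset.mul_sum, Finset.sum_ite_eq']
    refine add_le_add (by split_ifs <;> simp)
      (mul_le_mul_of_nonneg_left (sum_kern_item_le ha hab _ _) hc)
  have hsumδ0 : ∀ i, 0 ≤ ∑ j ∈ reach a b p, δ i j := fun i => Finset.sum_nonneg fun j _ => hδ0 i j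
  have hC : ∀ i, 0 ≤ c ^ 4 * (√b / (a * α)) * (kern a b i p.1 * kern a b i p.2) := fun i =>
    mul_nonneg (by positivity) (mul_nonneg (hk _ _) (hk _ _))
  calc _ ≤ ∑ i ∈ reach a b p, ∑ r ∈ (reach a b p).offDiag,
        c ^ 4 * (√b / (a * α)) * (kern a b i p.1 * kern a b i p.2) * δ i r.1 * δ i r.2 *
          actorBound a b := by
        refine Finset.sum_le_sum fun i _ => Finset.sum_le_sum fun r hr => ?_
        refine (Finset.sum_le_sum (hterm i r hr)).trans ?_
        rw [← Finset.mul_sum]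
        exact mul_le_mul_of_nonneg_left (sum_kern_actor_le ha hab _ _)
          (mul_nonneg (mul_nonneg (hC i) (hδ0 _ _)) (hδ0 _ _))
    _ ≤ ∑ i ∈ reach a b p, ∑ r ∈ reach a b p ×ˢ reach a b p,
        c ^ 4 * (√b / (a * α)) * (kern a b i p.1 * kern a b i p.2) * actorBound a b *
          (δ i r.1 * δ i r.2) := by
        refine Finset.sum_le_sum fun i _ => ?_
        refine (Finset.sum_le_sum_of_subset_of_nonneg (t := reach a b p ×ˢ reach a b p)
          (fun r hr => ?_) fun r _ _ => ?_).trans (le_of_eq ?_)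
        · rw [Finset.mem_offDiag] at hr
          exact Finset.mem_product.2 ⟨hr.1, hr.2.1⟩
        · exact mul_nonneg (mul_nonneg (mul_nonneg (hC i) (hδ0 _ _)) (hδ0 _ _)) hG
        · exact Finset.sum_congr rfl fun r _ => by ring
    _ ≤ ∑ i ∈ reach a b p,
        c ^ 4 * (√b / (a * α)) * (kern a b i p.1 * kern a b i p.2) * actorBound a b *
          (1 + c * itemBound a b) ^ 2 := by
        refine Finset.sum_le_sum fun i _ => ?_
        rw [← Finset.mul_sum, ← sum_mul_sum_eq, sq]
        exact mul_le_mul_of_nonneg_left (mul_le_mul (hsumδ i) (hsumδ i) (hsumδ0 i) (by positivity))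
          (mul_nonneg (hC i) hG)
    _ = _ := by
        rw [pairNorm, Finset.mul_sum, Finset.sum_mul]
        exact Finset.sum_congr rfl fun i _ => by field_simp

end CrudeBounds

/-! ### Orders of the moments and truncation of the weights. -/

section Moments

variable {a b : ℝ} {μX μY : Measure ℝ≥0} [IsProbabilityMeasure μX] [IsProbabilityMeasure μY]

lemma itemDeg_le {F : Finset (ℕ × ℕ)} {A B : Finset ℕ} (h : F ⊆ A ×ˢ B) (i : ℕ) :
    itemDeg F i ≤ B.card := by
  refine Finset.card_le_card_of_injOn Prod.snd (fun e he => ?_) fun e he e' he' hee => ?_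
  · exact (Finset.mem_product.1 (h (Finset.mem_filter.1 he).1)).2
  · exact Prod.ext ((Finset.mem_filter.1 he).2.trans (Finset.mem_filter.1 he').2.symm) hee

lemma actorDeg_le {F : Finset (ℕ × ℕ)} {A B : Finset ℕ} (h : F ⊆ A ×ˢ B) (j : ℕ) :
    actorDeg F j ≤ A.card := by
  refine Finset.card_le_card_of_injOn Prod.fst (fun e he => ?_) fun e he e' he' hee => ?_
  · exact (Finset.mem_product.1 (h (Finset.mem_filter.1 he).1)).1
  · exact Prod.ext hee ((Finset.mem_filter.1 he).2.trans (Finset.mem_filter.1 he').2.symm)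

lemma tmoment_univ (μ : Measure ℝ≥0) : tmoment Set.univ μ = wmoment μ := by
  funext k; simp [tmoment, wmoment]

lemma integrable_pow_of_le {μ : Measure ℝ≥0} [IsProbabilityMeasure μ] {n k : ℕ}
    (h : Integrable (fun x : ℝ≥0 => (x : ℝ) ^ n) μ) (hk : k ≤ n) :
    Integrable (fun x : ℝ≥0 => (x : ℝ) ^ k) μ := by
  refine ((integrable_const (1 : ℝ)).add h).mono' (by fun_prop) (ae_of_all _ fun x => ?_)
  rw [Real.norm_of_nonneg (by positivity), Pi.add_apply]
  rcases le_total (x : ℝ) 1 with hx | hx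
  · exact (pow_le_one₀ x.2 hx).trans (le_add_of_nonneg_right (by positivity))
  · exact (pow_le_pow_right₀ hx hk).trans (le_add_of_nonneg_left zero_le_one)

/-- The moments of order four and three enter here: an item has at most `B.card ≤ 4` edges and an
actor at most `A.card ≤ 3`, and these are the numbers of actors and items that three paths can
involve. -/
lemma law_real_cyl_univ_le (hX : Integrable (fun x : ℝ≥0 => (x : ℝ) ^ 4) μX)
    (hY : Integrable (fun y : ℝ≥0 => (y : ℝ) ^ 3) μY) {F : Finset (ℕ × ℕ)} {A B : Finset ℕ}
    (hF : F ⊆ A ×ˢ B) (hA : A.card ≤ 3) (hB : B.card ≤ 4) :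
    (law a b (fun t : ℕ => (t : ℝ)) μX μY).real (cyl Set.univ F) ≤
      edgeWeight a b (wmoment μX) (wmoment μY) F := by
  rw [← tmoment_univ, ← tmoment_univ]
  refine law_real_cyl_le MeasurableSet.univ F (fun i => ?_) fun j => ?_
  · simpa using integrable_pow_of_le hX ((itemDeg_le hF i).trans hB)
  · simpa using integrable_pow_of_le hY ((actorDeg_le hF j).trans hA)

/-- The pair `p` has indices so large that edges between vertices of weights at most `M` within
reach of `p` have probabilities less than `1`. -/
def IsLarge (a b : ℝ) (M : ℝ≥0) (p : ℕ × ℕ) : Prop :=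
  ∀ α : ℕ, α = p.1 ∨ α = p.2 → (M : ℝ) ^ 4 ≤ a * α ^ 2 ∧ (M : ℝ) ^ 4 ≤ a ^ 2 / b * α ^ 2

lemma eventually_isLarge (ha : 0 < a) (hab : a < b) {l : Filter (ℕ × ℕ)} (hl : IsPairFilter a b l)
    (M : ℝ≥0) : ∀ᶠ p in l, IsLarge a b M p := by
  have hb := ha.trans hab
  have h : ∀ {f : ℕ × ℕ → ℕ}, Tendsto f l atTop →
      ∀ᶠ p in l, (M : ℝ) ^ 4 ≤ a * (f p : ℝ) ^ 2 ∧ (M : ℝ) ^ 4 ≤ a ^ 2 / b * (f p : ℝ) ^ 2 := by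
    intro f hf
    have h1 : Tendsto (fun p => (f p : ℝ) ^ 2) l atTop :=
      (tendsto_pow_atTop two_ne_zero).comp (tendsto_natCast_atTop_atTop.comp hf)
    exact ((h1.const_mul_atTop ha).eventually_ge_atTop _).and
      ((h1.const_mul_atTop (by positivity : 0 < a ^ 2 / b)).eventually_ge_atTop _)
  filter_upwards [h hl.fst, h hl.snd] with p h1 h2
  rintro α (rfl | rfl)
  exacts [h1, h2]

/-- From `i ≥ a α` follows `i α ≥ a α²`; from `u ≥ i / b` follows `i u ≥ i² / b ≥ a² α² / b`. These
are the two conditions in `IsLarge`. -/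
lemma IsLarge.path (ha : 0 < a) (hab : a < b) {M : ℝ≥0} {p : ℕ × ℕ} (h : IsLarge a b M p)
    {i α u : ℕ} (hα : α = p.1 ∨ α = p.2) (hk : ∀ e ∈ path i α u, kern a b e.1 e.2 ≠ 0) :
    ∀ e ∈ path i α u, (M : ℝ) ^ 4 ≤ (e.1 : ℝ) * e.2 := by
  have hb := ha.trans hab
  have h1 := kern_ne_zero (hk (i, α) (by simp [RandomIntersection.path]))
  have h2 := kern_ne_zero (hk (i, u) (by simp [RandomIntersection.path]))
  dsimp only at h1 h2
  intro e he
  simp only [RandomIntersection.path, Finset.mem_insert, Finset.mem_singleton] at he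
  rcases he with rfl | rfl
  · refine (h α hα).1.trans ?_
    dsimp only
    rw [sq, ← mul_assoc]
    gcongr
    exact h1.1
  · refine (h α hα).2.trans ?_
    dsimp only
    have h3 : (a * α) * (a * α) ≤ i * (b * u) :=
      mul_le_mul (h1.1) (h1.1.trans h2.2.1) (by positivity) (by positivity)
    rw [div_mul_eq_mul_div, div_le_iff₀ hb]
    nlinarith

/-- If some edge lies outside the support of the kernel, the left side is zero, so largeness matters
on the support only. -/
lemma edgeWeight_le_law_real_cyl {M : ℝ≥0} {F : Finset (ℕ × ℕ)}
    (h : (∀ e ∈ F, kern a b e.1 e.2 ≠ 0) → ∀ e ∈ F, (M : ℝ) ^ 4 ≤ (e.1 : ℝ) * e.2) :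
    edgeWeight a b (tmoment (Set.Iic M) μX) (tmoment (Set.Iic M) μY) F ≤
      (law a b (fun t : ℕ => (t : ℝ)) μX μY).real (cyl (Set.Iic M) F) := by
  by_cases h1 : ∀ e ∈ F, kern a b e.1 e.2 ≠ 0
  · exact le_law_real_cyl F (h h1)
  · push Not at h1
    obtain ⟨e, he, h1⟩ := h1
    rw [edgeWeight, Finset.prod_eq_zero he h1, zero_mul, zero_mul]
    exact measureReal_nonneg

lemma forall_mem_union_imp {F F' : Finset (ℕ × ℕ)} {P Q : ℕ × ℕ → Prop}
    (h : (∀ e ∈ F, P e) → ∀ e ∈ F, Q e) (h' : (∀ e ∈ F', P e) → ∀ e ∈ F', Q e)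
    (hk : ∀ e ∈ F ∪ F', P e) : ∀ e ∈ F ∪ F', Q e := by
  intro e he
  rcases Finset.mem_union.1 he with he | he
  · exact h (fun e he => hk e (Finset.mem_union_left _ he)) e he
  · exact h' (fun e he => hk e (Finset.mem_union_right _ he)) e he

end Moments

/-! ### Sums of the crude bounds over configurations. -/

section ErrorSums

variable {a b c : ℝ}

lemma card_path_le (i s t : ℕ) : (path i s t).card ≤ 2 := Finset.card_le_two

lemma card_union_le_add {F F' : Finset (ℕ × ℕ)} {m n : ℕ} (h : F.card ≤ m) (h' : F'.card ≤ n) :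
    (F ∪ F').card ≤ m + n := (Finset.card_union_le _ _).trans (add_le_add h h')

lemma extConst_nonneg (ha : 0 < a) (hab : a < b) (hc : 0 ≤ c) (m : ℕ) :
    0 ≤ extConst a b c m := by
  have hb := ha.trans hab
  unfold extConst itemBound actorBound
  positivity

lemma sum_crude_ext_le (ha : 0 < a) (hab : a < b) (hc : 0 ≤ c) {m : ℕ} {ι : Type*} (Q : Finset ι)
    (F : ι → Finset (ℕ × ℕ)) (hF : ∀ q, (F q).card ≤ m) (R U : Finset ℕ) (α : ℕ) :
    ∑ q ∈ Q ×ˢ R, ∑ u ∈ U, crude a b c (F q.1 ∪ path q.2 α u) ≤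
      extConst a b c m * ∑ q ∈ Q, crude a b c (F q) := by
  rw [Finset.sum_product, Finset.mul_sum]
  exact Finset.sum_le_sum fun q _ => sum_crude_union_path_le ha hab hc (F q) (hF q) R U α

lemma sum_offDiag_swap (U : Finset ℕ) (f : ℕ × ℕ → ℝ) :
    ∑ r ∈ U.offDiag, f r.swap = ∑ r ∈ U.offDiag, f r := by
  refine Finset.sum_nbij' Prod.swap Prod.swap ?_ ?_ ?_ ?_ ?_ <;> simp +contextual [eq_comm]

/-- The terms are nonnegative, so the condition `u' ≠ u` is dropped and the new path is summed over
all its free ends. -/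
lemma sum_crude_ext_offDiag_le (ha : 0 < a) (hab : a < b) (hc : 0 ≤ c) {m : ℕ} {ι : Type*}
    (Q : Finset ι) (F : ι → ℕ → Finset (ℕ × ℕ)) (hF : ∀ q u, (F q u).card ≤ m) (R U : Finset ℕ)
    (α : ℕ) :
    ∑ q ∈ Q ×ˢ R, ∑ r ∈ U.offDiag, crude a b c (F q.1 r.1 ∪ path q.2 α r.2) ≤
      extConst a b c m * ∑ q ∈ Q, ∑ u ∈ U, crude a b c (F q u) := by
  rw [Finset.sum_product, Finset.mul_sum]
  refine Finset.sum_le_sum fun q _ => ?_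
  calc ∑ i ∈ R, ∑ r ∈ U.offDiag, crude a b c (F q r.1 ∪ path i α r.2)
      ≤ ∑ i ∈ R, ∑ u ∈ U, ∑ u' ∈ U, crude a b c (F q u ∪ path i α u') := by
        refine Finset.sum_le_sum fun i _ => ?_
        rw [sum_offDiag_eq]
        exact Finset.sum_le_sum fun u _ => Finset.sum_le_sum_of_subset_of_nonneg
          Finset.sdiff_subset fun _ _ _ => crude_nonneg hc _
    _ = ∑ u ∈ U, ∑ i ∈ R, ∑ u' ∈ U, crude a b c (F q u ∪ path i α u') := Finset.sum_comm
    _ ≤ ∑ u ∈ U, extConst a b c m * crude a b c (F q u) :=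
        Finset.sum_le_sum fun u _ => sum_crude_union_path_le ha hab hc (F q u) (hF q u) R U α
    _ = _ := by rw [Finset.mul_sum]

/-- A constant for the error terms with two paths between the same pair of actors. -/
def errConst (a b c : ℝ) : ℝ :=
  c ^ 4 * itemBound a b * (√a)⁻¹ +
    c ^ 4 * (1 + c * itemBound a b) ^ 2 * actorBound a b * (√b / a)

/-- The bound for the error terms with two paths between the same pair of actors. -/
def errBound (a b c : ℝ) (p : ℕ × ℕ) : ℝ :=
  errConst a b c * pairNorm a b p * ((p.1 : ℝ)⁻¹ + (p.2 : ℝ)⁻¹)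

lemma pairNorm_nonneg (a b : ℝ) (p : ℕ × ℕ) : 0 ≤ pairNorm a b p :=
  Finset.sum_nonneg fun _ _ => mul_nonneg (kern_nonneg _ _ _ _) (kern_nonneg _ _ _ _)

lemma sum_crude_pair_le_errBound (ha : 0 < a) (hab : a < b) {p : ℕ × ℕ}
    (hp : p.1 ≠ p.2) :
    ∑ r ∈ (reach a b p).offDiag, crude a b c (path r.1 p.1 p.2 ∪ path r.2 p.1 p.2) ≤
      errBound a b c p := by
  have hb := ha.trans hab
  refine (sum_crude_pair_le ha hab hp).trans ?_
  rw [errBound, errConst]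
  have h1 : 0 ≤ c ^ 4 * itemBound a b * (√a)⁻¹ := by unfold itemBound; positivity
  have h2 : 0 ≤ c ^ 4 * (1 + c * itemBound a b) ^ 2 * actorBound a b * (√b / a) := by
    unfold actorBound; positivity
  have h3 := pairNorm_nonneg a b p
  gcongr
  · exact le_add_of_nonneg_right h2
  · exact le_add_of_nonneg_left (by positivity)

lemma sum_crude_loop_le_errBound (ha : 0 < a) (hab : a < b) (hc : 0 ≤ c) {p : ℕ × ℕ}
    (hp : p.1 ≠ p.2) {α : ℕ} (hα : α = p.1 ∨ α = p.2) (hα0 : 0 < α) :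
    ∑ q ∈ reach a b p ×ˢ (reach a b p).offDiag, ∑ u ∈ others a b p,
      crude a b c (path q.1 p.1 p.2 ∪ (path q.2.1 α u ∪ path q.2.2 α u)) ≤ errBound a b c p := by
  have hb := ha.trans hab
  rw [Finset.sum_product]
  refine (sum_crude_loop_le ha hab hc hp hα hα0).trans ?_
  rw [errBound, errConst]
  have h1 : 0 ≤ c ^ 4 * itemBound a b * (√a)⁻¹ := by unfold itemBound; positivity
  have h2 : 0 ≤ c ^ 4 * (1 + c * itemBound a b) ^ 2 * actorBound a b * (√b / a) := by
    unfold actorBound; positivity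
  have h3 := pairNorm_nonneg a b p
  gcongr
  · exact le_add_of_nonneg_left h1
  · rcases hα with rfl | rfl
    · exact le_add_of_nonneg_right (by positivity)
    · exact le_add_of_nonneg_left (by positivity)

end ErrorSums

/-! ### Upper bounds for the expected counts. -/

section Expectations

variable {a b : ℝ} {μX μY : Measure ℝ≥0} [IsProbabilityMeasure μX] [IsProbabilityMeasure μY]

lemma sum_edgeInd_mul {ι κ : Type*} (T : Set ℝ≥0) (Q : Finset ι) (S : Finset κ)
    (F : ι → Finset (ℕ × ℕ)) (G : κ → Finset (ℕ × ℕ)) (ω : Sample) :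
    (∑ x ∈ Q, edgeInd T (F x) ω) * ∑ y ∈ S, edgeInd T (G y) ω =
      ∑ q ∈ Q ×ˢ S, edgeInd T (F q.1 ∪ G q.2) ω := by
  rw [sum_mul_sum_eq]
  simp only [edgeInd_mul]

lemma pathCount_mul (T : Set ℝ≥0) (R S : Finset ℕ) (s t u v : ℕ) (ω : Sample) :
    pathCount T R s t ω * pathCount T S u v ω =
      ∑ q ∈ R ×ˢ S, edgeInd T (path q.1 s t ∪ path q.2 u v) ω :=
  sum_edgeInd_mul T R S (fun i => path i s t) (fun i => path i u v) ω

lemma pathCount_mul_mul (T : Set ℝ≥0) (R : Finset ℕ) (s t u v x y : ℕ) (ω : Sample) :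
    pathCount T R s t ω * (pathCount T R u v ω * pathCount T R x y ω) =
      ∑ q ∈ R ×ˢ R ×ˢ R, edgeInd T (path q.1 s t ∪ (path q.2.1 u v ∪ path q.2.2 x y)) ω := by
  rw [pathCount_mul]
  exact sum_edgeInd_mul T R (R ×ˢ R) (fun i => path i s t)
    (fun q => path q.1 u v ∪ path q.2 x y) ω

lemma integrable_adjInd_mul {P : Measure Sample} [IsProbabilityMeasure P] (s t u v : ℕ) :
    Integrable (fun ω => adjInd s t ω * adjInd u v ω) P := by
  refine Integrable.of_bound (C := 1)
    ((measurable_adjInd s t).mul (measurable_adjInd u v)).aestronglyMeasurable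
    (ae_of_all _ fun ω => ?_)
  rw [Real.norm_of_nonneg (mul_nonneg (adjInd_nonneg _ _ _) (adjInd_nonneg _ _ _))]
  exact mul_le_one₀ (adjInd_le_one _ _ _) (adjInd_nonneg _ _ _) (adjInd_le_one _ _ _)

lemma integrable_adjInd_mul_mul {P : Measure Sample} [IsProbabilityMeasure P] (s t u v x y : ℕ) :
    Integrable (fun ω => adjInd s t ω * adjInd u v ω * adjInd x y ω) P := by
  refine Integrable.of_bound (C := 1)
    (((measurable_adjInd s t).mul (measurable_adjInd u v)).mul
      (measurable_adjInd x y)).aestronglyMeasurable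
    (ae_of_all _ fun ω => ?_)
  have h := mul_nonneg (adjInd_nonneg s t ω) (adjInd_nonneg u v ω)
  rw [Real.norm_of_nonneg (mul_nonneg h (adjInd_nonneg _ _ _))]
  exact mul_le_one₀ (mul_le_one₀ (adjInd_le_one _ _ _) (adjInd_nonneg _ _ _) (adjInd_le_one _ _ _))
    (adjInd_nonneg _ _ _) (adjInd_le_one _ _ _)

/-- Almost surely every item of `p.1` or `p.2` lies in `reach a b p`, so the finite path count
detects all their adjacencies. -/
lemma ae_adjInd_le_pathCount (ha : 0 < a) (hab : a < b) (p : ℕ × ℕ) :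
    ∀ᵐ ω ∂(law a b (fun t : ℕ => (t : ℝ)) μX μY), ∀ α, α = p.1 ∨ α = p.2 → ∀ u,
      adjInd α u ω ≤ pathCount Set.univ (reach a b p) α u ω := by
  filter_upwards [ae_kern_ne_zero] with ω hω α hα u
  refine adjInd_le_pathCount fun i hi => mem_reach_of_kern ha hab ?_
  have h := hω _ hi
  rcases hα with rfl | rfl
  exacts [Or.inl h, Or.inr h]

variable (a b μX μY)

/-- The expected number of actors `u ≠ p.1, p.2` with `p.1 ∼ p.2` and `p.1 ∼ u`. -/
def expTwo (p : ℕ × ℕ) : ℝ :=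
  ∫ ω, ∑ u ∈ others a b p, adjInd p.1 p.2 ω * adjInd p.1 u ω
    ∂(law a b (fun t : ℕ => (t : ℝ)) μX μY)

/-- The expected number of pairs of distinct actors `u, v ≠ p.1, p.2` with `p.1 ∼ p.2`, `α ∼ u`
and `β ∼ v`. -/
def expThree (p : ℕ × ℕ) (α β : ℕ) : ℝ :=
  ∫ ω, ∑ r ∈ (others a b p).offDiag, adjInd p.1 p.2 ω * adjInd α r.1 ω * adjInd β r.2 ω
    ∂(law a b (fun t : ℕ => (t : ℝ)) μX μY)

/-- The expected number of actors `u ≠ p.1, p.2` with `p.1 ∼ p.2`, `p.1 ∼ u` and `p.2 ∼ u`. -/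
def expCommon (p : ℕ × ℕ) : ℝ :=
  ∫ ω, ∑ u ∈ others a b p, adjInd p.1 p.2 ω * adjInd p.1 u ω * adjInd p.2 u ω
    ∂(law a b (fun t : ℕ => (t : ℝ)) μX μY)

variable {a b μX μY}

lemma integral_adjInd (P : Measure Sample) (s t : ℕ) :
    ∫ ω, adjInd s t ω ∂P = P.real (adjEvent s t) :=
  integral_indicator_one (measurableSet_adjEvent s t)

section Upper

lemma law_real_adjEvent_le (ha : 0 < a) (hab : a < b)
    (hX : Integrable (fun x : ℝ≥0 => (x : ℝ) ^ 4) μX)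
    (hY : Integrable (fun y : ℝ≥0 => (y : ℝ) ^ 3) μY) (p : ℕ × ℕ) :
    (law a b (fun t : ℕ => (t : ℝ)) μX μY).real (adjEvent p.1 p.2) ≤
      oneSum a b (wmoment μX) (wmoment μY) p := by
  rw [← integral_adjInd, oneSum]
  calc _ ≤ ∫ ω, pathCount Set.univ (reach a b p) p.1 p.2 ω
        ∂(law a b (fun t : ℕ => (t : ℝ)) μX μY) := by
        refine integral_mono_of_nonneg (ae_of_all _ fun ω => adjInd_nonneg _ _ _)
          (integrable_finsetSum _ fun _ _ => integrable_edgeInd MeasurableSet.univ _) ?_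
        filter_upwards [ae_adjInd_le_pathCount ha hab p] with ω hω
        exact hω _ (Or.inl rfl) _
    _ = ∑ i ∈ reach a b p, (law a b (fun t : ℕ => (t : ℝ)) μX μY).real
        (cyl Set.univ (path i p.1 p.2)) := by
        simp only [pathCount]
        rw [integral_finsetSum _ fun _ _ => integrable_edgeInd MeasurableSet.univ _]
        exact Finset.sum_congr rfl fun i _ => integral_edgeInd MeasurableSet.univ _
    _ ≤ _ := by
        refine Finset.sum_le_sum fun i _ => law_real_cyl_univ_le hX hY (A := {i})
          (B := {p.1, p.2}) ?_ (by simp) (Finset.card_le_two.trans (by norm_num))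
        intro e he
        simp only [path, Finset.mem_insert, Finset.mem_singleton] at he
        rcases he with rfl | rfl <;> simp

lemma expTwo_le (ha : 0 < a) (hab : a < b)
    (hX : Integrable (fun x : ℝ≥0 => (x : ℝ) ^ 4) μX)
    (hY : Integrable (fun y : ℝ≥0 => (y : ℝ) ^ 3) μY) (p : ℕ × ℕ)
    : expTwo a b μX μY p ≤ twoSum a b (wmoment μX) (wmoment μY) p := by
  rw [expTwo, twoSum, Finset.sum_comm]
  calc _ ≤ ∫ ω, ∑ u ∈ others a b p, ∑ q ∈ reach a b p ×ˢ reach a b p,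
        edgeInd Set.univ (path q.1 p.1 p.2 ∪ path q.2 p.1 u) ω
        ∂(law a b (fun t : ℕ => (t : ℝ)) μX μY) := by
        refine integral_mono_of_nonneg (ae_of_all _ fun ω => Finset.sum_nonneg fun u _ =>
          mul_nonneg (adjInd_nonneg _ _ _) (adjInd_nonneg _ _ _))
          (integrable_sum_edgeInd MeasurableSet.univ _ _ _) ?_
        filter_upwards [ae_adjInd_le_pathCount ha hab p] with ω hω
        refine Finset.sum_le_sum fun u _ => ?_
        rw [← pathCount_mul]
        exact mul_le_mul (hω _ (Or.inl rfl) _) (hω _ (Or.inl rfl) _) (adjInd_nonneg _ _ _)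
          (pathCount_nonneg _ _ _ _ _)
    _ = _ := integral_sum_edgeInd MeasurableSet.univ _ _ _
    _ ≤ _ := by
        refine Finset.sum_le_sum fun u _ => Finset.sum_le_sum fun q _ =>
          law_real_cyl_univ_le hX hY (A := {q.1, q.2}) (B := {p.1, p.2, u}) ?_
          (Finset.card_le_two.trans (by norm_num)) (Finset.card_le_three.trans (by norm_num))
        intro e he
        simp only [path, Finset.mem_union, Finset.mem_insert, Finset.mem_singleton] at he
        rcases he with (rfl | rfl) | (rfl | rfl) <;> simp

lemma adjInd_triple_le {p : ℕ × ℕ} {ω : Sample} (hω : ∀ α, α = p.1 ∨ α = p.2 → ∀ u,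
    adjInd α u ω ≤ pathCount Set.univ (reach a b p) α u ω) {α β : ℕ} (hα : α = p.1 ∨ α = p.2)
    (hβ : β = p.1 ∨ β = p.2) (u v : ℕ) :
    adjInd p.1 p.2 ω * adjInd α u ω * adjInd β v ω ≤
      ∑ q ∈ reach a b p ×ˢ reach a b p ×ˢ reach a b p,
        edgeInd Set.univ (path q.1 p.1 p.2 ∪ (path q.2.1 α u ∪ path q.2.2 β v)) ω := by
  rw [← pathCount_mul_mul, mul_assoc]
  refine mul_le_mul (hω _ (Or.inl rfl) _) (mul_le_mul (hω _ hα _) (hω _ hβ _)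
    (adjInd_nonneg _ _ _) (pathCount_nonneg _ _ _ _ _))
    (mul_nonneg (adjInd_nonneg _ _ _) (adjInd_nonneg _ _ _)) (pathCount_nonneg _ _ _ _ _)

lemma law_real_cyl_triple_le (hX : Integrable (fun x : ℝ≥0 => (x : ℝ) ^ 4) μX)
    (hY : Integrable (fun y : ℝ≥0 => (y : ℝ) ^ 3) μY) {p : ℕ × ℕ} {α β : ℕ} (hα : α = p.1 ∨ α = p.2)
    (hβ : β = p.1 ∨ β = p.2) (q : ℕ × ℕ × ℕ) (u v : ℕ) :
    (law a b (fun t : ℕ => (t : ℝ)) μX μY).real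
      (cyl Set.univ (path q.1 p.1 p.2 ∪ (path q.2.1 α u ∪ path q.2.2 β v))) ≤
    edgeWeight a b (wmoment μX) (wmoment μY)
      (path q.1 p.1 p.2 ∪ (path q.2.1 α u ∪ path q.2.2 β v)) := by
  refine law_real_cyl_univ_le hX hY (A := {q.1, q.2.1, q.2.2}) (B := {p.1, p.2, u, v}) ?_
    Finset.card_le_three Finset.card_le_four
  intro e he
  simp only [path, Finset.mem_union, Finset.mem_insert, Finset.mem_singleton] at he
  rcases he with (rfl | rfl) | (rfl | rfl) | (rfl | rfl) <;> simp <;> tauto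

lemma expThree_le (ha : 0 < a) (hab : a < b)
    (hX : Integrable (fun x : ℝ≥0 => (x : ℝ) ^ 4) μX)
    (hY : Integrable (fun y : ℝ≥0 => (y : ℝ) ^ 3) μY) (p : ℕ × ℕ) {α β : ℕ} (hα : α = p.1 ∨ α = p.2) (hβ : β = p.1 ∨ β = p.2) :
    expThree a b μX μY p α β ≤ threeSum a b (wmoment μX) (wmoment μY) p α β := by
  rw [expThree, threeSum, Finset.sum_comm]
  refine (integral_mono_of_nonneg (ae_of_all _ fun ω => Finset.sum_nonneg fun u _ =>
    mul_nonneg (mul_nonneg (adjInd_nonneg _ _ _) (adjInd_nonneg _ _ _)) (adjInd_nonneg _ _ _))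
    (integrable_sum_edgeInd MeasurableSet.univ (others a b p).offDiag
      (reach a b p ×ˢ reach a b p ×ˢ reach a b p) fun r q =>
      path q.1 p.1 p.2 ∪ (path q.2.1 α r.1 ∪ path q.2.2 β r.2)) ?_).trans ?_
  · filter_upwards [ae_adjInd_le_pathCount ha hab p] with ω hω
    exact Finset.sum_le_sum fun r _ => adjInd_triple_le hω hα hβ _ _
  · rw [integral_sum_edgeInd MeasurableSet.univ]
    exact Finset.sum_le_sum fun r _ => Finset.sum_le_sum fun q _ =>
      law_real_cyl_triple_le hX hY hα hβ q _ _

lemma expCommon_le (ha : 0 < a) (hab : a < b)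
    (hX : Integrable (fun x : ℝ≥0 => (x : ℝ) ^ 4) μX)
    (hY : Integrable (fun y : ℝ≥0 => (y : ℝ) ^ 3) μY) (p : ℕ × ℕ) :
    expCommon a b μX μY p ≤ commonSum a b (wmoment μX) (wmoment μY) p := by
  rw [expCommon, commonSum, Finset.sum_comm]
  refine (integral_mono_of_nonneg (ae_of_all _ fun ω => Finset.sum_nonneg fun u _ =>
    mul_nonneg (mul_nonneg (adjInd_nonneg _ _ _) (adjInd_nonneg _ _ _)) (adjInd_nonneg _ _ _))
    (integrable_sum_edgeInd MeasurableSet.univ (others a b p)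
      (reach a b p ×ˢ reach a b p ×ˢ reach a b p) fun u q =>
      path q.1 p.1 p.2 ∪ (path q.2.1 p.1 u ∪ path q.2.2 p.2 u)) ?_).trans ?_
  · filter_upwards [ae_adjInd_le_pathCount ha hab p] with ω hω
    exact Finset.sum_le_sum fun r _ =>
      adjInd_triple_le hω (Or.inl rfl) (Or.inr rfl) _ _
  · rw [integral_sum_edgeInd MeasurableSet.univ]
    exact Finset.sum_le_sum fun r _ => Finset.sum_le_sum fun q _ =>
      law_real_cyl_triple_le hX hY (Or.inl rfl) (Or.inr rfl) q _ _

end Upper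

end Expectations

/-! ### Lower bounds for the expected counts by truncation. -/

section Lower

variable {a b : ℝ} {μX μY : Measure ℝ≥0} [IsProbabilityMeasure μX] [IsProbabilityMeasure μY]

/-- The total weight of the triples of paths through one item between `p.1`, `p.2` and another
actor. -/
def commonDiagSum (a b : ℝ) (mX mY : ℕ → ℝ) (p : ℕ × ℕ) : ℝ :=
  ∑ i ∈ reach a b p, ∑ u ∈ others a b p,
    edgeWeight a b mX mY (path i p.1 p.2 ∪ (path i p.1 u ∪ path i p.2 u))

lemma tendsto_commonDiagSum (mX mY : ℕ → ℝ) {l : Filter (ℕ × ℕ)} (ha : 0 < a) (hab : a < b)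
    (hl : IsPairFilter a b l) :
    Tendsto (fun p => commonDiagSum a b mX mY p / pairNorm a b p) l
      (𝓝 (mX 3 * mY 1 ^ 3 * gam a b)) := by
  refine (tendsto_common_sum hl ((tendsto_actorSum ha hab (isItem_common ha hab hl)).const_mul
    (mX 3 * mY 1 ^ 3))).congr' ?_
  filter_upwards [hl.ne] with p hp
  rw [commonDiagSum]
  congr 1
  refine Finset.sum_congr rfl fun i _ => ?_
  rw [sum_others_eq fun u h1 h2 => edgeWeight_common_same hp h1 h2, actorSum]
  ring

lemma IsLarge.edgeWeight_path_le (ha : 0 < a) (hab : a < b) {M : ℝ≥0} {p : ℕ × ℕ}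
    (h : IsLarge a b M p) (i : ℕ) :
    edgeWeight a b (tmoment (Set.Iic M) μX) (tmoment (Set.Iic M) μY) (RandomIntersection.path i p.1 p.2) ≤
      (law a b (fun t : ℕ => (t : ℝ)) μX μY).real
        (cyl (Set.Iic M) (RandomIntersection.path i p.1 p.2)) :=
  edgeWeight_le_law_real_cyl (h.path ha hab (Or.inl rfl))

lemma IsLarge.edgeWeight_two_le (ha : 0 < a) (hab : a < b) {M : ℝ≥0} {p : ℕ × ℕ}
    (h : IsLarge a b M p) (i j u : ℕ) :
    edgeWeight a b (tmoment (Set.Iic M) μX) (tmoment (Set.Iic M) μY)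
        (RandomIntersection.path i p.1 p.2 ∪ RandomIntersection.path j p.1 u) ≤
      (law a b (fun t : ℕ => (t : ℝ)) μX μY).real (cyl (Set.Iic M)
        (RandomIntersection.path i p.1 p.2 ∪ RandomIntersection.path j p.1 u)) :=
  edgeWeight_le_law_real_cyl (forall_mem_union_imp (h.path ha hab (Or.inl rfl))
    (h.path ha hab (Or.inl rfl)))

lemma IsLarge.edgeWeight_three_le (ha : 0 < a) (hab : a < b) {M : ℝ≥0} {p : ℕ × ℕ}
    (h : IsLarge a b M p) {α β : ℕ} (hα : α = p.1 ∨ α = p.2) (hβ : β = p.1 ∨ β = p.2)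
    (i j k u v : ℕ) :
    edgeWeight a b (tmoment (Set.Iic M) μX) (tmoment (Set.Iic M) μY)
        (RandomIntersection.path i p.1 p.2 ∪
          (RandomIntersection.path j α u ∪ RandomIntersection.path k β v)) ≤
      (law a b (fun t : ℕ => (t : ℝ)) μX μY).real (cyl (Set.Iic M)
        (RandomIntersection.path i p.1 p.2 ∪
          (RandomIntersection.path j α u ∪ RandomIntersection.path k β v))) :=
  edgeWeight_le_law_real_cyl (forall_mem_union_imp (h.path ha hab (Or.inl rfl))
    (forall_mem_union_imp (h.path ha hab hα) (h.path ha hab hβ)))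

lemma integral_sum_edgeInd_Iic_le {ι κ : Type*} (M : ℝ≥0) (Q : Finset ι) (S : Finset κ)
    (F : ι → κ → Finset (ℕ × ℕ)) :
    ∫ ω, ∑ q ∈ Q, ∑ r ∈ S, edgeInd (Set.Iic M) (F q r) ω
        ∂(law a b (fun t : ℕ => (t : ℝ)) μX μY) ≤
      ∑ r ∈ S, ∑ q ∈ Q, crude a b ((M : ℝ) ^ 2) (F q r) := by
  rw [integral_sum_edgeInd measurableSet_Iic, Finset.sum_comm]
  exact Finset.sum_le_sum fun _ _ => Finset.sum_le_sum fun _ _ => law_real_cyl_Iic_le M _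

lemma integral_sub_add {Ω : Type*} [MeasurableSpace Ω] {P : Measure Ω} {f g h : Ω → ℝ}
    (hf : Integrable f P) (hg : Integrable g P) (hh : Integrable h P) :
    ∫ ω, (f ω - (g ω + h ω)) ∂P = ∫ ω, f ω ∂P - (∫ ω, g ω ∂P + ∫ ω, h ω ∂P) := by
  rw [← integral_add hg hh]
  exact integral_sub hf (hg.add hh)

lemma integral_sub_add_add {Ω : Type*} [MeasurableSpace Ω] {P : Measure Ω} {f g h k : Ω → ℝ}
    (hf : Integrable f P) (hg : Integrable g P) (hh : Integrable h P) (hk : Integrable k P) :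
    ∫ ω, (f ω - (g ω + h ω + k ω)) ∂P =
      ∫ ω, f ω ∂P - (∫ ω, g ω ∂P + ∫ ω, h ω ∂P + ∫ ω, k ω ∂P) := by
  rw [← integral_add hg hh]
  exact integral_sub_add hf (hg.add hh) hk

lemma oneSum_sub_le (ha : 0 < a) (hab : a < b) {M : ℝ≥0} {p : ℕ × ℕ} (h : IsLarge a b M p)
    (hp : p.1 ≠ p.2) :
    oneSum a b (tmoment (Set.Iic M) μX) (tmoment (Set.Iic M) μY) p -
        errBound a b ((M : ℝ) ^ 2) p ≤
      (law a b (fun t : ℕ => (t : ℝ)) μX μY).real (adjEvent p.1 p.2) := by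
  have hi : ∀ F, Integrable (edgeInd (Set.Iic M) F) (law a b (fun t : ℕ => (t : ℝ)) μX μY) :=
    fun F => integrable_edgeInd measurableSet_Iic F
  have h1 : ∫ ω, (pathCount (Set.Iic M) (reach a b p) p.1 p.2 ω -
      pathPairCount (Set.Iic M) (reach a b p) p.1 p.2 ω) ∂(law a b (fun t : ℕ => (t : ℝ)) μX μY) ≤
      ∫ ω, adjInd p.1 p.2 ω ∂(law a b (fun t : ℕ => (t : ℝ)) μX μY) := by
    refine integral_mono ((integrable_finsetSum _ fun _ _ => hi _).sub
      (integrable_finsetSum _ fun _ _ => hi _))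
      ((integrable_const 1).indicator (measurableSet_adjEvent _ _)) fun ω => ?_
    exact pathCount_sub_le_adjInd _ _ hp ω
  simp only [pathCount, pathPairCount] at h1
  rw [integral_adjInd, integral_sub (integrable_finsetSum _ fun _ _ => hi _)
    (integrable_finsetSum _ fun _ _ => hi _), integral_finsetSum _ fun _ _ => hi _,
    integral_finsetSum _ fun _ _ => hi _] at h1
  simp only [integral_edgeInd measurableSet_Iic] at h1
  refine le_trans (sub_le_sub ?_ ?_) h1
  · exact Finset.sum_le_sum fun i _ => h.edgeWeight_path_le ha hab i
  · exact (Finset.sum_le_sum fun r _ => law_real_cyl_Iic_le M _).trans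
      (sum_crude_pair_le_errBound ha hab hp)

/-- Two errors arise: a doubled path from `p.1` to `p.2`, having at most four edges, with a further
path attached (whence `extConst` at `4`), and a doubled path from `p.1` to `u` (the summand `1`). -/
lemma twoSum_sub_le (ha : 0 < a) (hab : a < b) {M : ℝ≥0} {p : ℕ × ℕ} (h : IsLarge a b M p)
    (hp : p.1 ≠ p.2) (hp0 : 0 < p.1) :
    twoSum a b (tmoment (Set.Iic M) μX) (tmoment (Set.Iic M) μY) p -
        (extConst a b ((M : ℝ) ^ 2) 4 + 1) * errBound a b ((M : ℝ) ^ 2) p ≤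
      expTwo a b μX μY p := by
  set P := law a b (fun t : ℕ => (t : ℝ)) μX μY with hP
  set R := reach a b p with hR
  have hc : (0 : ℝ) ≤ (M : ℝ) ^ 2 := by positivity
  have hi := fun {κ : Type} (Q : Finset κ) (F : ℕ → κ → Finset (ℕ × ℕ)) =>
    integrable_sum_edgeInd (P := P) (measurableSet_Iic (a := M)) (others a b p) Q F
  have h1 : ∫ ω, (∑ u ∈ others a b p, ∑ q ∈ R ×ˢ R,
        edgeInd (Set.Iic M) (path q.1 p.1 p.2 ∪ path q.2 p.1 u) ω -
      (∑ u ∈ others a b p, ∑ q ∈ R.offDiag ×ˢ R,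
        edgeInd (Set.Iic M) ((path q.1.1 p.1 p.2 ∪ path q.1.2 p.1 p.2) ∪ path q.2 p.1 u) ω +
      ∑ u ∈ others a b p, ∑ q ∈ R ×ˢ R.offDiag,
        edgeInd (Set.Iic M) (path q.1 p.1 p.2 ∪ (path q.2.1 p.1 u ∪ path q.2.2 p.1 u)) ω)) ∂P ≤
      expTwo a b μX μY p := by
    refine integral_mono ((hi _ _).sub ((hi _ _).add (hi _ _)))
      (integrable_finsetSum _ fun _ _ => integrable_adjInd_mul _ _ _ _) fun ω => ?_
    dsimp only
    rw [← Finset.sum_add_distrib, ← Finset.sum_sub_distrib]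
    refine Finset.sum_le_sum fun u hu => ?_
    rw [mem_others] at hu
    have h2 := mul_sub_le_mul (adjInd_nonneg p.1 p.2 ω) (adjInd_nonneg p.1 u ω)
      (pathCount_nonneg _ _ _ _ _) (pathCount_nonneg _ _ _ _ _) (pathPairCount_nonneg _ _ _ _ _)
      (pathPairCount_nonneg _ _ _ _ _) (pathCount_sub_le_adjInd (Set.Iic M) R hp ω)
      (pathCount_sub_le_adjInd (Set.Iic M) R hu.2.1.symm ω)
    rw [pathCount_mul] at h2
    refine le_trans (le_of_eq ?_) h2
    congr 2
    · exact (sum_edgeInd_mul (Set.Iic M) R.offDiag R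
        (fun r => path r.1 p.1 p.2 ∪ path r.2 p.1 p.2) (fun i => path i p.1 u) ω).symm
    · exact (sum_edgeInd_mul (Set.Iic M) R R.offDiag
        (fun i => path i p.1 p.2) (fun r => path r.1 p.1 u ∪ path r.2 p.1 u) ω).symm
  rw [integral_sub_add (hi _ _) (hi _ _) (hi _ _)] at h1
  refine le_trans (sub_le_sub ?_ ?_) h1
  · rw [integral_sum_edgeInd measurableSet_Iic, twoSum, Finset.sum_comm]
    exact Finset.sum_le_sum fun u _ => Finset.sum_le_sum fun q _ =>
      h.edgeWeight_two_le ha hab q.1 q.2 u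
  · rw [add_mul, one_mul]
    refine add_le_add ?_ ?_
    · refine (integral_sum_edgeInd_Iic_le M _ _ _).trans ?_
      refine (sum_crude_ext_le ha hab hc (m := 4) R.offDiag
        (fun r => path r.1 p.1 p.2 ∪ path r.2 p.1 p.2)
        (fun r => card_union_le_add (card_path_le _ _ _) (card_path_le _ _ _)) _ _ _).trans ?_
      exact mul_le_mul_of_nonneg_left (sum_crude_pair_le_errBound ha hab hp)
        (extConst_nonneg ha hab hc _)
    · exact (integral_sum_edgeInd_Iic_le M _ _ _).trans
        (sum_crude_loop_le_errBound ha hab hc hp (Or.inl rfl) hp0)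

/-- Any of the three paths may be doubled. In each case three paths with at most six edges are
bounded first and the fourth is attached at the cost of `extConst` at `6`. The two cases with a
doubled path to a further actor give the summand `2`. -/
lemma threeSum_sub_le (ha : 0 < a) (hab : a < b) {M : ℝ≥0} {p : ℕ × ℕ} (h : IsLarge a b M p)
    (hp : p.1 ≠ p.2) {α β : ℕ} (hα : α = p.1 ∨ α = p.2) (hβ : β = p.1 ∨ β = p.2) (hα0 : 0 < α)
    (hβ0 : 0 < β) :
    threeSum a b (tmoment (Set.Iic M) μX) (tmoment (Set.Iic M) μY) p α β -
        extConst a b ((M : ℝ) ^ 2) 6 * (extConst a b ((M : ℝ) ^ 2) 4 + 2) *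
          errBound a b ((M : ℝ) ^ 2) p ≤
      expThree a b μX μY p α β := by
  set P := law a b (fun t : ℕ => (t : ℝ)) μX μY with hP
  set R := reach a b p with hR
  set U := (others a b p).offDiag with hU
  have hc : (0 : ℝ) ≤ (M : ℝ) ^ 2 := by positivity
  have hi := fun {κ : Type} (Q : Finset κ) (F : ℕ × ℕ → κ → Finset (ℕ × ℕ)) =>
    integrable_sum_edgeInd (P := P) (measurableSet_Iic (a := M)) U Q F
  have h1 : ∫ ω, (∑ r ∈ U, ∑ q ∈ R ×ˢ R ×ˢ R, edgeInd (Set.Iic M)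
        (path q.1 p.1 p.2 ∪ (path q.2.1 α r.1 ∪ path q.2.2 β r.2)) ω -
      ((∑ r ∈ U, ∑ q ∈ (R.offDiag ×ˢ R) ×ˢ R, edgeInd (Set.Iic M)
          (((path q.1.1.1 p.1 p.2 ∪ path q.1.1.2 p.1 p.2) ∪ path q.1.2 α r.1) ∪
            path q.2 β r.2) ω +
        ∑ r ∈ U, ∑ q ∈ (R ×ˢ R.offDiag) ×ˢ R, edgeInd (Set.Iic M)
          ((path q.1.1 p.1 p.2 ∪ (path q.1.2.1 α r.1 ∪ path q.1.2.2 α r.1)) ∪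
            path q.2 β r.2) ω) +
        ∑ r ∈ U, ∑ q ∈ (R ×ˢ R.offDiag) ×ˢ R, edgeInd (Set.Iic M)
          ((path q.1.1 p.1 p.2 ∪ (path q.1.2.1 β r.2 ∪ path q.1.2.2 β r.2)) ∪
            path q.2 α r.1) ω)) ∂P ≤
      expThree a b μX μY p α β := by
    refine integral_mono ((hi _ _).sub (((hi _ _).add (hi _ _)).add (hi _ _)))
      (integrable_finsetSum _ fun _ _ => integrable_adjInd_mul_mul _ _ _ _ _ _) fun ω => ?_
    dsimp only
    rw [← Finset.sum_add_distrib, ← Finset.sum_add_distrib, ← Finset.sum_sub_distrib]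
    refine Finset.sum_le_sum fun r hr => ?_
    rw [hU, Finset.mem_offDiag, mem_others, mem_others] at hr
    have hne : ∀ {γ u : ℕ}, γ = p.1 ∨ γ = p.2 → u ≠ p.1 ∧ u ≠ p.2 → γ ≠ u := by
      rintro γ u (rfl | rfl) h3
      exacts [h3.1.symm, h3.2.symm]
    have hA := pathCount_nonneg (Set.Iic M) R p.1 p.2 ω
    have hA2 := pathPairCount_nonneg (Set.Iic M) R p.1 p.2 ω
    have hB := pathCount_nonneg (Set.Iic M) R α r.1 ω
    have hB2 := pathPairCount_nonneg (Set.Iic M) R α r.1 ω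
    have hC := pathCount_nonneg (Set.Iic M) R β r.2 ω
    have hC2 := pathPairCount_nonneg (Set.Iic M) R β r.2 ω
    have h2 := mul_sub_le_mul (adjInd_nonneg p.1 p.2 ω) (adjInd_nonneg α r.1 ω)
      hA hB hA2 hB2 (pathCount_sub_le_adjInd (Set.Iic M) R hp ω)
      (pathCount_sub_le_adjInd (Set.Iic M) R (hne hα hr.1.2) ω)
    have h3 := mul_sub_le_mul (mul_nonneg (adjInd_nonneg p.1 p.2 ω) (adjInd_nonneg α r.1 ω))
      (adjInd_nonneg β r.2 ω) (mul_nonneg hA hB) hC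
      (add_nonneg (mul_nonneg hA2 hB) (mul_nonneg hA hB2)) hC2 h2
      (pathCount_sub_le_adjInd (Set.Iic M) R (hne hβ hr.2.1.2) ω)
    have e1 := pathCount_mul_mul (Set.Iic M) R p.1 p.2 α r.1 β r.2 ω
    have e2 : pathPairCount (Set.Iic M) R p.1 p.2 ω * pathCount (Set.Iic M) R α r.1 ω *
        pathCount (Set.Iic M) R β r.2 ω = ∑ q ∈ (R.offDiag ×ˢ R) ×ˢ R, edgeInd (Set.Iic M)
          (((path q.1.1.1 p.1 p.2 ∪ path q.1.1.2 p.1 p.2) ∪ path q.1.2 α r.1) ∪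
            path q.2 β r.2) ω := by
      rw [pathPairCount, pathCount, sum_edgeInd_mul (Set.Iic M) R.offDiag R
        (fun r => path r.1 p.1 p.2 ∪ path r.2 p.1 p.2) (fun i => path i α r.1) ω]
      exact sum_edgeInd_mul (Set.Iic M) (R.offDiag ×ˢ R) R
        (fun q => (path q.1.1 p.1 p.2 ∪ path q.1.2 p.1 p.2) ∪ path q.2 α r.1)
        (fun i => path i β r.2) ω
    have e3 : ∀ γ δ u v, pathCount (Set.Iic M) R p.1 p.2 ω * pathPairCount (Set.Iic M) R γ u ω *
        pathCount (Set.Iic M) R δ v ω = ∑ q ∈ (R ×ˢ R.offDiag) ×ˢ R, edgeInd (Set.Iic M)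
          ((path q.1.1 p.1 p.2 ∪ (path q.1.2.1 γ u ∪ path q.1.2.2 γ u)) ∪
            path q.2 δ v) ω := by
      intro γ δ u v
      rw [pathPairCount, pathCount, sum_edgeInd_mul (Set.Iic M) R R.offDiag
        (fun i => path i p.1 p.2) (fun r => path r.1 γ u ∪ path r.2 γ u) ω]
      exact sum_edgeInd_mul (Set.Iic M) (R ×ˢ R.offDiag) R
        (fun q => path q.1 p.1 p.2 ∪ (path q.2.1 γ u ∪ path q.2.2 γ u))
        (fun i => path i δ v) ω
    rw [← e1, ← e2, ← e3 α β r.1 r.2, ← e3 β α r.2 r.1]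
    refine le_trans (le_of_eq ?_) h3
    ring
  rw [integral_sub_add_add (hi _ _) (hi _ _) (hi _ _) (hi _ _)] at h1
  refine le_trans (sub_le_sub ?_ ?_) h1
  · rw [integral_sum_edgeInd measurableSet_Iic, threeSum, Finset.sum_comm]
    exact Finset.sum_le_sum fun r _ => Finset.sum_le_sum fun q _ =>
      h.edgeWeight_three_le ha hab hα hβ q.1 q.2.1 q.2.2 r.1 r.2
  · have h6 := extConst_nonneg ha hab hc 6
    have h4 := extConst_nonneg ha hab hc 4
    have hcard : ∀ i j k s t u v x y : ℕ,
        (path i s t ∪ (path j u v ∪ path k x y)).card ≤ 6 := fun i j k s t u v x y =>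
      card_union_le_add (card_path_le _ _ _)
        (card_union_le_add (card_path_le _ _ _) (card_path_le _ _ _))
    have hloop : ∀ {γ : ℕ}, γ = p.1 ∨ γ = p.2 → 0 < γ → _ := fun {γ} hγ hγ0 =>
      sum_crude_loop_le_errBound ha hab hc hp hγ hγ0
    have e : extConst a b ((M : ℝ) ^ 2) 6 * (extConst a b ((M : ℝ) ^ 2) 4 + 2) *
          errBound a b ((M : ℝ) ^ 2) p =
        extConst a b ((M : ℝ) ^ 2) 6 * (extConst a b ((M : ℝ) ^ 2) 4 *
          errBound a b ((M : ℝ) ^ 2) p) +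
        extConst a b ((M : ℝ) ^ 2) 6 * errBound a b ((M : ℝ) ^ 2) p +
        extConst a b ((M : ℝ) ^ 2) 6 * errBound a b ((M : ℝ) ^ 2) p := by ring
    rw [e]
    refine add_le_add (add_le_add ?_ ?_) ?_
    · refine (integral_sum_edgeInd_Iic_le M _ _ _).trans ?_
      refine (sum_crude_ext_offDiag_le ha hab hc (m := 6) (R.offDiag ×ˢ R)
        (fun q u => (path q.1.1 p.1 p.2 ∪ path q.1.2 p.1 p.2) ∪ path q.2 α u)
        (fun q u => by rw [Finset.union_assoc]; exact hcard _ _ _ _ _ _ _ _ _)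
        R (others a b p) β).trans ?_
      refine mul_le_mul_of_nonneg_left ?_ h6
      refine (sum_crude_ext_le ha hab hc (m := 4) R.offDiag
        (fun r => path r.1 p.1 p.2 ∪ path r.2 p.1 p.2)
        (fun r => card_union_le_add (card_path_le _ _ _) (card_path_le _ _ _)) _ _ _).trans ?_
      exact mul_le_mul_of_nonneg_left (sum_crude_pair_le_errBound ha hab hp) h4
    · refine (integral_sum_edgeInd_Iic_le M _ _ _).trans ?_
      refine (sum_crude_ext_offDiag_le ha hab hc (m := 6) (R ×ˢ R.offDiag)
        (fun q u => path q.1 p.1 p.2 ∪ (path q.2.1 α u ∪ path q.2.2 α u))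
        (fun q u => hcard _ _ _ _ _ _ _ _ _) R (others a b p) β).trans ?_
      exact mul_le_mul_of_nonneg_left (hloop hα hα0) h6
    · refine (integral_sum_edgeInd_Iic_le M _ _ _).trans ?_
      -- The two further actors are interchanged, so that the path attached last ends at the second
      -- coordinate.
      refine le_trans (le_of_eq (Finset.sum_congr rfl fun q _ => ?_))
        ((sum_crude_ext_offDiag_le ha hab hc (m := 6) (R ×ˢ R.offDiag)
        (fun q u => path q.1 p.1 p.2 ∪ (path q.2.1 β u ∪ path q.2.2 β u))
        (fun q u => hcard _ _ _ _ _ _ _ _ _) R (others a b p) α).trans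
        (mul_le_mul_of_nonneg_left (hloop hβ hβ0) h6))
      exact sum_offDiag_swap (others a b p) fun r => crude a b ((M : ℝ) ^ 2)
        ((path q.1.1 p.1 p.2 ∪ (path q.1.2.1 β r.1 ∪ path q.1.2.2 β r.1)) ∪ path q.2 α r.2)

/-- Bonferroni is applied directly to the events that one item joins `p.1`, `p.2` and `u`. Two such
events force a doubled path from `p.1` to `p.2` and a path from `p.1` to `u`. The remaining patterns
are not needed, since they are negligible in the upper bound. -/
lemma commonDiagSum_sub_le (ha : 0 < a) (hab : a < b) {M : ℝ≥0} {p : ℕ × ℕ} (h : IsLarge a b M p)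
    (hp : p.1 ≠ p.2) :
    commonDiagSum a b (tmoment (Set.Iic M) μX) (tmoment (Set.Iic M) μY) p -
        extConst a b ((M : ℝ) ^ 2) 4 * errBound a b ((M : ℝ) ^ 2) p ≤
      expCommon a b μX μY p := by
  set P := law a b (fun t : ℕ => (t : ℝ)) μX μY with hP
  set R := reach a b p with hR
  have hc : (0 : ℝ) ≤ (M : ℝ) ^ 2 := by positivity
  have hi := fun {κ : Type} (Q : Finset κ) (F : ℕ → κ → Finset (ℕ × ℕ)) =>
    integrable_sum_edgeInd (P := P) (measurableSet_Iic (a := M)) (others a b p) Q F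
  have h1 : ∫ ω, (∑ u ∈ others a b p, ∑ i ∈ R,
        edgeInd (Set.Iic M) (path i p.1 p.2 ∪ (path i p.1 u ∪ path i p.2 u)) ω -
      ∑ u ∈ others a b p, ∑ q ∈ R.offDiag ×ˢ R,
        edgeInd (Set.Iic M) ((path q.1.1 p.1 p.2 ∪ path q.1.2 p.1 p.2) ∪ path q.2 p.1 u) ω) ∂P ≤
      expCommon a b μX μY p := by
    refine integral_mono ((hi _ _).sub (hi _ _))
      (integrable_finsetSum _ fun _ _ => integrable_adjInd_mul_mul _ _ _ _ _ _) fun ω => ?_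
    dsimp only
    rw [← Finset.sum_sub_distrib]
    refine Finset.sum_le_sum fun u hu => ?_
    rw [mem_others] at hu
    have h2 := sum_sub_sum_offDiag_le (R := R)
      (fun i => edgeInd_eq (Set.Iic M) (path i p.1 p.2 ∪ (path i p.1 u ∪ path i p.2 u)) ω)
      (mul_nonneg (mul_nonneg (adjInd_nonneg p.1 p.2 ω) (adjInd_nonneg p.1 u ω))
        (adjInd_nonneg p.2 u ω)) fun i _ hi => ?_
    · refine le_trans (sub_le_sub_left ?_ _) h2
      rw [Finset.sum_product]
      refine Finset.sum_le_sum fun r hr => ?_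
      rw [edgeInd_mul]
      refine le_trans (edgeInd_anti _ ?_ ω) (Finset.single_le_sum
        (f := fun j => edgeInd (Set.Iic M) ((path r.1 p.1 p.2 ∪ path r.2 p.1 p.2) ∪
          path j p.1 u) ω) (fun _ _ => edgeInd_nonneg _ _ _) (Finset.mem_offDiag.1 hr).1)
      intro e he
      simp only [Finset.mem_union] at he ⊢
      tauto
    · rw [← edgeInd_mul, ← edgeInd_mul] at hi
      have h3 : edgeInd (Set.Iic M) (path i p.1 p.2) ω = 1 ∧
          edgeInd (Set.Iic M) (path i p.1 u) ω = 1 ∧ edgeInd (Set.Iic M) (path i p.2 u) ω = 1 := by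
        rcases edgeInd_eq (Set.Iic M) (path i p.1 p.2) ω with e | e <;>
        rcases edgeInd_eq (Set.Iic M) (path i p.1 u) ω with e' | e' <;>
        rcases edgeInd_eq (Set.Iic M) (path i p.2 u) ω with e'' | e'' <;>
        simp_all
      have h4 := one_le_adjInd hp h3.1
      have h5 := one_le_adjInd hu.2.1.symm h3.2.1
      have h6 := one_le_adjInd hu.2.2.symm h3.2.2
      exact one_le_mul_of_one_le_of_one_le (one_le_mul_of_one_le_of_one_le h4 h5) h6
  rw [integral_sub (hi _ _) (hi _ _)] at h1
  refine le_trans (sub_le_sub ?_ ?_) h1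
  · rw [integral_sum_edgeInd measurableSet_Iic, commonDiagSum, Finset.sum_comm]
    exact Finset.sum_le_sum fun u _ => Finset.sum_le_sum fun i _ =>
      h.edgeWeight_three_le ha hab (Or.inl rfl) (Or.inr rfl) i i i u u
  · refine (integral_sum_edgeInd_Iic_le M _ _ _).trans ?_
    refine (sum_crude_ext_le ha hab hc (m := 4) R.offDiag
      (fun r => path r.1 p.1 p.2 ∪ path r.2 p.1 p.2)
      (fun r => card_union_le_add (card_path_le _ _ _) (card_path_le _ _ _)) _ _ _).trans ?_
    exact mul_le_mul_of_nonneg_left (sum_crude_pair_le_errBound ha hab hp)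
      (extConst_nonneg ha hab hc _)

end Lower

/-! ### Limits of the normalised expected counts. -/

section Limits

variable {a b : ℝ} {μX μY : Measure ℝ≥0} [IsProbabilityMeasure μX] [IsProbabilityMeasure μY]

lemma tendsto_tmoment {μ : Measure ℝ≥0} [IsProbabilityMeasure μ] {k : ℕ}
    (h : Integrable (fun x : ℝ≥0 => (x : ℝ) ^ k) μ) :
    Tendsto (fun M : ℕ => tmoment (Set.Iic (M : ℝ≥0)) μ k) atTop (𝓝 (wmoment μ k)) := by
  refine tendsto_integral_of_dominated_convergence (fun x : ℝ≥0 => (x : ℝ) ^ k)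
    (fun M => ?_) h (fun M => ae_of_all _ fun x => ?_) (ae_of_all _ fun x => ?_)
  · exact (integrable_indicator_Iic_pow μ _ k).aestronglyMeasurable
  · rw [Real.norm_of_nonneg (by positivity)]
    refine pow_le_pow_left₀ (by positivity) ?_ _
    exact_mod_cast Set.indicator_le_self' (f := id) (fun _ _ => zero_le) x
  · obtain ⟨N, hN⟩ := exists_nat_ge x
    refine tendsto_const_nhds.congr' ?_
    filter_upwards [eventually_ge_atTop N] with M hM
    have : x ∈ Set.Iic (M : ℝ≥0) := hN.trans (by exact_mod_cast hM)
    rw [Set.indicator_of_mem this]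
    rfl

/-- The order of limits matters: the lower bounds hold for `x` far enough along `l` depending on
`M`, so `M` is chosen first, with `c M` close to `C`. -/
lemma tendsto_of_lower_bounds {X : Type*} {l : Filter X} {E U : X → ℝ} {L : ℕ → X → ℝ}
    {c : ℕ → ℝ} {C : ℝ} (hU : Tendsto U l (𝓝 C)) (hEU : ∀ᶠ x in l, E x ≤ U x)
    (hL : ∀ M, Tendsto (L M) l (𝓝 (c M))) (hLE : ∀ M, ∀ᶠ x in l, L M x ≤ E x)
    (hc : Tendsto c atTop (𝓝 C)) : Tendsto E l (𝓝 C) := by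
  rw [tendsto_order]
  constructor
  · intro y hy
    obtain ⟨M, hM⟩ := (hc.eventually_const_lt hy).exists
    filter_upwards [(hL M).eventually_const_lt hM, hLE M] with x h1 h2 using h1.trans_le h2
  · intro y hy
    filter_upwards [hU.eventually_lt_const hy, hEU] with x h1 h2 using h2.trans_lt h1

variable {l : Filter (ℕ × ℕ)}

lemma tendsto_errBound (hl : IsPairFilter a b l) (c k : ℝ) :
    Tendsto (fun p => k * errBound a b c p / pairNorm a b p) l (𝓝 0) := by
  have h1 : Tendsto (fun p : ℕ × ℕ => k * (errConst a b c * ((p.1 : ℝ)⁻¹ + (p.2 : ℝ)⁻¹))) l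
      (𝓝 0) := by
    have h2 := (tendsto_inv_atTop_zero.comp (tendsto_natCast_atTop_atTop (R := ℝ))).comp hl.fst
    have h3 := (tendsto_inv_atTop_zero.comp (tendsto_natCast_atTop_atTop (R := ℝ))).comp hl.snd
    simpa using ((h2.add h3).const_mul (errConst a b c)).const_mul k
  refine h1.congr' ?_
  filter_upwards [hl.pos] with p hp
  rw [errBound]
  field_simp

/-- Convergence of an expectation squeezed between the sums for truncated weights and the sum for
the weights themselves. -/
lemma tendsto_expectation {μX μY : Measure ℝ≥0} (hl : IsPairFilter a b l) {E : ℕ × ℕ → ℝ}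
    {S S' : (ℕ → ℝ) → (ℕ → ℝ) → ℕ × ℕ → ℝ} {C : (ℕ → ℝ) → (ℕ → ℝ) → ℝ} (k : ℝ → ℝ)
    (hS : Tendsto (fun p => S (wmoment μX) (wmoment μY) p / pairNorm a b p) l
      (𝓝 (C (wmoment μX) (wmoment μY))))
    (hS' : ∀ mX mY, Tendsto (fun p => S' mX mY p / pairNorm a b p) l (𝓝 (C mX mY)))
    (hE : ∀ p, E p ≤ S (wmoment μX) (wmoment μY) p)
    (hE' : ∀ M : ℝ≥0, ∀ᶠ p in l, S' (tmoment (Set.Iic M) μX) (tmoment (Set.Iic M) μY) p -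
      k ((M : ℝ) ^ 2) * errBound a b ((M : ℝ) ^ 2) p ≤ E p)
    (hC : Tendsto (fun M : ℕ => C (tmoment (Set.Iic (M : ℝ≥0)) μX)
      (tmoment (Set.Iic (M : ℝ≥0)) μY)) atTop (𝓝 (C (wmoment μX) (wmoment μY)))) :
    Tendsto (fun p => E p / pairNorm a b p) l (𝓝 (C (wmoment μX) (wmoment μY))) := by
  refine tendsto_of_lower_bounds hS (Eventually.of_forall fun p =>
    div_le_div_of_nonneg_right (hE p) (pairNorm_nonneg a b p))
    (L := fun M p => S' (tmoment (Set.Iic (M : ℝ≥0)) μX) (tmoment (Set.Iic (M : ℝ≥0)) μY) p /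
      pairNorm a b p - k (((M : ℝ≥0) : ℝ) ^ 2) * errBound a b (((M : ℝ≥0) : ℝ) ^ 2) p /
      pairNorm a b p)
    (fun M => ?_) (fun M => ?_) hC
  · simpa using (hS' (tmoment (Set.Iic (M : ℝ≥0)) μX) (tmoment (Set.Iic (M : ℝ≥0)) μY)).sub
      (tendsto_errBound hl (((M : ℝ≥0) : ℝ) ^ 2) (k (((M : ℝ≥0) : ℝ) ^ 2)))
  · filter_upwards [hE' M] with p hp
    rw [← sub_div]
    exact div_le_div_of_nonneg_right hp (pairNorm_nonneg a b p)

lemma tendsto_law_adjEvent (ha : 0 < a) (hab : a < b)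
    (hX : Integrable (fun x : ℝ≥0 => (x : ℝ) ^ 4) μX)
    (hY : Integrable (fun y : ℝ≥0 => (y : ℝ) ^ 3) μY) (hl : IsPairFilter a b l) :
    Tendsto (fun p => (law a b (fun t : ℕ => (t : ℝ)) μX μY).real (adjEvent p.1 p.2) /
      pairNorm a b p) l (𝓝 (h₁ μX μY)) := by
  have cX := fun {k : ℕ} (hk : k ≤ 4) => tendsto_tmoment (integrable_pow_of_le hX hk)
  have cY := fun {k : ℕ} (hk : k ≤ 3) => tendsto_tmoment (integrable_pow_of_le hY hk)
  refine tendsto_expectation hl (S := oneSum a b) (S' := oneSum a b)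
    (C := fun mX mY => mX 2 * mY 1 ^ 2) (fun _ => 1)
    (tendsto_oneSum _ _ hl) (fun mX mY => tendsto_oneSum mX mY hl)
    (law_real_adjEvent_le ha hab hX hY) (fun M => ?_) ?_
  · filter_upwards [hl.ne, eventually_isLarge ha hab hl M] with p hp h
    rw [one_mul]
    exact oneSum_sub_le ha hab h hp
  · exact (cX (by norm_num)).mul ((cY (by norm_num)).pow 2)

lemma tendsto_expTwo (ha : 0 < a) (hab : a < b)
    (hX : Integrable (fun x : ℝ≥0 => (x : ℝ) ^ 4) μX)
    (hY : Integrable (fun y : ℝ≥0 => (y : ℝ) ^ 3) μY) (hl : IsPairFilter a b l) :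
    Tendsto (fun p => expTwo a b μX μY p / pairNorm a b p) l
      (𝓝 (h₂ a b μX μY + 2 * h₃ a b μX μY)) := by
  have cX := fun {k : ℕ} (hk : k ≤ 4) => tendsto_tmoment (integrable_pow_of_le hX hk)
  have cY := fun {k : ℕ} (hk : k ≤ 3) => tendsto_tmoment (integrable_pow_of_le hY hk)
  have h := tendsto_expectation (μX := μX) (μY := μY) hl (S := twoSum a b) (S' := twoSum a b)
    (C := fun mX mY => mX 3 * mY 1 ^ 3 * gam a b +
      2 * (√b - √a) * (mX 2 ^ 2 * mY 2 * mY 1 ^ 2 * gam a b)) (fun c => extConst a b c 4 + 1)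
    (tendsto_twoSum _ _ ha hab hl) (fun mX mY => tendsto_twoSum mX mY ha hab hl)
    (expTwo_le ha hab hX hY) (fun M => ?_) ?_
  · convert h using 2
    rw [h₂, h₃]; ring
  · filter_upwards [hl.ne, eventually_isLarge ha hab hl M, hl.fst.eventually_gt_atTop 0]
      with p hp h h0
    exact twoSum_sub_le ha hab h hp h0
  · exact (((cX (by norm_num)).mul ((cY (by norm_num)).pow 3)).mul_const _).add
      ((((((cX (by norm_num)).pow 2).mul (cY (by norm_num))).mul
        ((cY (by norm_num)).pow 2)).mul_const _).const_mul _)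

lemma tendsto_expThree_ss (ha : 0 < a) (hab : a < b)
    (hX : Integrable (fun x : ℝ≥0 => (x : ℝ) ^ 4) μX)
    (hY : Integrable (fun y : ℝ≥0 => (y : ℝ) ^ 3) μY) (hl : IsPairFilter a b l) :
    Tendsto (fun p => expThree a b μX μY p p.1 p.1 / pairNorm a b p) l
      (𝓝 (h₄ a b μX μY + 6 * h₅ a b μX μY + 4 * h₆ a b μX μY)) := by
  have cX := fun {k : ℕ} (hk : k ≤ 4) => tendsto_tmoment (integrable_pow_of_le hX hk)
  have cY := fun {k : ℕ} (hk : k ≤ 3) => tendsto_tmoment (integrable_pow_of_le hY hk)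
  have h := tendsto_expectation (μX := μX) (μY := μY) hl
    (S := fun mX mY p => threeSum a b mX mY p p.1 p.1)
    (S' := fun mX mY p => threeSum a b mX mY p p.1 p.1)
    (C := fun mX mY => mX 4 * mY 1 ^ 4 * gam a b ^ 2 +
        6 * (√b - √a) * (mX 2 * mX 3 * mY 2 * mY 1 ^ 3 * gam a b ^ 2) +
        4 * (√b - √a) ^ 2 * (mX 2 ^ 3 * mY 3 * mY 1 ^ 3 * gam a b ^ 2))
    (fun c => extConst a b c 6 * (extConst a b c 4 + 2))
    (tendsto_threeSum_ss _ _ ha hab hl) (fun mX mY => tendsto_threeSum_ss mX mY ha hab hl)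
    (fun p => expThree_le ha hab hX hY p (Or.inl rfl) (Or.inl rfl)) (fun M => ?_) ?_
  · convert h using 2
    rw [h₄, h₅, h₆]; ring
  · filter_upwards [hl.ne, eventually_isLarge ha hab hl M, hl.fst.eventually_gt_atTop 0]
      with p hp h h0
    exact threeSum_sub_le ha hab h hp (Or.inl rfl) (Or.inl rfl) h0 h0
  · exact ((((cX (by norm_num)).mul ((cY (by norm_num)).pow 4)).mul_const _).add
      ((((((cX (by norm_num)).mul (cX (by norm_num))).mul (cY (by norm_num))).mul
        ((cY (by norm_num)).pow 3)).mul_const _).const_mul _)).add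
      ((((((cX (by norm_num)).pow 3).mul (cY (by norm_num))).mul
        ((cY (by norm_num)).pow 3)).mul_const _).const_mul _)

lemma tendsto_expThree_st (ha : 0 < a) (hab : a < b)
    (hX : Integrable (fun x : ℝ≥0 => (x : ℝ) ^ 4) μX)
    (hY : Integrable (fun y : ℝ≥0 => (y : ℝ) ^ 3) μY) (hl : IsPairFilter a b l) :
    Tendsto (fun p => expThree a b μX μY p p.1 p.2 / pairNorm a b p) l
      (𝓝 (h₄ a b μX μY + 4 * h₅ a b μX μY + 4 * h₇ a b μX μY)) := by
  have cX := fun {k : ℕ} (hk : k ≤ 4) => tendsto_tmoment (integrable_pow_of_le hX hk)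
  have cY := fun {k : ℕ} (hk : k ≤ 3) => tendsto_tmoment (integrable_pow_of_le hY hk)
  have h := tendsto_expectation (μX := μX) (μY := μY) hl
    (S := fun mX mY p => threeSum a b mX mY p p.1 p.2)
    (S' := fun mX mY p => threeSum a b mX mY p p.1 p.2)
    (C := fun mX mY => mX 4 * mY 1 ^ 4 * gam a b ^ 2 +
        4 * (√b - √a) * (mX 2 * mX 3 * mY 2 * mY 1 ^ 3 * gam a b ^ 2) +
        4 * (√b - √a) ^ 2 * (mX 2 ^ 3 * mY 2 ^ 2 * mY 1 ^ 2 * gam a b ^ 2))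
    (fun c => extConst a b c 6 * (extConst a b c 4 + 2))
    (tendsto_threeSum_st _ _ ha hab hl) (fun mX mY => tendsto_threeSum_st mX mY ha hab hl)
    (fun p => expThree_le ha hab hX hY p (Or.inl rfl) (Or.inr rfl)) (fun M => ?_) ?_
  · convert h using 2
    rw [h₄, h₅, h₇]; ring
  · filter_upwards [hl.ne, eventually_isLarge ha hab hl M, hl.fst.eventually_gt_atTop 0,
      hl.snd.eventually_gt_atTop 0] with p hp h h0 h0'
    exact threeSum_sub_le ha hab h hp (Or.inl rfl) (Or.inr rfl) h0 h0'
  · exact ((((cX (by norm_num)).mul ((cY (by norm_num)).pow 4)).mul_const _).add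
      ((((((cX (by norm_num)).mul (cX (by norm_num))).mul (cY (by norm_num))).mul
        ((cY (by norm_num)).pow 3)).mul_const _).const_mul _)).add
      ((((((cX (by norm_num)).pow 3).mul ((cY (by norm_num)).pow 2)).mul
        ((cY (by norm_num)).pow 2)).mul_const _).const_mul _)

lemma tendsto_expCommon (ha : 0 < a) (hab : a < b)
    (hX : Integrable (fun x : ℝ≥0 => (x : ℝ) ^ 4) μX)
    (hY : Integrable (fun y : ℝ≥0 => (y : ℝ) ^ 3) μY) (hl : IsPairFilter a b l) :
    Tendsto (fun p => expCommon a b μX μY p / pairNorm a b p) l (𝓝 (h₂ a b μX μY)) := by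
  have cX := fun {k : ℕ} (hk : k ≤ 4) => tendsto_tmoment (integrable_pow_of_le hX hk)
  have cY := fun {k : ℕ} (hk : k ≤ 3) => tendsto_tmoment (integrable_pow_of_le hY hk)
  refine tendsto_expectation hl (S := commonSum a b) (S' := commonDiagSum a b)
    (C := fun mX mY => mX 3 * mY 1 ^ 3 * gam a b) (fun c => extConst a b c 4)
    (tendsto_commonSum _ _ ha hab hl) (fun mX mY => tendsto_commonDiagSum mX mY ha hab hl)
    (expCommon_le ha hab hX hY) (fun M => ?_) ?_
  · filter_upwards [hl.ne, eventually_isLarge ha hab hl M] with p hp h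
    exact commonDiagSum_sub_le ha hab h hp
  · exact ((cX (by norm_num)).mul ((cY (by norm_num)).pow 3)).mul_const _

lemma isPairFilter_pairLimit (ha : 0 < a) (hab : a < b) : IsPairFilter a b (pairLimit a b) := by
  have hb := ha.trans hab
  have hlt : ∀ᶠ p : ℕ × ℕ in pairLimit a b, p.1 < p.2 :=
    (eventually_principal.2 fun _ h => h).filter_mono inf_le_right
  have hfst : Tendsto Prod.fst (pairLimit a b) atTop :=
    tendsto_comap.mono_left (inf_le_left.trans (inf_le_left.trans inf_le_left))
  have hsnd : Tendsto Prod.snd (pairLimit a b) atTop :=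
    tendsto_comap.mono_left (inf_le_left.trans (inf_le_left.trans inf_le_right))
  have hdiff : Tendsto (fun p : ℕ × ℕ => b * (p.1 : ℝ) - a * (p.2 : ℝ)) (pairLimit a b) atTop :=
    tendsto_comap.mono_left (inf_le_left.trans inf_le_right)
  refine ⟨hfst, hsnd, hlt.mono fun p hp => hp.ne, ?_⟩
  filter_upwards [hlt, hfst.eventually_gt_atTop 0, hdiff.eventually_ge_atTop 1] with p h1 h2 h3
  have hp1 : (0 : ℝ) < p.1 := by exact_mod_cast h2
  have hp2 : (p.1 : ℝ) ≤ p.2 := by exact_mod_cast h1.le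
  have hp2' := hp1.trans_le hp2
  have hi1 := Nat.le_ceil (a * (p.2 : ℝ))
  have hi2 := Nat.ceil_lt_add_one (by positivity : 0 ≤ a * (p.2 : ℝ))
  -- This item is common to both actors as soon as `b s - a t ≥ 1`, because `a s ≤ a t ≤ i < a t + 1
  -- ≤ b s ≤ b t`.
  set i := ⌈a * (p.2 : ℝ)⌉₊ with hi
  have hi0 : (0 : ℝ) < i := (by positivity : 0 < a * (p.2 : ℝ)).trans_le hi1
  have k1 : 0 < kern a b i p.1 := by
    rw [kern, if_pos ⟨(mul_le_mul_of_nonneg_left hp2 ha.le).trans hi1, by linarith⟩]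
    positivity
  have k2 : 0 < kern a b i p.2 := by
    rw [kern, if_pos ⟨hi1, by nlinarith⟩]
    positivity
  exact Finset.sum_pos' (fun j _ => mul_nonneg (kern_nonneg _ _ _ _) (kern_nonneg _ _ _ _))
    ⟨i, mem_reach_of_kern ha hab (Or.inl k1.ne'), mul_pos k1 k2⟩

end Limits

/-! ### Conditional moments of degrees in terms of expected counts. -/

section Degrees

lemma integral_add_add {Ω : Type*} [MeasurableSpace Ω] {P : Measure Ω} {f g h : Ω → ℝ}
    (hf : Integrable f P) (hg : Integrable g P) (hh : Integrable h P) :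
    ∫ ω, (f ω + g ω + h ω) ∂P = ∫ ω, f ω ∂P + ∫ ω, g ω ∂P + ∫ ω, h ω ∂P := by
  rw [← integral_add hf hg]
  exact integral_add (hf.add hg) hh

lemma integral_sub_sub {Ω : Type*} [MeasurableSpace Ω] {P : Measure Ω} {f g h : Ω → ℝ}
    (hf : Integrable f P) (hg : Integrable g P) (hh : Integrable h P) :
    ∫ ω, (f ω - (g ω - h ω)) ∂P = ∫ ω, f ω ∂P - (∫ ω, g ω ∂P - ∫ ω, h ω ∂P) := by
  rw [← integral_sub hg hh]
  exact integral_sub hf (hg.sub hh)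

variable {a b : ℝ} {μX μY : Measure ℝ≥0} [IsProbabilityMeasure μX] [IsProbabilityMeasure μY]

/-- Almost surely all neighbours of `p.1` lie within reach. In particular the neighbourhood is
finite, and the value `0` of `Set.ncard` on infinite sets plays no role. -/
lemma ae_deg_eq (ha : 0 < a) (hab : a < b) (p : ℕ × ℕ) :
    ∀ᵐ ω ∂(law a b (fun t : ℕ => (t : ℝ)) μX μY),
      deg p.1 ω = adjInd p.1 p.2 ω + ∑ u ∈ others a b p, adjInd p.1 u ω := by
  classical
  filter_upwards [ae_kern_ne_zero] with ω hω
  have h1 : p.2 ∉ others a b p := by simp [others]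
  rw [← Finset.sum_insert (f := fun u => adjInd p.1 u ω) h1]
  have h2 : (graph ω).neighborSet p.1 =
      ((insert p.2 (others a b p)).filter fun u => ω ∈ adjEvent p.1 u : Finset ℕ) := by
    ext u
    rw [Finset.mem_coe, Finset.mem_filter]
    refine ⟨fun h => ⟨?_, h⟩, fun h => h.2⟩
    obtain ⟨hne, i, hs, hu⟩ := id h
    rw [Finset.mem_insert, mem_others]
    by_cases hut : u = p.2
    · exact Or.inl hut
    · exact Or.inr ⟨mem_reach_of_kern_kern ha hab (Or.inl (hω _ hs)) (hω _ hu), hne.symm, hut⟩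
  rw [deg, h2, Set.ncard_coe_finset, Finset.card_filter, Nat.cast_sum]
  refine Finset.sum_congr rfl fun u _ => ?_
  by_cases h : ω ∈ adjEvent p.1 u <;> simp [adjInd, h]

lemma condE_comm (P : Measure Sample) (s t : ℕ) (Z : Sample → ℝ) :
    condE P s t Z = condE P t s Z := by
  rw [condE, condE, condLaw, condLaw, adjEvent_comm]

/-- This holds for a null event as well, where both sides are `0` by convention. -/
lemma condE_eq (P : Measure Sample) (s t : ℕ) (Z : Sample → ℝ) :
    condE P s t Z = (∫ ω, adjInd s t ω * Z ω ∂P) / P.real (adjEvent s t) := by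
  rw [condE, condLaw, ProbabilityTheory.cond, integral_smul_measure,
    ← integral_indicator (measurableSet_adjEvent s t), ENNReal.toReal_inv, smul_eq_mul,
    div_eq_inv_mul]
  congr 1
  refine integral_congr_ae (ae_of_all _ fun ω => ?_)
  by_cases h : ω ∈ adjEvent s t <;> simp [adjInd, h]

lemma integrable_adjInd {P : Measure Sample} [IsProbabilityMeasure P] (s t : ℕ) :
    Integrable (adjInd s t) P := (integrable_const 1).indicator (measurableSet_adjEvent s t)

lemma condE_deg (ha : 0 < a) (hab : a < b) (p : ℕ × ℕ) :
    condE (law a b (fun t : ℕ => (t : ℝ)) μX μY) p.1 p.2 (deg p.1) =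
      ((law a b (fun t : ℕ => (t : ℝ)) μX μY).real (adjEvent p.1 p.2) + expTwo a b μX μY p) /
        (law a b (fun t : ℕ => (t : ℝ)) μX μY).real (adjEvent p.1 p.2) := by
  rw [condE_eq, expTwo]
  congr 1
  rw [← integral_adjInd, ← integral_add (integrable_adjInd _ _)
    (integrable_finsetSum _ fun _ _ => integrable_adjInd_mul _ _ _ _)]
  refine integral_congr_ae ?_
  filter_upwards [ae_deg_eq ha hab p] with ω hω
  rw [hω, mul_add, adjInd_mul_self, Finset.mul_sum]

lemma sq_sum_adjInd (U : Finset ℕ) (s : ℕ) (ω : Sample) :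
    (∑ u ∈ U, adjInd s u ω) ^ 2 =
      ∑ u ∈ U, adjInd s u ω + ∑ r ∈ U.offDiag, adjInd s r.1 ω * adjInd s r.2 ω := by
  rw [sum_offDiag_eq, sq, Finset.sum_mul_sum, ← Finset.sum_add_distrib]
  refine Finset.sum_congr rfl fun u hu => ?_
  rw [sum_split_one hu, adjInd_mul_self]

/-- On `v_s ∼ v_t` the degree is `1 + S` with `S` a sum of indicators. The factor `3` consists of
`2` from the cross term and `1` from the diagonal of `S²`. -/
lemma condE_deg_sq (ha : 0 < a) (hab : a < b) (p : ℕ × ℕ) :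
    condE (law a b (fun t : ℕ => (t : ℝ)) μX μY) p.1 p.2 (fun ω => deg p.1 ω ^ 2) =
      ((law a b (fun t : ℕ => (t : ℝ)) μX μY).real (adjEvent p.1 p.2) +
        3 * expTwo a b μX μY p + expThree a b μX μY p p.1 p.1) /
        (law a b (fun t : ℕ => (t : ℝ)) μX μY).real (adjEvent p.1 p.2) := by
  rw [condE_eq, expTwo, expThree]
  congr 1
  have i1 : Integrable (fun ω => ∑ u ∈ others a b p, adjInd p.1 p.2 ω * adjInd p.1 u ω)
      (law a b (fun t : ℕ => (t : ℝ)) μX μY) :=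
    integrable_finsetSum _ fun _ _ => integrable_adjInd_mul _ _ _ _
  have i2 : Integrable (fun ω => ∑ r ∈ (others a b p).offDiag,
      adjInd p.1 p.2 ω * adjInd p.1 r.1 ω * adjInd p.1 r.2 ω)
      (law a b (fun t : ℕ => (t : ℝ)) μX μY) :=
    integrable_finsetSum _ fun _ _ => integrable_adjInd_mul_mul _ _ _ _ _ _
  rw [← integral_adjInd, ← integral_const_mul,
    ← integral_add_add (integrable_adjInd _ _) (i1.const_mul 3) i2]
  refine integral_congr_ae ?_
  filter_upwards [ae_deg_eq ha hab p] with ω hω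
  simp only [mul_assoc]
  rw [hω, ← Finset.mul_sum, ← Finset.mul_sum]
  have h1 := sq_sum_adjInd (others a b p) p.1 ω
  have h2 := adjInd_mul_self p.1 p.2 ω
  set x := adjInd p.1 p.2 ω
  set S := ∑ u ∈ others a b p, adjInd p.1 u ω
  have h3 : x * (x + S) ^ 2 = (x * x) * x + 2 * (x * x) * S + x * S ^ 2 := by ring
  rw [h3, h2, h2, h1]
  ring

/-- In `(1 + S)(1 + S')` the diagonal part of `S S'` counts common neighbours, and the rest pairs of
distinct further neighbours. -/
lemma condE_deg_mul (ha : 0 < a) (hab : a < b) (p : ℕ × ℕ) :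
    condE (law a b (fun t : ℕ => (t : ℝ)) μX μY) p.1 p.2 (fun ω => deg p.1 ω * deg p.2 ω) =
      ((law a b (fun t : ℕ => (t : ℝ)) μX μY).real (adjEvent p.1 p.2) +
        expTwo a b μX μY p + expTwo a b μX μY p.swap + expCommon a b μX μY p +
        expThree a b μX μY p p.1 p.2) /
        (law a b (fun t : ℕ => (t : ℝ)) μX μY).real (adjEvent p.1 p.2) := by
  rw [condE_eq, expTwo, expTwo, expThree, expCommon]
  congr 1
  simp only [Prod.fst_swap, Prod.snd_swap, others_swap, adjInd_comm p.2 p.1]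
  have i1 : ∀ s, Integrable (fun ω => ∑ u ∈ others a b p, adjInd p.1 p.2 ω * adjInd s u ω)
      (law a b (fun t : ℕ => (t : ℝ)) μX μY) := fun s =>
    integrable_finsetSum _ fun _ _ => integrable_adjInd_mul _ _ _ _
  have i2 : Integrable (fun ω => ∑ r ∈ (others a b p).offDiag,
      adjInd p.1 p.2 ω * adjInd p.1 r.1 ω * adjInd p.2 r.2 ω)
      (law a b (fun t : ℕ => (t : ℝ)) μX μY) :=
    integrable_finsetSum _ fun _ _ => integrable_adjInd_mul_mul _ _ _ _ _ _
  have i3 : Integrable (fun ω => ∑ u ∈ others a b p,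
      adjInd p.1 p.2 ω * adjInd p.1 u ω * adjInd p.2 u ω)
      (law a b (fun t : ℕ => (t : ℝ)) μX μY) :=
    integrable_finsetSum _ fun _ _ => integrable_adjInd_mul_mul _ _ _ _ _ _
  have i0 := integrable_adjInd (P := law a b (fun t : ℕ => (t : ℝ)) μX μY) p.1 p.2
  have i012 : Integrable (fun ω => adjInd p.1 p.2 ω +
      ∑ u ∈ others a b p, adjInd p.1 p.2 ω * adjInd p.1 u ω +
      ∑ u ∈ others a b p, adjInd p.1 p.2 ω * adjInd p.2 u ω)
      (law a b (fun t : ℕ => (t : ℝ)) μX μY) := (i0.add (i1 p.1)).add (i1 p.2)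
  rw [← integral_adjInd, ← integral_add_add i0 (i1 p.1) (i1 p.2),
    ← integral_add_add i012 i3 i2]
  refine integral_congr_ae ?_
  filter_upwards [ae_deg_eq ha hab p, ae_deg_eq ha hab p.swap] with ω hω hω'
  simp only [Prod.fst_swap, Prod.snd_swap, others_swap, adjInd_comm p.2 p.1] at hω'
  simp only [mul_assoc]
  rw [hω, hω', ← Finset.mul_sum, ← Finset.mul_sum, ← Finset.mul_sum, ← Finset.mul_sum]
  have h1 : (∑ u ∈ others a b p, adjInd p.1 u ω) * ∑ u ∈ others a b p, adjInd p.2 u ω =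
      ∑ u ∈ others a b p, adjInd p.1 u ω * adjInd p.2 u ω +
        ∑ r ∈ (others a b p).offDiag, adjInd p.1 r.1 ω * adjInd p.2 r.2 ω := by
    rw [sum_offDiag_eq, Finset.sum_mul_sum, ← Finset.sum_add_distrib]
    exact Finset.sum_congr rfl fun u hu => sum_split_one hu _
  have h2 := adjInd_mul_self p.1 p.2 ω
  set x := adjInd p.1 p.2 ω
  set S := ∑ u ∈ others a b p, adjInd p.1 u ω
  set S' := ∑ u ∈ others a b p, adjInd p.2 u ω
  have h3 : x * ((x + S) * (x + S')) = (x * x) * x + (x * x) * S + (x * x) * S' +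
      x * (S * S') := by ring
  rw [h3, h2, h2, h1]
  ring

lemma memLp_deg (ha : 0 < a) (hab : a < b) (p : ℕ × ℕ) (s t : ℕ) :
    MemLp (deg p.1) 2 (condLaw (law a b (fun t : ℕ => (t : ℝ)) μX μY) s t) := by
  have hac : condLaw (law a b (fun t : ℕ => (t : ℝ)) μX μY) s t ≪
      law a b (fun t : ℕ => (t : ℝ)) μX μY := cond_absolutelyContinuous
  have h : ∀ᵐ ω ∂(condLaw (law a b (fun t : ℕ => (t : ℝ)) μX μY) s t),
      deg p.1 ω = adjInd p.1 p.2 ω + ∑ u ∈ others a b p, adjInd p.1 u ω :=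
    hac.ae_le (ae_deg_eq ha hab p)
  have hm : Measurable fun ω => adjInd p.1 p.2 ω + ∑ u ∈ others a b p, adjInd p.1 u ω :=
    (measurable_adjInd _ _).add (Finset.measurable_sum _ fun _ _ => measurable_adjInd _ _)
  have : IsFiniteMeasure (condLaw (law a b (fun t : ℕ => (t : ℝ)) μX μY) s t) := by
    unfold condLaw; infer_instance
  refine MemLp.of_bound (hm.aestronglyMeasurable.congr (h.mono fun ω hω => hω.symm))
    (1 + (others a b p).card) (h.mono fun ω hω => ?_)
  rw [hω, Real.norm_of_nonneg (add_nonneg (adjInd_nonneg _ _ _)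
    (Finset.sum_nonneg fun _ _ => adjInd_nonneg _ _ _))]
  refine add_le_add (adjInd_le_one _ _ _) ?_
  exact (Finset.sum_le_card_nsmul _ _ 1 fun _ _ => adjInd_le_one _ _ _).trans (by simp)

end Degrees

/-! ### Positivity of the limiting variance and limits of conditional moments. -/

section Final

variable {a b : ℝ} {μX μY : Measure ℝ≥0} [IsProbabilityMeasure μX] [IsProbabilityMeasure μY]

lemma wmoment_pos {μ : Measure ℝ≥0} {k : ℕ} (h : Integrable (fun x : ℝ≥0 => (x : ℝ) ^ k) μ)
    (h0 : 0 < μ (Set.Ioi 0)) : 0 < wmoment μ k := by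
  rw [wmoment, integral_pos_iff_support_of_nonneg (fun x => by positivity) h]
  refine h0.trans_le (measure_mono fun x hx => ?_)
  have : (0 : ℝ) < x := hx
  exact (pow_pos this k).ne'

/-- Cauchy–Schwarz, obtained from `∫ x^k (x - c)² ≥ 0` with the minimising `c`. -/
lemma sq_wmoment_le {μ : Measure ℝ≥0} [IsProbabilityMeasure μ] {k : ℕ}
    (h : Integrable (fun x : ℝ≥0 => (x : ℝ) ^ (k + 2)) μ) (h0 : 0 < μ (Set.Ioi 0)) :
    wmoment μ (k + 1) ^ 2 ≤ wmoment μ k * wmoment μ (k + 2) := by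
  have i0 := integrable_pow_of_le h (show k ≤ k + 2 by omega)
  have i1 := integrable_pow_of_le h (show k + 1 ≤ k + 2 by omega)
  have hpos := wmoment_pos i0 h0
  set c := wmoment μ (k + 1) / wmoment μ k with hc
  have h1 : 0 ≤ ∫ x : ℝ≥0,
      ((x : ℝ) ^ (k + 2) - (2 * c * (x : ℝ) ^ (k + 1) - c ^ 2 * (x : ℝ) ^ k)) ∂μ := by
    refine integral_nonneg fun x => ?_
    have : (x : ℝ) ^ (k + 2) - (2 * c * (x : ℝ) ^ (k + 1) - c ^ 2 * (x : ℝ) ^ k) =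
        (x : ℝ) ^ k * ((x : ℝ) - c) ^ 2 := by ring
    simp only [Pi.zero_apply]
    rw [this]
    positivity
  rw [integral_sub_sub h (i1.const_mul _) (i0.const_mul _), integral_const_mul,
    integral_const_mul] at h1
  change 0 ≤ wmoment μ (k + 2) - (2 * c * wmoment μ (k + 1) - c ^ 2 * wmoment μ k) at h1
  have h2 : c * wmoment μ k = wmoment μ (k + 1) := by rw [hc]; field_simp
  have h3 : wmoment μ (k + 2) - (2 * c * wmoment μ (k + 1) - c ^ 2 * wmoment μ k) =
      wmoment μ (k + 2) - c * wmoment μ (k + 1) := by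
    rw [sq, mul_assoc, mul_assoc, h2]; ring
  rw [h3] at h1
  nlinarith [mul_nonneg hpos.le h1]

lemma gam_pos (ha : 0 < a) (hab : a < b) : 0 < gam a b := by
  have h : √a < √b := Real.sqrt_lt_sqrt ha.le hab
  have := inv_strictAnti₀ (Real.sqrt_pos.2 ha) h
  rw [gam]
  linarith

lemma variance_limit_pos (ha : 0 < a) (hab : a < b)
    (hX : Integrable (fun x : ℝ≥0 => (x : ℝ) ^ 4) μX)
    (hY : Integrable (fun y : ℝ≥0 => (y : ℝ) ^ 3) μY)
    (hX0 : 0 < μX (Set.Ioi 0)) (hY0 : 0 < μY (Set.Ioi 0)) :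
    0 < δ₂ a b μX μY - δ₁ a b μX μY ^ 2 := by
  have p2 := wmoment_pos (integrable_pow_of_le hX (show 2 ≤ 4 by norm_num)) hX0
  have p3 := wmoment_pos (integrable_pow_of_le hX (show 3 ≤ 4 by norm_num)) hX0
  have q1 := wmoment_pos (integrable_pow_of_le hY (show 1 ≤ 3 by norm_num)) hY0
  have q2 := wmoment_pos (integrable_pow_of_le hY (show 2 ≤ 3 by norm_num)) hY0
  have cX : wmoment μX 3 ^ 2 ≤ wmoment μX 2 * wmoment μX 4 := sq_wmoment_le hX hX0
  have cY : wmoment μY 2 ^ 2 ≤ wmoment μY 1 * wmoment μY 3 := sq_wmoment_le hY hY0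
  have hg := gam_pos ha hab
  have hψ : 0 < √b - √a := sub_pos.2 (Real.sqrt_lt_sqrt ha.le hab)
  rw [δ₂, δ₁, h₁, h₂, h₃, h₄, h₅, h₆]
  set a2 := wmoment μX 2
  set a3 := wmoment μX 3
  set a4 := wmoment μX 4
  set b1 := wmoment μY 1
  set b2 := wmoment μY 2
  set b3 := wmoment μY 3
  set g := gam a b
  set ψ := √b - √a
  -- The expansion isolates the deficits `a2 * a4 - a3 ^ 2` and `b1 * b3 - b2 ^ 2`, which are
  -- nonnegative by Cauchy–Schwarz; the other terms are strictly positive.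
  have e : 1 + (a2 * b1 ^ 2)⁻¹ * (3 * (a3 * b1 ^ 3 * g) + 6 * (a2 ^ 2 * b1 ^ 2 * b2 * g * ψ) +
      a4 * b1 ^ 4 * g ^ 2 + 6 * (a2 * a3 * b1 ^ 3 * b2 * g ^ 2 * ψ) +
      4 * (a2 ^ 3 * b1 ^ 3 * b3 * g ^ 2 * ψ ^ 2)) -
      (1 + (a2 * b1 ^ 2)⁻¹ * (a3 * b1 ^ 3 * g + 2 * (a2 ^ 2 * b1 ^ 2 * b2 * g * ψ))) ^ 2 =
      a3 * b1 * g / a2 + 2 * (a2 * b2 * g * ψ) + 2 * (a3 * b1 * b2 * g ^ 2 * ψ) +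
        b1 ^ 2 * g ^ 2 * (a2 * a4 - a3 ^ 2) / a2 ^ 2 +
        4 * (a2 ^ 2 * g ^ 2 * ψ ^ 2) * (b1 * b3 - b2 ^ 2) := by
    field_simp
    ring
  rw [e]
  have t1 : 0 < a3 * b1 * g / a2 := by positivity
  have t2 : 0 < a2 * b2 * g * ψ := by positivity
  have t3 : 0 < a3 * b1 * b2 * g ^ 2 * ψ := by positivity
  have t4 : 0 ≤ b1 ^ 2 * g ^ 2 * (a2 * a4 - a3 ^ 2) / a2 ^ 2 :=
    div_nonneg (mul_nonneg (by positivity) (sub_nonneg.2 cX)) (by positivity)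
  have t5 : 0 ≤ 4 * (a2 ^ 2 * g ^ 2 * ψ ^ 2) * (b1 * b3 - b2 ^ 2) :=
    mul_nonneg (by positivity) (sub_nonneg.2 cY)
  linarith

lemma h₁_pos (hX : Integrable (fun x : ℝ≥0 => (x : ℝ) ^ 4) μX)
    (hY : Integrable (fun y : ℝ≥0 => (y : ℝ) ^ 3) μY)
    (hX0 : 0 < μX (Set.Ioi 0)) (hY0 : 0 < μY (Set.Ioi 0)) : 0 < h₁ μX μY :=
  mul_pos (wmoment_pos (integrable_pow_of_le hX (show 2 ≤ 4 by norm_num)) hX0)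
    (pow_pos (wmoment_pos (integrable_pow_of_le hY (show 1 ≤ 3 by norm_num)) hY0) 2)

variable {l : Filter (ℕ × ℕ)}

/-- Numerator and denominator are both proportional to `pairNorm` in the limit, and it cancels
wherever it is positive. -/
lemma tendsto_div_law (ha : 0 < a) (hab : a < b)
    (hX : Integrable (fun x : ℝ≥0 => (x : ℝ) ^ 4) μX)
    (hY : Integrable (fun y : ℝ≥0 => (y : ℝ) ^ 3) μY)
    (hX0 : 0 < μX (Set.Ioi 0)) (hY0 : 0 < μY (Set.Ioi 0)) (hl : IsPairFilter a b l)
    {E F : ℕ × ℕ → ℝ} {C : ℝ} (hE : Tendsto (fun p => E p / pairNorm a b p) l (𝓝 C))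
    (hF : ∀ p : ℕ × ℕ, F p =
      ((law a b (fun t : ℕ => (t : ℝ)) μX μY).real (adjEvent p.1 p.2) + E p) /
        (law a b (fun t : ℕ => (t : ℝ)) μX μY).real (adjEvent p.1 p.2)) :
    Tendsto F l (𝓝 (1 + (h₁ μX μY)⁻¹ * C)) := by
  have h0 := (h₁_pos hX hY hX0 hY0).ne'
  have h := tendsto_law_adjEvent ha hab hX hY hl
  have h1 := (h.add hE).div h h0
  have e : (h₁ μX μY + C) / h₁ μX μY = 1 + (h₁ μX μY)⁻¹ * C := by field_simp
  rw [e] at h1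
  refine h1.congr' ?_
  filter_upwards [hl.pos] with p hpos
  rw [Pi.div_apply]
  rw [hF p, ← add_div, div_div_div_cancel_right₀ hpos.ne']

lemma tendsto_condE_deg (ha : 0 < a) (hab : a < b)
    (hX : Integrable (fun x : ℝ≥0 => (x : ℝ) ^ 4) μX)
    (hY : Integrable (fun y : ℝ≥0 => (y : ℝ) ^ 3) μY)
    (hX0 : 0 < μX (Set.Ioi 0)) (hY0 : 0 < μY (Set.Ioi 0)) (hl : IsPairFilter a b l) :
    Tendsto (fun p : ℕ × ℕ => condE (law a b (fun t : ℕ => (t : ℝ)) μX μY) p.1 p.2 (deg p.1)) l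
      (𝓝 (δ₁ a b μX μY)) :=
  tendsto_div_law ha hab hX hY hX0 hY0 hl (tendsto_expTwo ha hab hX hY hl) (condE_deg ha hab)

lemma tendsto_condE_deg_sq (ha : 0 < a) (hab : a < b)
    (hX : Integrable (fun x : ℝ≥0 => (x : ℝ) ^ 4) μX)
    (hY : Integrable (fun y : ℝ≥0 => (y : ℝ) ^ 3) μY)
    (hX0 : 0 < μX (Set.Ioi 0)) (hY0 : 0 < μY (Set.Ioi 0)) (hl : IsPairFilter a b l) :
    Tendsto (fun p : ℕ × ℕ =>
      condE (law a b (fun t : ℕ => (t : ℝ)) μX μY) p.1 p.2 (fun ω => deg p.1 ω ^ 2)) l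
      (𝓝 (δ₂ a b μX μY)) := by
  have h := tendsto_div_law ha hab hX hY hX0 hY0 hl
    (F := fun p =>
      condE (law a b (fun t : ℕ => (t : ℝ)) μX μY) p.1 p.2 (fun ω => deg p.1 ω ^ 2))
    (E := fun p => 3 * expTwo a b μX μY p + expThree a b μX μY p p.1 p.1)
    (((tendsto_expTwo ha hab hX hY hl).const_mul 3 |>.add
      (tendsto_expThree_ss ha hab hX hY hl)).congr fun p => by ring)
    (fun p => by rw [condE_deg_sq ha hab p, add_assoc])
  convert h using 2
  rw [δ₂]; ring

lemma tendsto_condE_deg_mul (ha : 0 < a) (hab : a < b)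
    (hX : Integrable (fun x : ℝ≥0 => (x : ℝ) ^ 4) μX)
    (hY : Integrable (fun y : ℝ≥0 => (y : ℝ) ^ 3) μY)
    (hX0 : 0 < μX (Set.Ioi 0)) (hY0 : 0 < μY (Set.Ioi 0)) (hl : IsPairFilter a b l) :
    Tendsto (fun p : ℕ × ℕ =>
      condE (law a b (fun t : ℕ => (t : ℝ)) μX μY) p.1 p.2 (fun ω => deg p.1 ω * deg p.2 ω)) l
      (𝓝 (δ₂ a b μX μY - bigDelta a b μX μY)) := by
  have hs : Tendsto (fun p : ℕ × ℕ => expTwo a b μX μY p.swap / pairNorm a b p) l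
      (𝓝 (h₂ a b μX μY + 2 * h₃ a b μX μY)) :=
    (tendsto_map'_iff.1 (tendsto_expTwo ha hab hX hY hl.swap)).congr fun p => by
      simp only [Function.comp, pairNorm_swap]
  have h := tendsto_div_law ha hab hX hY hX0 hY0 hl
    (F := fun p =>
      condE (law a b (fun t : ℕ => (t : ℝ)) μX μY) p.1 p.2 (fun ω => deg p.1 ω * deg p.2 ω))
    (E := fun p => expTwo a b μX μY p + expTwo a b μX μY p.swap + expCommon a b μX μY p +
      expThree a b μX μY p p.1 p.2)
    (((((tendsto_expTwo ha hab hX hY hl).add hs).add (tendsto_expCommon ha hab hX hY hl)).add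
      (tendsto_expThree_st ha hab hX hY hl)).congr fun p => by ring)
    (fun p => by rw [condE_deg_mul ha hab p]; ring)
  convert h using 2
  rw [δ₂, bigDelta]; ring

end Final

end RandomIntersection

end

theorem mainTheorem4 (a b : ℝ) (ha : 0 < a) (hab : a < b)
    (μX μY : Measure ℝ≥0) [IsProbabilityMeasure μX] [IsProbabilityMeasure μY]
    (hX : Integrable (fun x : ℝ≥0 => (x : ℝ) ^ 4) μX)
    (hY : Integrable (fun y : ℝ≥0 => (y : ℝ) ^ 3) μY)
    (hX0 : 0 < μX (Set.Ioi 0)) (hY0 : 0 < μY (Set.Ioi 0))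
    (P : Measure Sample)
    (hP : P = law a b (fun t : ℕ => (t : ℝ)) μX μY) :
    (∀ᶠ p in pairLimit a b,
      0 < P (adjEvent p.1 p.2) ∧
      MemLp (deg p.1) 2 (condLaw P p.1 p.2) ∧
      MemLp (deg p.2) 2 (condLaw P p.1 p.2)) ∧
    Tendsto (fun p : ℕ × ℕ => condE P p.1 p.2 (deg p.1))
      (pairLimit a b) (𝓝 (δ₁ a b μX μY)) ∧
    Tendsto (fun p : ℕ × ℕ => condE P p.1 p.2 (deg p.2))
      (pairLimit a b) (𝓝 (δ₁ a b μX μY)) ∧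
    Tendsto (fun p : ℕ × ℕ =>
        condE P p.1 p.2 (fun ω => deg p.1 ω ^ 2))
      (pairLimit a b) (𝓝 (δ₂ a b μX μY)) ∧
    Tendsto (fun p : ℕ × ℕ =>
        condE P p.1 p.2 (fun ω => deg p.2 ω ^ 2))
      (pairLimit a b) (𝓝 (δ₂ a b μX μY)) ∧
    Tendsto (fun p : ℕ × ℕ => condE P p.1 p.2
        (fun ω => deg p.1 ω * deg p.2 ω))
      (pairLimit a b)
      (𝓝 (δ₂ a b μX μY - bigDelta a b μX μY)) ∧
    0 < δ₂ a b μX μY - δ₁ a b μX μY ^ 2 ∧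
    Tendsto (fun p : ℕ × ℕ => assortativity P p.1 p.2)
      (pairLimit a b)
      (𝓝 (1 - bigDelta a b μX μY /
        (δ₂ a b μX μY - δ₁ a b μX μY ^ 2))) := by
  subst hP
  have hl := isPairFilter_pairLimit ha hab
  have t1 := tendsto_condE_deg ha hab hX hY hX0 hY0 hl
  have t2 := tendsto_condE_deg_sq ha hab hX hY hX0 hY0 hl
  have t3 := tendsto_condE_deg_mul ha hab hX hY hX0 hY0 hl
  -- The limits for the second actor come from those for the first one along the swapped filter, as
  -- conditioning on `v_s ∼ v_t` is symmetric.
  have s1 : Tendsto (fun p : ℕ × ℕ =>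
      condE (law a b (fun t : ℕ => (t : ℝ)) μX μY) p.1 p.2 (deg p.2)) (pairLimit a b)
      (𝓝 (δ₁ a b μX μY)) :=
    (tendsto_map'_iff.1 (tendsto_condE_deg ha hab hX hY hX0 hY0 hl.swap)).congr fun p =>
      condE_comm _ _ _ _
  have s2 : Tendsto (fun p : ℕ × ℕ =>
      condE (law a b (fun t : ℕ => (t : ℝ)) μX μY) p.1 p.2 (fun ω => deg p.2 ω ^ 2))
      (pairLimit a b) (𝓝 (δ₂ a b μX μY)) :=
    (tendsto_map'_iff.1 (tendsto_condE_deg_sq ha hab hX hY hX0 hY0 hl.swap)).congr fun p =>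
      condE_comm _ _ _ _
  have hpos := variance_limit_pos ha hab hX hY hX0 hY0
  refine ⟨?_, t1, s1, t2, s2, t3, hpos, ?_⟩
  · filter_upwards [hl.pos, (tendsto_law_adjEvent ha hab hX hY hl).eventually_const_lt
      (h₁_pos hX hY hX0 hY0)] with p hn h
    refine ⟨?_, memLp_deg ha hab p _ _, memLp_deg ha hab p.swap _ _⟩
    rw [div_pos_iff_of_pos_right hn] at h
    exact (ENNReal.toReal_pos_iff.1 h).1
  · have v1 := t2.sub (t1.pow 2)
    have v2 := s2.sub (s1.pow 2)
    have hne : √((δ₂ a b μX μY - δ₁ a b μX μY ^ 2) * (δ₂ a b μX μY - δ₁ a b μX μY ^ 2)) ≠ 0 := by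
      rw [Real.sqrt_mul_self hpos.le]; exact hpos.ne'
    have h := (t3.sub (t1.mul s1)).div (v1.mul v2).sqrt hne
    rw [Real.sqrt_mul_self hpos.le] at h
    -- Both conditional variances tend to `δ₂ - δ₁²`, so the square root of their product does too,
    -- and the limiting covariance is this variance minus `Δ`.
    have e : (δ₂ a b μX μY - bigDelta a b μX μY - δ₁ a b μX μY * δ₁ a b μX μY) /
        (δ₂ a b μX μY - δ₁ a b μX μY ^ 2) =
        1 - bigDelta a b μX μY / (δ₂ a b μX μY - δ₁ a b μX μY ^ 2) := by
      rw [eq_sub_iff_add_eq, ← add_div, div_eq_one_iff_eq hpos.ne']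
      ring
    rw [e] at h
    exact h
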